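/- **Conventions.** Let $K$ be a field. Algebras over $K$ are associative, possibly without unit, with non-degenerate product; $M(A)$ is the multiplier algebra and $\iota$ the identity map. A *multiplier Hopf algebra* is an algebra $A$ with a homomorphism $\Delta:A\to M(A\otimes A)$ such that $\Delta(a)(1\otimes b)$ and $(a\otimes1)\Delta(b)$ lie in $A\otimes A$ for all $a,b\in A$, such that $(a\otimes1\otimes1)(\Delta\otimes\iota)(\Delta(b)(1\otimes c))=(\iota\otimes\Delta)((a\otimes1)\Delta(b))(1\otimes1\otimes c)$ for all $a,b,c\in A$, and such that the linear maps $a\otimes b\mapsto\Delta(a)(1\otimes b)$ and $a\otimes b\mapsto(a\otimes1)\Delta(b)$ of $A\otimes A$ are bijective. It is *regular* if $(A,\Delta^{\rm cop})$ is a multiplier Hopf algebra too; it then has a unique counit $\varepsilon$ and a unique antipode $S:A\to A$, which is bijective. We use Sweedler notation $\Delta(a)=a_{(1)}\otimes a_{(2)}$. Let $A,B$ be regular multiplier Hopf algebras over $K$ and let $\langle\cdot,\cdot\rangle:A\times B\to K$ be a *pairing*: a non-degenerate bilinear form such that the multipliers $$b\blacktriangleright a=\langle a_{(2)},b\rangle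 a_{(1)},\quad a\blacktriangleleft b=\langle a_{(1)},b\rangle a_{(2)},\quad a\blacktriangleright b=\langle a,b_{(2)}\rangle b_{(1)},\quad b\blacktriangleleft a=\langle a,b_{(1)}\rangle b_{(2)}$$ belong to $A$, $A$, $B$, $B$ respectively, such that for all $a,a'\in A$, $b,b'\in B$ $$\langle a,bb'\rangle=\langle b'\blacktriangleright a,b\rangle=\langle a\blacktriangleleft b,b'\rangle,\qquad \langle aa',b\rangle=\langle a,a'\blacktriangleright b\rangle=\langle a',b\blacktriangleleft a\rangle,$$ and such that these four actions are unital ($B\blacktriangleright A=A$, $A\blacktriangleleft B=A$, $A\blacktriangleright B=B$, $B\blacktriangleleft A=B$). The *Drinfel'd double* $\mathscr D=A\bowtie B$ and the *Heisenberg double* $\mathscr H=A\#B$ both have underlying space $A\otimes B$. Their products, and the comultiplication of $\mathscr D$, are $$(a\bowtie b)(a'\bowtie b')=a\big(b_{(1)}\blacktriangleright a'\blacktriangleleft S^{-1}(b_{(3)})\big)\bowtie b_{(2)}b',\qquad (a\#b)(a'\#b')=a(b_{(1)}\blacktriangleright a')\#b_{(2)}b',$$ $$\Delta_{\mathscr D}(a\bowtie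 b)=\Delta^{\rm cop}(a)\Delta(b)=(a_{(2)}\bowtie b_{(1)})\otimes(a_{(1)}\bowtie b_{(2)}).$$ For a vector space $X$, the *completed module* $M_0(\mathscr D\otimes X)$ consists of the pairs $y$ of linear maps $\mathscr D\to\mathscr D\otimes X$, written $x\mapsto(x\otimes1)y$ and $x\mapsto y(x\otimes1)$, such that $(x'\otimes1)\big(y(x\otimes1)\big)=\big((x'\otimes1)y\big)(x\otimes1)$ for all $x,x'\in\mathscr D$. If $X$ is an algebra, $M_0(\mathscr D\otimes X)$ has the product given by $(x\otimes1)(yz)=((x\otimes1)y)z$ and $(yz)(x\otimes1)=y(z(x\otimes1))$, where $(x\otimes h)z=(1\otimes h)((x\otimes1)z)$ and $y(x\otimes h)=(y(x\otimes1))(1\otimes h)$. **Proposition 3.5.** There is exactly one linear map $\Gamma:\mathscr H\to M_0(\mathscr D\otimes\mathscr H)$ such that $$(x\otimes1)\,\Gamma(a\#b)=x(a_{(2)}\bowtie b_{(1)})\otimes(a_{(1)}\#b_{(2)})\qquad(x\in\mathscr D,\ a\in A,\ b\in B),$$ and it makes $\mathscr H$ a left $\mathscr D$-comodule algebra, that is: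 1. $\mathscr H$ is an associative algebra with non-degenerate product; 2. $\Gamma$ is injective; 3. $\Gamma$ is coassociative, $(\Delta_{\mathscr D}\otimes\iota)\Gamma=(\iota\otimes\Gamma)\Gamma$, in the sense that for all $p,q\in\mathscr D$ and $h\in\mathscr H$ $$(p\otimes1\otimes1)\,(\Delta_{\mathscr D}\otimes\iota)\big((q\otimes1)\Gamma(h)\big)=\big((p\otimes1)\Delta_{\mathscr D}(q)\otimes1\big)\,(\iota\otimes\Gamma)\Gamma(h),$$ where $(x\otimes y\otimes1)(\iota\otimes\Gamma)\Gamma(h)=(1\otimes y\otimes1)(\iota\otimes\Gamma)\big((x\otimes1)\Gamma(h)\big)$ for $x,y\in\mathscr D$; 4. $\Gamma$ is multiplicative, $\Gamma(hk)=\Gamma(h)\Gamma(k)$ in $M_0(\mathscr D\otimes\mathscr H)$ for all $h,k\in\mathscr H$. -/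

import Mathlib

open scoped TensorProduct

/-! ## Algebras without unit, multiplier algebras -/

/-- The multiplication of an algebra, viewed as a bilinear map, is non-degenerate. -/
def NondegenerateMul {K V : Type*} [Field K] [AddCommGroup V] [Module K V]
    (μ : V →ₗ[K] V →ₗ[K] V) : Prop :=
  (∀ x, (∀ y, μ x y = 0) → x = 0) ∧ (∀ y, (∀ x, μ x y = 0) → y = 0)

/-- The multiplication is associative. -/
def AssociativeMul {K V : Type*} [Field K] [AddCommGroup V] [Module K V]
    (μ : V →ₗ[K] V →ₗ[K] V) : Prop :=
  ∀ x y z, μ (μ x y) z = μ x (μ y z)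

/-- The multiplier algebra `M(R)`: pairs `m = (L, ρ)` of linear maps, `L x = m x` and `ρ x = x m`,
that satisfy `m (x y) = (m x) y`, `(x y) m = x (y m)` and `x (m y) = (x m) y`. -/
def MultiplierAlgebra (K R : Type*) [Field K] [NonUnitalRing R] [Module K R]
    [IsScalarTower K R R] [SMulCommClass K R R] :
    Subalgebra K (Module.End K R × (Module.End K R)ᵐᵒᵖ) where
  carrier := {m | (∀ x y, m.1 (x * y) = m.1 x * y) ∧
    (∀ x y, m.2.unop (x * y) = x * m.2.unop y) ∧
    (∀ x y, x * m.1 y = m.2.unop x * y)}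
  mul_mem' := by
    rintro a b ⟨ha1, ha2, ha3⟩ ⟨hb1, hb2, hb3⟩
    refine ⟨fun x y => ?_, fun x y => ?_, fun x y => ?_⟩
    · simp [hb1, ha1]
    · simp [hb2, ha2]
    · simp [ha3, hb3]
  add_mem' := by
    rintro a b ⟨ha1, ha2, ha3⟩ ⟨hb1, hb2, hb3⟩
    refine ⟨fun x y => ?_, fun x y => ?_, fun x y => ?_⟩
    · simp [hb1, ha1, add_mul]
    · simp [hb2, ha2, mul_add]
    · simp [ha3, hb3, add_mul, mul_add]
  algebraMap_mem' := by
    intro r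
    refine ⟨fun x y => ?_, fun x y => ?_, fun x y => ?_⟩ <;>
      simp [Algebra.algebraMap_eq_smul_one, smul_mul_assoc, mul_smul_comm]

namespace MultiplierAlgebra

variable {K R R' : Type*} [Field K]
  [NonUnitalRing R] [Module K R] [IsScalarTower K R R] [SMulCommClass K R R]
  [NonUnitalRing R'] [Module K R'] [IsScalarTower K R' R'] [SMulCommClass K R' R']

/-- Left multiplication by a multiplier, `x ↦ m x`. -/
def left (m : MultiplierAlgebra K R) : R →ₗ[K] R := m.1.1

/-- Right multiplication by a multiplier, `x ↦ x m`. -/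
def right (m : MultiplierAlgebra K R) : R →ₗ[K] R := m.1.2.unop

/-- An element of `R`, viewed as a multiplier. -/
def ofElem (K : Type*) {R : Type*} [Field K] [NonUnitalRing R] [Module K R]
    [IsScalarTower K R R] [SMulCommClass K R R] (r : R) : MultiplierAlgebra K R :=
  ⟨(LinearMap.mulLeft K r, MulOpposite.op (LinearMap.mulRight K r)),
    fun x y => by simp [mul_assoc], fun x y => by simp [mul_assoc],
    fun x y => by simp [mul_assoc]⟩

/-- The multiplier `m ⊗ n` of `R ⊗ R'`. -/
noncomputable def tmul (m : MultiplierAlgebra K R) (n : MultiplierAlgebra K R') :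
    MultiplierAlgebra K (R ⊗[K] R') :=
  ⟨(TensorProduct.map (left m) (left n), MulOpposite.op (TensorProduct.map (right m) (right n))), by
    obtain ⟨m, hm1, hm2, hm3⟩ := m
    obtain ⟨n, hn1, hn2, hn3⟩ := n
    refine ⟨fun x y => ?_, fun x y => ?_, fun x y => ?_⟩ <;>
    · induction x using TensorProduct.induction_on with
      | zero => simp
      | add x₁ x₂ h₁ h₂ => simp_all [add_mul]
      | tmul a b =>
        induction y using TensorProduct.induction_on with
        | zero => simp
        | add y₁ y₂ h₁ h₂ => simp_all [mul_add]
        | tmul c d =>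
          simp_all [left, right, Algebra.TensorProduct.tmul_mul_tmul]⟩

/-- The flip map of `R ⊗ R`, extended to the multiplier algebra. -/
noncomputable def flip (m : MultiplierAlgebra K (R ⊗[K] R)) : MultiplierAlgebra K (R ⊗[K] R) :=
  ⟨((TensorProduct.comm K R R).toLinearMap ∘ₗ left m ∘ₗ (TensorProduct.comm K R R).toLinearMap,
    MulOpposite.op ((TensorProduct.comm K R R).toLinearMap ∘ₗ right m ∘ₗ
      (TensorProduct.comm K R R).toLinearMap)), by
    have hc : ∀ x y : R ⊗[K] R, TensorProduct.comm K R R (x * y) =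
        TensorProduct.comm K R R x * TensorProduct.comm K R R y := by
      intro x y
      induction x using TensorProduct.induction_on with
      | zero => simp
      | add x₁ x₂ h₁ h₂ => simp_all [add_mul]
      | tmul a b =>
        induction y using TensorProduct.induction_on with
        | zero => simp
        | add y₁ y₂ h₁ h₂ => simp_all [mul_add]
        | tmul c d => simp [Algebra.TensorProduct.tmul_mul_tmul]
    have hcc : ∀ x : R ⊗[K] R, TensorProduct.comm K R R (TensorProduct.comm K R R x) = x :=
      fun x => (TensorProduct.comm K R R).symm_apply_apply x
    obtain ⟨m, hm1, hm2, hm3⟩ := m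
    refine ⟨fun x y => ?_, fun x y => ?_, fun x y => ?_⟩
    · simp [left, hc, hm1, hcc]
    · simp [right, hc, hm2, hcc]
    · have := congrArg (TensorProduct.comm K R R)
        (hm3 (TensorProduct.comm K R R x) (TensorProduct.comm K R R y))
      simpa [left, right, hc, hcc] using this⟩

end MultiplierAlgebra

/-! ## Regular multiplier Hopf algebras -/

section Hopf

variable (K A : Type*) [Field K] [NonUnitalRing A] [Module K A] [IsScalarTower K A A]
  [SMulCommClass K A A]

open MultiplierAlgebra

/-- A multiplier Hopf algebra `(A, Δ)`. The linear maps `T₁`, `T₂` witness that `Δ(a)(1 ⊗ b)` and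
`(a ⊗ 1)Δ(b)` lie in `A ⊗ A`; they are determined by `Δ`. -/
structure MultiplierHopfAlgebra where
  nondeg : NondegenerateMul (LinearMap.mul K A)
  /-- The comultiplication, a homomorphism `A → M(A ⊗ A)`. -/
  Δ : A →ₙₐ[K] MultiplierAlgebra K (A ⊗[K] A)
  /-- `T₁(a ⊗ b) = Δ(a)(1 ⊗ b)`. -/
  T₁ : A ⊗[K] A →ₗ[K] A ⊗[K] A
  /-- `T₂(a ⊗ b) = (a ⊗ 1)Δ(b)`. -/
  T₂ : A ⊗[K] A →ₗ[K] A ⊗[K] A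
  T₁_spec : ∀ a b, ofElem K (T₁ (a ⊗ₜ b)) = Δ a * tmul 1 (ofElem K b)
  T₂_spec : ∀ a b, ofElem K (T₂ (a ⊗ₜ b)) = tmul (ofElem K a) 1 * Δ b
  /-- `(a ⊗ 1 ⊗ 1)(Δ ⊗ ι)(Δ(b)(1 ⊗ c)) = (ι ⊗ Δ)((a ⊗ 1)Δ(b))(1 ⊗ 1 ⊗ c)`. -/
  coassoc : ∀ a b c,
    TensorProduct.assoc K A A A
      (T₂.rTensor A ((TensorProduct.assoc K A A A).symm (a ⊗ₜ T₁ (b ⊗ₜ c)))) =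
    T₁.lTensor A (TensorProduct.assoc K A A A (T₂ (a ⊗ₜ b) ⊗ₜ c))
  bijective_T₁ : Function.Bijective T₁
  bijective_T₂ : Function.Bijective T₂

/-- A multiplier Hopf algebra `(A, Δ)` is regular if `(A, Δ^cop)` is a multiplier Hopf algebra
too. -/
structure RegularMultiplierHopfAlgebra extends MultiplierHopfAlgebra K A where
  /-- The multiplier Hopf algebra `(A, Δ^cop)`. -/
  cop : MultiplierHopfAlgebra K A
  cop_Δ : ∀ a, cop.Δ a = MultiplierAlgebra.flip (Δ a)

namespace RegularMultiplierHopfAlgebra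

variable {K A} (H : RegularMultiplierHopfAlgebra K A)

/-- `Δ(a)(1 ⊗ a') = a₍₁₎ ⊗ a₍₂₎ a'`. -/
def coverSnd (a a' : A) : A ⊗[K] A := H.T₁ (a ⊗ₜ a')

/-- `Δ(a)(a' ⊗ 1) = a₍₁₎ a' ⊗ a₍₂₎`. -/
noncomputable def coverFst (a a' : A) : A ⊗[K] A :=
  TensorProduct.comm K A A (H.cop.T₁ (a ⊗ₜ a'))

theorem ofElem_coverSnd (a a' : A) :
    ofElem K (H.coverSnd a a') = H.Δ a * tmul 1 (ofElem K a') :=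
  H.T₁_spec a a'

/-- `ε` is the counit: a homomorphism with `(ε ⊗ ι)(Δ(a)(1 ⊗ b)) = ab` and
`(ι ⊗ ε)((a ⊗ 1)Δ(b)) = ab`. -/
def IsCounit (ε : A →ₙₐ[K] K) : Prop :=
  (∀ a b, TensorProduct.lid K A ((ε : A →ₗ[K] K).rTensor A (H.T₁ (a ⊗ₜ b))) = a * b) ∧
  (∀ a b, TensorProduct.rid K A ((ε : A →ₗ[K] K).lTensor A (H.T₂ (a ⊗ₜ b))) = a * b)

/-- `S` is the antipode: a bijective anti-homomorphism with
`m((S ⊗ ι)(Δ(a)(1 ⊗ b))) = ε(a) b` and `m((ι ⊗ S)((a ⊗ 1)Δ(b))) = ε(b) a`. -/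
def IsAntipode (S : A ≃ₗ[K] A) : Prop :=
  (∀ a b, S (a * b) = S b * S a) ∧
  ∃ ε : A →ₙₐ[K] K, H.IsCounit ε ∧
    (∀ a b, LinearMap.mul' K A (S.toLinearMap.rTensor A (H.T₁ (a ⊗ₜ b))) = ε a • b) ∧
    (∀ a b, LinearMap.mul' K A (S.toLinearMap.lTensor A (H.T₂ (a ⊗ₜ b))) = ε b • a)

/-- The antipode. A regular multiplier Hopf algebra has exactly one. -/
noncomputable def antipode : A ≃ₗ[K] A :=
  Classical.epsilon H.IsAntipode

end RegularMultiplierHopfAlgebra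

end Hopf

/-! ## Pairings -/

section Pairing

variable {K A B : Type*} [Field K]
  [NonUnitalRing A] [Module K A] [IsScalarTower K A A] [SMulCommClass K A A]
  [NonUnitalRing B] [Module K B] [IsScalarTower K B B] [SMulCommClass K B B]

/-- A pairing of two regular multiplier Hopf algebras: a non-degenerate bilinear form for which the
multipliers `b ▶ a`, `a ◀ b` of `A` and `a ▶ b`, `b ◀ a` of `B` are elements of `A`, respectively
`B` (they are determined by the form), the product of each algebra is dual to the coproduct of the
other one, and the four actions are unital. -/
structure MultiplierHopfPairing (HA : RegularMultiplierHopfAlgebra K A)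
    (HB : RegularMultiplierHopfAlgebra K B) where
  /-- The form `⟨a, b⟩`. -/
  form : A →ₗ[K] B →ₗ[K] K
  nondegenerate : form.Nondegenerate
  /-- `b ▶ a = ⟨a₍₂₎, b⟩ a₍₁₎`. -/
  lactA : B →ₗ[K] A →ₗ[K] A
  /-- `a ◀ b = ⟨a₍₁₎, b⟩ a₍₂₎`. -/
  ractA : A →ₗ[K] B →ₗ[K] A
  /-- `a ▶ b = ⟨a, b₍₂₎⟩ b₍₁₎`. -/
  lactB : A →ₗ[K] B →ₗ[K] B
  /-- `b ◀ a = ⟨a, b₍₁₎⟩ b₍₂₎`. -/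
  ractB : B →ₗ[K] A →ₗ[K] B
  /-- `(b ▶ a) a' = ⟨a₍₂₎, b⟩ a₍₁₎ a'`. -/
  lactA_mul : ∀ b a a', lactA b a * a' =
    TensorProduct.rid K A ((form.flip b).lTensor A (HA.coverFst a a'))
  /-- `(a ◀ b) a' = ⟨a₍₁₎, b⟩ a₍₂₎ a'`. -/
  ractA_mul : ∀ a b a', ractA a b * a' =
    TensorProduct.lid K A ((form.flip b).rTensor A (HA.coverSnd a a'))
  /-- `(a ▶ b) b' = ⟨a, b₍₂₎⟩ b₍₁₎ b'`. -/
  lactB_mul : ∀ a b b', lactB a b * b' =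
    TensorProduct.rid K B ((form a).lTensor B (HB.coverFst b b'))
  /-- `(b ◀ a) b' = ⟨a, b₍₁₎⟩ b₍₂₎ b'`. -/
  ractB_mul : ∀ b a b', ractB b a * b' =
    TensorProduct.lid K B ((form a).rTensor B (HB.coverSnd b b'))
  /-- `⟨a, b b'⟩ = ⟨a₍₁₎, b⟩ ⟨a₍₂₎, b'⟩`, the right side read as `⟨b' ▶ a, b⟩`. -/
  form_mul_right : ∀ a b b', form a (b * b') = form (lactA b' a) b
  /-- `⟨a, b b'⟩ = ⟨a₍₁₎, b⟩ ⟨a₍₂₎, b'⟩`, the right side read as `⟨a ◀ b, b'⟩`. -/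
  form_mul_right' : ∀ a b b', form a (b * b') = form (ractA a b) b'
  /-- `⟨a a', b⟩ = ⟨a, b₍₁₎⟩ ⟨a', b₍₂₎⟩`, the right side read as `⟨a, a' ▶ b⟩`. -/
  form_mul_left : ∀ a a' b, form (a * a') b = form a (lactB a' b)
  /-- `⟨a a', b⟩ = ⟨a, b₍₁₎⟩ ⟨a', b₍₂₎⟩`, the right side read as `⟨a', b ◀ a⟩`. -/
  form_mul_left' : ∀ a a' b, form (a * a') b = form a' (ractB b a)
  /-- `B ▶ A = A`. -/
  unital_lactA : Function.Surjective (TensorProduct.lift lactA)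
  /-- `A ◀ B = A`. -/
  unital_ractA : Function.Surjective (TensorProduct.lift ractA)
  /-- `A ▶ B = B`. -/
  unital_lactB : Function.Surjective (TensorProduct.lift lactB)
  /-- `B ◀ A = B`. -/
  unital_ractB : Function.Surjective (TensorProduct.lift ractB)

namespace MultiplierHopfPairing

variable {HA : RegularMultiplierHopfAlgebra K A} {HB : RegularMultiplierHopfAlgebra K B}
  (P : MultiplierHopfPairing HA HB)

/-! ### The Heisenberg double -/

/-- The product of the Heisenberg double `ℋ = A # B`, the smash product on the space `A ⊗ B`:
`(a # b)(a' # b') = a (b₍₁₎ ▶ a') # b₍₂₎ b'`. -/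
noncomputable def heisenbergMul : A ⊗[K] B →ₗ[K] A ⊗[K] B →ₗ[K] A ⊗[K] B :=
  TensorProduct.curry
    ((LinearMap.mul' K A ∘ₗ
        (TensorProduct.lift P.lactA.flip).lTensor A ∘ₗ
        (TensorProduct.assoc K A A B).toLinearMap).rTensor B ∘ₗ
      (TensorProduct.assoc K (A ⊗[K] A) B B).symm.toLinearMap ∘ₗ
      HB.T₁.lTensor (A ⊗[K] A) ∘ₗ
      (TensorProduct.tensorTensorTensorComm K A B A B).toLinearMap)

theorem heisenbergMul_tmul (a a' : A) (b b' : B) :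
    P.heisenbergMul (a ⊗ₜ b) (a' ⊗ₜ b') =
      (LinearMap.mulLeft K a ∘ₗ P.lactA.flip a').rTensor B (HB.coverSnd b b') := by
  simp only [heisenbergMul, RegularMultiplierHopfAlgebra.coverSnd, TensorProduct.curry_apply,
    LinearMap.comp_apply, LinearEquiv.coe_coe, TensorProduct.tensorTensorTensorComm_tmul,
    LinearMap.lTensor_tmul]
  induction HB.T₁ (b ⊗ₜ b') using TensorProduct.induction_on with
  | zero => simp
  | add x y hx hy => simp only [TensorProduct.tmul_add, map_add, hx, hy]
  | tmul x y => simp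

/-! ### The Drinfel'd double -/

/-- `R(b ⊗ a) = b₍₁₎ ▶ a ⊗ b₍₂₎`, expressed by multiplying the second leg by `b'`:
`R(b ⊗ a)(1 ⊗ b') = b₍₁₎ ▶ a ⊗ b₍₂₎ b'`. -/
def IsLeftTwist (R : B ⊗[K] A →ₗ[K] A ⊗[K] B) : Prop :=
  ∀ b a b', (LinearMap.mulRight K b').lTensor A (R (b ⊗ₜ a)) =
    (P.lactA.flip a).rTensor B (HB.coverSnd b b')

/-- `R(a ⊗ b) = a ◀ S⁻¹(b₍₂₎) ⊗ b₍₁₎`, expressed by multiplying the second leg by `b'`: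
`R(a ⊗ b)(1 ⊗ b') = a ◀ S⁻¹(b₍₂₎) ⊗ b₍₁₎ b'`. -/
def IsRightTwist (R : A ⊗[K] B →ₗ[K] A ⊗[K] B) : Prop :=
  ∀ a b b', (LinearMap.mulRight K b').lTensor A (R (a ⊗ₜ b)) =
    (P.ractA a ∘ₗ HB.antipode.symm.toLinearMap).rTensor B
      (TensorProduct.comm K B B (HB.coverFst b b'))

/-- The unique linear map `b ⊗ a ↦ b₍₁₎ ▶ a ⊗ b₍₂₎`. -/
noncomputable def leftTwist : B ⊗[K] A →ₗ[K] A ⊗[K] B := Classical.epsilon P.IsLeftTwist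

/-- The unique linear map `a ⊗ b ↦ a ◀ S⁻¹(b₍₂₎) ⊗ b₍₁₎`. -/
noncomputable def rightTwist : A ⊗[K] B →ₗ[K] A ⊗[K] B := Classical.epsilon P.IsRightTwist

/-- The twist map `T(b ⊗ a) = b₍₁₎ ▶ a ◀ S⁻¹(b₍₃₎) ⊗ b₍₂₎`. -/
noncomputable def twist : B ⊗[K] A →ₗ[K] A ⊗[K] B := P.rightTwist ∘ₗ P.leftTwist

/-- The product of the Drinfel'd double `𝒟 = A ⋈ B` on the space `A ⊗ B`:
`(a ⋈ b)(a' ⋈ b') = (m ⊗ m)(ι ⊗ T ⊗ ι)(a ⊗ b ⊗ a' ⊗ b')`. -/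
noncomputable def doubleMul : A ⊗[K] B →ₗ[K] A ⊗[K] B →ₗ[K] A ⊗[K] B :=
  TensorProduct.curry
    (TensorProduct.map (LinearMap.mul' K A) (LinearMap.mul' K B) ∘ₗ
      (TensorProduct.assoc K A A (B ⊗[K] B)).symm.toLinearMap ∘ₗ
      ((TensorProduct.assoc K A B B).toLinearMap ∘ₗ P.twist.rTensor B ∘ₗ
        (TensorProduct.assoc K B A B).symm.toLinearMap).lTensor A ∘ₗ
      (TensorProduct.assoc K A B (A ⊗[K] B)).toLinearMap)

theorem doubleMul_tmul (a a' : A) (b b' : B) :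
    P.doubleMul (a ⊗ₜ b) (a' ⊗ₜ b') =
      TensorProduct.map (LinearMap.mulLeft K a) (LinearMap.mulRight K b') (P.twist (b ⊗ₜ a')) := by
  simp only [doubleMul, TensorProduct.curry_apply, LinearMap.comp_apply, LinearEquiv.coe_coe,
    TensorProduct.assoc_tmul, LinearMap.lTensor_tmul, TensorProduct.assoc_symm_tmul,
    LinearMap.rTensor_tmul]
  induction P.twist (b ⊗ₜ a') using TensorProduct.induction_on with
  | zero => simp
  | add x y hx hy => simp only [TensorProduct.add_tmul, TensorProduct.tmul_add, map_add, hx, hy]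
  | tmul x y => simp

end MultiplierHopfPairing

end Pairing

/-! ## Completed modules and comodule algebras -/

section Comodule

variable {K D X : Type*} [Field K] [AddCommGroup D] [Module K D] [AddCommGroup X] [Module K X]

/-- The completed module `M₀(D ⊗ X)` of the `D`-bimodule `D ⊗ X`, for an algebra `D` with product
`μ` and a vector space `X`. An element `y` is a pair of linear maps `D → D ⊗ X`, written
`d ↦ (d ⊗ 1) y` and `d ↦ y (d ⊗ 1)`, with `(d' ⊗ 1)(y (d ⊗ 1)) = ((d' ⊗ 1) y)(d ⊗ 1)`. -/
def CompletedModule (μ : D →ₗ[K] D →ₗ[K] D) (X : Type*) [AddCommGroup X] [Module K X] :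
    Submodule K ((D →ₗ[K] D ⊗[K] X) × (D →ₗ[K] D ⊗[K] X)) where
  carrier := {y | ∀ d' d, (μ d').rTensor X (y.2 d) = (μ.flip d).rTensor X (y.1 d')}
  add_mem' := by
    intro y z hy hz d' d
    simp [hy d' d, hz d' d]
  zero_mem' := by
    intro d' d
    simp
  smul_mem' := by
    intro c y hy d' d
    simp [hy d' d]

namespace CompletedModule

variable {μ : D →ₗ[K] D →ₗ[K] D}

/-- `y ↦ (d ↦ (d ⊗ 1) y)`. -/
def fromLeft : CompletedModule μ X →ₗ[K] D →ₗ[K] D ⊗[K] X :=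
  LinearMap.fst K _ _ ∘ₗ (CompletedModule μ X).subtype

/-- `y ↦ (d ↦ y (d ⊗ 1))`. -/
def fromRight : CompletedModule μ X →ₗ[K] D →ₗ[K] D ⊗[K] X :=
  LinearMap.snd K _ _ ∘ₗ (CompletedModule μ X).subtype

theorem compat (y : CompletedModule μ X) (d' d : D) :
    (μ d').rTensor X (fromRight y d) = (μ.flip d).rTensor X (fromLeft y d') :=
  y.2 d' d

/-- For `X` an algebra with product `ν`, the map `w ↦ w y` on `D ⊗ X`:
`(d ⊗ x) y = (1 ⊗ x)((d ⊗ 1) y)`. -/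
noncomputable def mulOnRight (ν : X →ₗ[K] X →ₗ[K] X) (y : CompletedModule μ X) :
    D ⊗[K] X →ₗ[K] D ⊗[K] X :=
  TensorProduct.lift ((LinearMap.lTensorHom D ∘ₗ ν).flip ∘ₗ fromLeft y)

/-- For `X` an algebra with product `ν`, the map `w ↦ y w` on `D ⊗ X`:
`y (d ⊗ x) = (y (d ⊗ 1))(1 ⊗ x)`. -/
noncomputable def mulOnLeft (ν : X →ₗ[K] X →ₗ[K] X) (y : CompletedModule μ X) :
    D ⊗[K] X →ₗ[K] D ⊗[K] X :=
  TensorProduct.lift ((LinearMap.lTensorHom D ∘ₗ ν.flip).flip ∘ₗ fromRight y)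

theorem mulOnRight_tmul (ν : X →ₗ[K] X →ₗ[K] X) (y : CompletedModule μ X) (d : D) (x : X) :
    mulOnRight ν y (d ⊗ₜ x) = (ν x).lTensor D (fromLeft y d) := rfl

theorem mulOnLeft_tmul (ν : X →ₗ[K] X →ₗ[K] X) (y : CompletedModule μ X) (d : D) (x : X) :
    mulOnLeft ν y (d ⊗ₜ x) = (ν.flip x).lTensor D (fromRight y d) := rfl

/-- For `X` an algebra with product `ν`, the product of `M₀(D ⊗ X)`:
`(d ⊗ 1)(y z) = ((d ⊗ 1) y) z` and `(y z)(d ⊗ 1) = y (z (d ⊗ 1))`. -/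
noncomputable def mul (ν : X →ₗ[K] X →ₗ[K] X) (y z : CompletedModule μ X) :
    CompletedModule μ X :=
  ⟨(mulOnRight ν z ∘ₗ fromLeft y, mulOnLeft ν y ∘ₗ fromRight z), by
    intro d' d
    have h₁ : ∀ w : D ⊗[K] X, (μ d').rTensor X (mulOnLeft ν y w) =
        TensorProduct.map₂ μ ν (fromLeft y d') w := by
      intro w
      induction w using TensorProduct.induction_on with
      | zero => simp
      | add w₁ w₂ h h' => simp only [map_add, h, h']
      | tmul e x =>
        rw [mulOnLeft_tmul, ← LinearMap.comp_apply, LinearMap.rTensor_comp_lTensor,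
          ← LinearMap.lTensor_comp_rTensor, LinearMap.comp_apply, compat]
        induction fromLeft y d' using TensorProduct.induction_on with
        | zero => simp
        | add w₁ w₂ h h' => simp only [map_add, LinearMap.add_apply, h, h']
        | tmul e' x' => simp
    have h₂ : ∀ w : D ⊗[K] X, (μ.flip d).rTensor X (mulOnRight ν z w) =
        TensorProduct.map₂ μ ν w (fromRight z d) := by
      intro w
      induction w using TensorProduct.induction_on with
      | zero => simp
      | add w₁ w₂ h h' => simp only [map_add, LinearMap.add_apply, h, h']
      | tmul e x =>
        rw [mulOnRight_tmul, ← LinearMap.comp_apply, LinearMap.rTensor_comp_lTensor,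
          ← LinearMap.lTensor_comp_rTensor, LinearMap.comp_apply, ← compat]
        induction fromRight z d using TensorProduct.induction_on with
        | zero => simp
        | add w₁ w₂ h h' => simp only [map_add, h, h']
        | tmul e' x' => simp
    exact (h₁ _).trans (h₂ _).symm⟩

end CompletedModule

open CompletedModule

variable {μ : D →ₗ[K] D →ₗ[K] D}

/-- For a linear map `Γ : X → M₀(D ⊗ X)`, the bilinear map `(d, x) ↦ (d ⊗ 1)Γ(x)`. -/
noncomputable def coverMap (Γ : X →ₗ[K] CompletedModule μ X) : D →ₗ[K] X →ₗ[K] D ⊗[K] X :=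
  (fromLeft ∘ₗ Γ).flip

/-- The linear map `d ⊗ e ↦ (d ⊗ e ⊗ 1) (ι ⊗ Γ)Γ(x)` from `D ⊗ D` to `D ⊗ (D ⊗ X)`, where
`(d ⊗ e ⊗ 1) (ι ⊗ Γ)Γ(x) = (1 ⊗ e ⊗ 1) (ι ⊗ Γ)((d ⊗ 1)Γ(x))`. -/
noncomputable def coverTwice (Γ : X →ₗ[K] CompletedModule μ X) (x : X) :
    D ⊗[K] D →ₗ[K] D ⊗[K] (D ⊗[K] X) :=
  TensorProduct.lift ((LinearMap.lTensorHom D ∘ₗ coverMap Γ).flip ∘ₗ fromLeft (Γ x))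

theorem coverTwice_tmul (Γ : X →ₗ[K] CompletedModule μ X) (x : X) (d e : D) :
    coverTwice Γ x (d ⊗ₜ e) = (coverMap Γ e).lTensor D (coverMap Γ d x) := rfl

/-- Coassociativity `(Δ ⊗ ι)Γ = (ι ⊗ Γ)Γ`, where `Δ : D → M₀(D ⊗ D)` is the comultiplication of
`D`. Both sides are multiplied from the left by `(p ⊗ 1)Δ(q) ⊗ 1`, an element of `D ⊗ D ⊗ 1`, and
the left side is then read as `(p ⊗ 1 ⊗ 1)(Δ ⊗ ι)((q ⊗ 1)Γ(x))`. For a multiplier Hopf algebra `D`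
the elements `(p ⊗ 1)Δ(q)` span `D ⊗ D`. -/
def IsCoassociative (Δ : D →ₗ[K] CompletedModule μ D) (Γ : X →ₗ[K] CompletedModule μ X) : Prop :=
  ∀ (p q : D) (x : X),
    TensorProduct.assoc K D D X ((coverMap Δ p).rTensor X (coverMap Γ q x)) =
      coverTwice Γ x (coverMap Δ p q)

/-- `Γ : X → M₀(D ⊗ X)` makes the algebra `X` with product `ν` a left comodule algebra over `D`
with product `μ` and comultiplication `Δ`. -/
structure IsLeftComoduleAlgebra (Δ : D →ₗ[K] CompletedModule μ D) (ν : X →ₗ[K] X →ₗ[K] X)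
    (Γ : X →ₗ[K] CompletedModule μ X) : Prop where
  assoc : AssociativeMul ν
  nondeg : NondegenerateMul ν
  injective : Function.Injective Γ
  coassoc : IsCoassociative Δ Γ
  map_mul : ∀ x y, Γ (ν x y) = CompletedModule.mul ν (Γ x) (Γ y)

end Comodule

/-! ## The comultiplication of the Drinfel'd double and the coaction on the Heisenberg double -/

namespace MultiplierHopfPairing

variable {K A B : Type*} [Field K]
  [NonUnitalRing A] [Module K A] [IsScalarTower K A A] [SMulCommClass K A A]
  [NonUnitalRing B] [Module K B] [IsScalarTower K B B] [SMulCommClass K B B]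
  {HA : RegularMultiplierHopfAlgebra K A} {HB : RegularMultiplierHopfAlgebra K B}
  (P : MultiplierHopfPairing HA HB)

/-- The element `(a₍₂₎ ⊗ b₍₁₎ b') ⊗ (a₍₁₎ a' ⊗ b₍₂₎)` of `(A ⊗ B) ⊗ (A ⊗ B)`, formed from
`Δ(a)(a' ⊗ 1)` and `Δ(b)(b' ⊗ 1)`. -/
noncomputable def coveredCoproduct (HA : RegularMultiplierHopfAlgebra K A)
    (HB : RegularMultiplierHopfAlgebra K B) (a : A) (b : B) (a' : A) (b' : B) :
    (A ⊗[K] B) ⊗[K] (A ⊗[K] B) :=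
  TensorProduct.tensorTensorTensorComm K A A B B
    (TensorProduct.comm K A A (HA.coverFst a a') ⊗ₜ HB.coverFst b b')

/-- The formula `(x ⊗ 1) Γ(a ⊗ b) = x (a₍₂₎ ⋈ b₍₁₎) ⊗ (a₍₁₎ ⊗ b₍₂₎)` for all `x` in the Drinfel'd
double `𝒟`. To give its right side a meaning, the component of the first leg in `B` is multiplied on
the right by an arbitrary `b'`, and the component of the second leg in `A` by an arbitrary `a'`:
the result is `x (a₍₂₎ ⋈ b₍₁₎ b') ⊗ (a₍₁₎ a' ⊗ b₍₂₎)`. -/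
def HasCoproductFormula (Γ : A ⊗[K] B →ₗ[K] CompletedModule P.doubleMul (A ⊗[K] B)) : Prop :=
  ∀ (x : A ⊗[K] B) (a a' : A) (b b' : B),
    TensorProduct.map ((LinearMap.mulRight K b').lTensor A) ((LinearMap.mulRight K a').rTensor B)
        (coverMap Γ x (a ⊗ₜ b)) =
      (P.doubleMul x).rTensor (A ⊗[K] B) (coveredCoproduct HA HB a b a' b')

/-- The comultiplication `Δ(a ⋈ b) = Δ^cop(a) Δ(b) = (a₍₂₎ ⋈ b₍₁₎) ⊗ (a₍₁₎ ⋈ b₍₂₎)` of the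
Drinfel'd double `𝒟`, with values in `M₀(𝒟 ⊗ 𝒟)`: the unique linear map with
`(x ⊗ 1)Δ(a ⋈ b) = x (a₍₂₎ ⋈ b₍₁₎) ⊗ (a₍₁₎ ⋈ b₍₂₎)`. -/
noncomputable def doubleΔ : A ⊗[K] B →ₗ[K] CompletedModule P.doubleMul (A ⊗[K] B) :=
  Classical.epsilon P.HasCoproductFormula

end MultiplierHopfPairing

/-! # The Heisenberg double as a comodule algebra over the Drinfel'd double

Sweedler notation is made rigorous by slicing. The forms `⟨·, c⟩` and `⟨d, ·⟩` separate the points of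
`A` and `B`, so an element of `V ⊗ A` or `V ⊗ B` is determined by its slices, and every covered
coproduct in `B` has explicit slices in terms of the actions `▶`, `◀`: for instance
`(ι ⊗ ⟨d, ·⟩)(Δ(b)(1 ⊗ b')) = (b' ▶ d) ▶ b`. Identities between covered coproducts thus become
identities between iterated actions, which associativity gives.

The products of the doubles involve the twists `b ⊗ a ↦ b₍₁₎ ▶ a ⊗ b₍₂₎` and
`a ⊗ b ↦ a ◀ S⁻¹(b₍₂₎) ⊗ b₍₁₎`. They exist because the actions are unital and the canonical maps
`T₁`, `T₂` are bijective; the second is the inverse of `a ⊗ b ↦ a ◀ b₍₂₎ ⊗ b₍₁₎`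
(`isLeftTwist_leftTwist`, `isRightTwist_rightTwist`). The antipode that this needs is built from the
inverses of `T₁` and `T₂` (`exists_isAntipode`).

The properties of the doubles and of `Γ` are proved on modules. A `DoubleAction` is a space on which
`A` and `B` act, with meaningful `a₍₂₎ v ⊗ a₍₁₎` and `b₍₁₎ v ⊗ b₍₂₎`. On `V ⊗ W` let `a` act by
`a₍₂₎ ⊗ a₍₁₎` and `b` by `b₍₁₎ ⊗ b₍₂₎`. Call the space an `ℋ`-module or a `𝒟`-module if the two actions
satisfy the relations of that algebra (`IsHeisenberg`, `IsDouble`). Tensor products behave as the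
coaction and the comultiplication demand: `𝒟`-modules tensored with
`𝒟`-modules are `𝒟`-modules (`IsDouble.tensor`), and `𝒟`-modules tensored with `ℋ`-modules are
`ℋ`-modules (`IsDouble.tensor_isHeisenberg`). The space `A` is a faithful `ℋ`-module, and `A ⊗ B` is
a faithful `𝒟`-module, being the tensor product of the `ℋ`-module `A` with the module `B`.

The map `Γ` is characterized by its effect on modules: on `V ⊗ W`, for a `𝒟`-module `V` and an
`ℋ`-module `W`, the element `Γ(h)` acts as `h` acts on the `ℋ`-module `V ⊗ W` (`joint_coaction`). So
`Γ(h k) = Γ(h) Γ(k)` because both act as the operator of `h` after that of `k`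
(`coaction_heisenbergMul`), and coassociativity is the compatibility of the module structure on
`V ⊗ V'` with a further coaction (`isCoassociative_coaction`). Uniqueness of `Γ` also shows that the
comultiplication of `𝒟` is the same linear map on `A ⊗ B` (`doubleΔ_eq_coaction`). Faithfulness of
the modules transfers these identities to `M₀(𝒟 ⊗ ℋ)`. -/

/-! ### Slices of tensors -/

section Slices

variable {K M N P Q : Type*} [Field K] [AddCommGroup M] [Module K M] [AddCommGroup N] [Module K N]
  [AddCommGroup P] [Module K P] [AddCommGroup Q] [Module K Q]

/-- The slice `m ⊗ n ↦ φ(n) m` of the second leg by a functional `φ`. -/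
noncomputable def sliceR (φ : N →ₗ[K] K) : M ⊗[K] N →ₗ[K] M :=
  (TensorProduct.rid K M).toLinearMap ∘ₗ φ.lTensor M

/-- The slice `m ⊗ n ↦ φ(m) n` of the first leg by a functional `φ`. -/
noncomputable def sliceL (φ : M →ₗ[K] K) : M ⊗[K] N →ₗ[K] N :=
  (TensorProduct.lid K N).toLinearMap ∘ₗ φ.rTensor N

@[simp] theorem sliceR_tmul (φ : N →ₗ[K] K) (m : M) (n : N) :
    sliceR φ (m ⊗ₜ[K] n) = φ n • m := by
  simp [sliceR]

@[simp] theorem sliceL_tmul (φ : M →ₗ[K] K) (m : M) (n : N) :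
    sliceL φ (m ⊗ₜ[K] n) = φ m • n := by
  simp [sliceL]

theorem sliceR_rTensor (φ : N →ₗ[K] K) (f : M →ₗ[K] P) (t : M ⊗[K] N) :
    sliceR φ (f.rTensor N t) = f (sliceR φ t) := by
  induction t using TensorProduct.induction_on <;> simp_all

theorem sliceR_lTensor (φ : P →ₗ[K] K) (f : N →ₗ[K] P) (t : M ⊗[K] N) :
    sliceR φ (f.lTensor M t) = sliceR (φ ∘ₗ f) t := by
  induction t using TensorProduct.induction_on <;> simp_all

theorem sliceL_rTensor (φ : P →ₗ[K] K) (f : M →ₗ[K] P) (t : M ⊗[K] N) :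
    sliceL φ (f.rTensor N t) = sliceL (φ ∘ₗ f) t := by
  induction t using TensorProduct.induction_on <;> simp_all

theorem sliceL_lTensor (φ : M →ₗ[K] K) (f : N →ₗ[K] P) (t : M ⊗[K] N) :
    sliceL φ (f.lTensor M t) = f (sliceL φ t) := by
  induction t using TensorProduct.induction_on <;> simp_all

theorem sliceR_comm (φ : M →ₗ[K] K) (t : M ⊗[K] N) :
    sliceR φ (TensorProduct.comm K M N t) = sliceL φ t := by
  induction t using TensorProduct.induction_on <;> simp_all

theorem sliceL_comm (φ : N →ₗ[K] K) (t : M ⊗[K] N) :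
    sliceL φ (TensorProduct.comm K M N t) = sliceR φ t := by
  induction t using TensorProduct.induction_on <;> simp_all

theorem apply_sliceR (φ : N →ₗ[K] K) (ψ : M →ₗ[K] K) (t : M ⊗[K] N) :
    ψ (sliceR φ t) = φ (sliceL ψ t) := by
  induction t using TensorProduct.induction_on <;> simp_all [mul_comm]

theorem sliceR_add_left (φ ψ : N →ₗ[K] K) (t : M ⊗[K] N) :
    sliceR (φ + ψ) t = sliceR φ t + sliceR ψ t := by
  simp [sliceR, LinearMap.lTensor_add]

theorem sliceR_smul_left (c : K) (φ : N →ₗ[K] K) (t : M ⊗[K] N) :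
    sliceR (c • φ) t = c • sliceR φ t := by
  simp [sliceR, LinearMap.lTensor_smul]

theorem comm_lTensor (f : N →ₗ[K] P) (t : M ⊗[K] N) :
    TensorProduct.comm K M P (f.lTensor M t) = f.rTensor M (TensorProduct.comm K M N t) := by
  induction t using TensorProduct.induction_on <;> simp_all

theorem comm_rTensor (f : M →ₗ[K] P) (t : M ⊗[K] N) :
    TensorProduct.comm K P N (f.rTensor N t) = f.lTensor N (TensorProduct.comm K M N t) := by
  induction t using TensorProduct.induction_on <;> simp_all

theorem comm_comm_apply (t : M ⊗[K] N) :
    TensorProduct.comm K N M (TensorProduct.comm K M N t) = t :=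
  (TensorProduct.comm K M N).symm_apply_apply t

theorem lTensor_rTensor_apply (f : M →ₗ[K] P) (g : N →ₗ[K] Q) (t : M ⊗[K] N) :
    g.lTensor P (f.rTensor N t) = f.rTensor Q (g.lTensor M t) := by
  induction t using TensorProduct.induction_on <;> simp_all

/-- A family of linear maps that separates the points of `M` separates those of `M ⊗ N`. -/
theorem eq_of_rTensor {ι : Sort*} (f : ι → M →ₗ[K] P) (hf : ∀ m, (∀ i, f i m = 0) → m = 0)
    {z z' : M ⊗[K] N} (h : ∀ i, (f i).rTensor N z = (f i).rTensor N z') : z = z' := by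
  classical
  rw [← sub_eq_zero]
  replace h : ∀ i, (f i).rTensor N (z - z') = 0 := fun i => by rw [map_sub, h i, sub_self]
  generalize z - z' = w at h
  let b := Module.Basis.ofVectorSpace K N
  let e := TensorProduct.equivFinsuppOfBasisRight (M := M) b
  let e' := TensorProduct.equivFinsuppOfBasisRight (M := P) b
  have key : ∀ (g : M →ₗ[K] P) (t : M ⊗[K] N) k, e' (g.rTensor N t) k = g (e t k) := by
    intro g t k
    induction t using TensorProduct.induction_on with
    | zero => simp
    | add x y hx hy => simp [hx, hy]
    | tmul x y => simp [e, e']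
  refine e.injective (Finsupp.ext fun k => ?_)
  rw [map_zero, Finsupp.zero_apply]
  refine hf _ fun i => ?_
  rw [← key, h i, map_zero, Finsupp.zero_apply]

theorem eq_of_lTensor {ι : Sort*} (f : ι → N →ₗ[K] P) (hf : ∀ n, (∀ i, f i n = 0) → n = 0)
    {z z' : M ⊗[K] N} (h : ∀ i, (f i).lTensor M z = (f i).lTensor M z') : z = z' := by
  refine (TensorProduct.comm K M N).injective (eq_of_rTensor f hf fun i => ?_)
  rw [← comm_lTensor, ← comm_lTensor, h i]

theorem eq_of_sliceR {ι : Sort*} (φ : ι → N →ₗ[K] K) (hφ : ∀ n, (∀ i, φ i n = 0) → n = 0)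
    {z z' : M ⊗[K] N} (h : ∀ i, sliceR (φ i) z = sliceR (φ i) z') : z = z' :=
  eq_of_lTensor φ hφ fun i => (TensorProduct.rid K M).injective (h i)

theorem eq_of_sliceL {ι : Sort*} (φ : ι → M →ₗ[K] K) (hφ : ∀ m, (∀ i, φ i m = 0) → m = 0)
    {z z' : M ⊗[K] N} (h : ∀ i, sliceL (φ i) z = sliceL (φ i) z') : z = z' :=
  eq_of_rTensor φ hφ fun i => (TensorProduct.lid K N).injective (h i)

/-- Linear maps with prescribed slices descend along a surjection: if the slices of `g : X → V ⊗ N`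
factor through `f : X → Y`, then some `G : Y → V ⊗ N` has the factored slices. -/
theorem exists_of_slices {ι : Sort*} (φ : ι → N →ₗ[K] K) {f : P →ₗ[K] Q}
    (hf : Function.Surjective f) (g : P →ₗ[K] M ⊗[K] N) (h : ι → Q →ₗ[K] M)
    (hg : ∀ i x, sliceR (φ i) (g x) = h i (f x)) :
    ∃ G : Q →ₗ[K] M ⊗[K] N, ∀ i y, sliceR (φ i) (G y) = h i y := by
  obtain ⟨s, hs⟩ := f.exists_rightInverse_of_surjective (LinearMap.range_eq_top.2 hf)
  refine ⟨g ∘ₗ s, fun i y => ?_⟩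
  rw [LinearMap.comp_apply, hg, ← LinearMap.comp_apply (f := f), hs, LinearMap.id_apply]

end Slices

/-! ### Counit and antipode of a multiplier Hopf algebra -/

section MulTensor

variable {K A : Type*} [Field K] [NonUnitalRing A] [Module K A] [IsScalarTower K A A]
  [SMulCommClass K A A]

theorem lTensor_mulRight_mul (c : A) (w z : A ⊗[K] A) :
    (LinearMap.mulRight K c).lTensor A w * z = w * (LinearMap.mulLeft K c).lTensor A z := by
  induction w using TensorProduct.induction_on with
  | zero => simp
  | add x y hx hy => simp only [map_add, add_mul, hx, hy]
  | tmul x y =>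
    induction z using TensorProduct.induction_on with
    | zero => simp
    | add x y hx hy => simp only [map_add, mul_add, hx, hy]
    | tmul p q => simp [mul_assoc]

theorem rTensor_mulRight_mul (c : A) (w z : A ⊗[K] A) :
    (LinearMap.mulRight K c).rTensor A w * z = w * (LinearMap.mulLeft K c).rTensor A z := by
  induction w using TensorProduct.induction_on with
  | zero => simp
  | add x y hx hy => simp only [map_add, add_mul, hx, hy]
  | tmul x y =>
    induction z using TensorProduct.induction_on with
    | zero => simp
    | add x y hx hy => simp only [map_add, mul_add, hx, hy]
    | tmul p q => simp [mul_assoc]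

theorem rTensor_mulLeft_mul (c : A) (w z : A ⊗[K] A) :
    (LinearMap.mulLeft K c).rTensor A w * z = (LinearMap.mulLeft K c).rTensor A (w * z) := by
  induction w using TensorProduct.induction_on with
  | zero => simp
  | add x y hx hy => simp only [map_add, add_mul, hx, hy]
  | tmul x y =>
    induction z using TensorProduct.induction_on with
    | zero => simp
    | add x y hx hy => simp only [map_add, mul_add, hx, hy]
    | tmul p q => simp [mul_assoc]

theorem comm_mul (w z : A ⊗[K] A) :
    TensorProduct.comm K A A (w * z) = TensorProduct.comm K A A w * TensorProduct.comm K A A z := by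
  induction w using TensorProduct.induction_on with
  | zero => simp
  | add x y hx hy => simp only [map_add, add_mul, hx, hy]
  | tmul x y =>
    induction z using TensorProduct.induction_on with
    | zero => simp
    | add x y hx hy => simp only [map_add, mul_add, hx, hy]
    | tmul p q => simp

theorem NondegenerateMul.tensor_ext (hA : NondegenerateMul (LinearMap.mul K A)) {w w' : A ⊗[K] A}
    (h : ∀ z, w * z = w' * z) : w = w' := by
  refine eq_of_rTensor (fun x => LinearMap.mulRight K x) (fun m hm => hA.1 m hm) fun x => ?_
  refine eq_of_lTensor (fun x => LinearMap.mulRight K x) (fun m hm => hA.1 m hm) fun y => ?_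
  have key : ∀ t : A ⊗[K] A, (LinearMap.mulRight K y).lTensor A
      ((LinearMap.mulRight K x).rTensor A t) = t * x ⊗ₜ y := by
    intro t
    induction t using TensorProduct.induction_on with
    | zero => simp
    | add x y hx hy => simp only [map_add, add_mul, hx, hy]
    | tmul p q => simp
  rw [key, key, h]

end MulTensor

namespace MultiplierHopfAlgebra

open MultiplierAlgebra

variable {K A : Type*} [Field K] [NonUnitalRing A] [Module K A] [IsScalarTower K A A]
  [SMulCommClass K A A] (H : MultiplierHopfAlgebra K A)

theorem T₁_mul (a b : A) (z : A ⊗[K] A) :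
    H.T₁ (a ⊗ₜ b) * z = left (H.Δ a) ((LinearMap.mulLeft K b).lTensor A z) :=
  congrArg (fun m => left m z) (H.T₁_spec a b)

theorem T₂_mul (a b : A) (z : A ⊗[K] A) :
    H.T₂ (a ⊗ₜ b) * z = (LinearMap.mulLeft K a).rTensor A (left (H.Δ b) z) :=
  congrArg (fun m => left m z) (H.T₂_spec a b)

theorem left_mul (m : MultiplierAlgebra K (A ⊗[K] A)) (x y : A ⊗[K] A) :
    left m (x * y) = left m x * y :=
  m.2.1 x y

theorem left_Δ_mul (a b : A) (z : A ⊗[K] A) :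
    left (H.Δ (a * b)) z = left (H.Δ a) (left (H.Δ b) z) := by
  rw [map_mul]; rfl

theorem left_Δ_tmul (a x y : A) :
    left (H.Δ a) (x ⊗ₜ y) = (LinearMap.mulRight K x).rTensor A (H.T₁ (a ⊗ₜ y)) := by
  refine H.nondeg.tensor_ext fun z => ?_
  rw [rTensor_mulRight_mul, T₁_mul, ← left_mul]
  congr 1
  induction z using TensorProduct.induction_on with
  | zero => simp
  | add x y hx hy => simp only [map_add, mul_add, hx, hy]
  | tmul p q => simp

theorem T₁_mul_tmul (a b c : A) : H.T₁ ((a * b) ⊗ₜ c) = left (H.Δ a) (H.T₁ (b ⊗ₜ c)) := by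
  refine H.nondeg.tensor_ext fun z => ?_
  rw [T₁_mul, ← left_mul, T₁_mul, left_Δ_mul]

/-- `((a ⊗ 1)Δ(b))(1 ⊗ c) = (a ⊗ 1)(Δ(b)(1 ⊗ c))`. -/
theorem lTensor_mulRight_T₂ (a b c : A) :
    (LinearMap.mulRight K c).lTensor A (H.T₂ (a ⊗ₜ b)) =
      (LinearMap.mulLeft K a).rTensor A (H.T₁ (b ⊗ₜ c)) := by
  refine H.nondeg.tensor_ext fun z => ?_
  rw [lTensor_mulRight_mul, T₂_mul, rTensor_mulLeft_mul, T₁_mul]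

/-- Coassociativity, `(T₂ ⊗ ι)(ι ⊗ T₁) = (ι ⊗ T₁)(T₂ ⊗ ι)`. -/
theorem coassoc_apply (a : A) (t : A ⊗[K] A) :
    TensorProduct.assoc K A A A (H.T₂.rTensor A ((TensorProduct.assoc K A A A).symm (a ⊗ₜ H.T₁ t))) =
      H.T₁.lTensor A (TensorProduct.assoc K A A A (H.T₂.rTensor A
        ((TensorProduct.assoc K A A A).symm (a ⊗ₜ t)))) := by
  induction t using TensorProduct.induction_on with
  | zero => simp
  | add x y hx hy => simp only [map_add, TensorProduct.tmul_add, hx, hy]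
  | tmul b c => rw [H.coassoc]; simp

/-- `T₁` as a linear equivalence. -/
noncomputable def equiv₁ : (A ⊗[K] A) ≃ₗ[K] (A ⊗[K] A) := LinearEquiv.ofBijective H.T₁ H.bijective_T₁

/-- `T₂` as a linear equivalence. -/
noncomputable def equiv₂ : (A ⊗[K] A) ≃ₗ[K] (A ⊗[K] A) := LinearEquiv.ofBijective H.T₂ H.bijective_T₂

@[simp] theorem equiv₁_symm_T₁ (t : A ⊗[K] A) : H.equiv₁.symm (H.T₁ t) = t :=
  H.equiv₁.symm_apply_apply t

@[simp] theorem equiv₂_symm_T₂ (t : A ⊗[K] A) : H.equiv₂.symm (H.T₂ t) = t :=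
  H.equiv₂.symm_apply_apply t

/-- Both `m ∘ T₁⁻¹` and `m ∘ T₂⁻¹` reduce to one functional on one of the legs. Coassociativity
gives `p ⊗ m(T₁⁻¹(q ⊗ b)) = m(T₂⁻¹(p ⊗ q)) ⊗ b`, so each side depends on `q` through a scalar. -/
theorem exists_counit : ∃ ε : A →ₗ[K] K, (∀ t, sliceL ε (H.T₁ t) = LinearMap.mul' K A t) ∧
    (∀ t, sliceR ε (H.T₂ t) = LinearMap.mul' K A t) := by
  let E : A ⊗[K] A →ₗ[K] A := LinearMap.mul' K A ∘ₗ H.equiv₁.symm.toLinearMap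
  let F : A ⊗[K] A →ₗ[K] A := LinearMap.mul' K A ∘ₗ H.equiv₂.symm.toLinearMap
  have hE : ∀ t, E (H.T₁ t) = LinearMap.mul' K A t := fun t => by simp [E]
  have hF : ∀ t, F (H.T₂ t) = LinearMap.mul' K A t := fun t => by simp [F]
  have hE' : E ∘ₗ H.T₁ = LinearMap.mul' K A := LinearMap.ext hE
  have h₁ : ∀ (x : A) (s : A ⊗[K] A), E.lTensor A (TensorProduct.assoc K A A A
      (H.T₂.rTensor A ((TensorProduct.assoc K A A A).symm (x ⊗ₜ H.T₁ s)))) =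
      (LinearMap.mulLeft K x).rTensor A (H.T₁ s) := by
    intro x s
    rw [coassoc_apply, ← LinearMap.comp_apply, ← LinearMap.lTensor_comp, hE']
    induction s using TensorProduct.induction_on with
    | zero => simp
    | add x y hx hy => simp only [map_add, TensorProduct.tmul_add, hx, hy]
    | tmul p q =>
      rw [← lTensor_mulRight_T₂]
      simp only [TensorProduct.assoc_symm_tmul, LinearMap.rTensor_tmul]
      generalize H.T₂ (x ⊗ₜ p) = u
      induction u using TensorProduct.induction_on with
      | zero => simp
      | add x y hx hy => simp only [map_add, TensorProduct.add_tmul, hx, hy]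
      | tmul p q => simp
  have h₂ : ∀ (y : A ⊗[K] A) (b : A), E.lTensor A (TensorProduct.assoc K A A A (y ⊗ₜ b)) =
      F y ⊗ₜ b := by
    intro y b
    obtain ⟨t, rfl⟩ := H.bijective_T₂.2 y
    rw [hF]
    induction t using TensorProduct.induction_on with
    | zero => simp
    | add x y hx hy => simp only [map_add, TensorProduct.add_tmul, hx, hy]
    | tmul x a =>
      obtain ⟨s, hs⟩ := H.bijective_T₁.2 (a ⊗ₜ b)
      have := h₁ x s
      rw [hs] at this
      simpa using this
  have h₃ : ∀ p q b : A, p ⊗ₜ[K] E (q ⊗ₜ b) = F (p ⊗ₜ q) ⊗ₜ[K] b := fun p q b => by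
    simpa using h₂ (p ⊗ₜ q) b
  by_cases hA : ∀ x : A, x = 0
  · exact ⟨0, fun t => (hA _).trans (hA _).symm, fun t => (hA _).trans (hA _).symm⟩
  push Not at hA
  obtain ⟨p, hp⟩ := hA
  obtain ⟨f, hf⟩ := Module.Projective.exists_dual_eq_one K hp
  let ε : A →ₗ[K] K := f ∘ₗ F ∘ₗ TensorProduct.mk K A A p
  have hEε : ∀ q b, E (q ⊗ₜ b) = ε q • b := fun q b => by
    simpa [hf, ε] using congrArg (sliceL f) (h₃ p q b)
  have hFε : ∀ q b, F (b ⊗ₜ q) = ε q • b := fun q b => by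
    have := congrArg (sliceR f) (h₃ b q p)
    rw [hEε] at this
    simpa [hf] using this.symm
  refine ⟨ε, fun t => ?_, fun t => ?_⟩
  · rw [← hE]
    generalize H.T₁ t = u
    induction u using TensorProduct.induction_on with
    | zero => simp
    | add x y hx hy => simp only [map_add, hx, hy]
    | tmul q b => simp [hEε]
  · rw [← hF]
    generalize H.T₂ t = u
    induction u using TensorProduct.induction_on with
    | zero => simp
    | add x y hx hy => simp only [map_add, hx, hy]
    | tmul q b => simp [hFε]

/-- The counit. -/
noncomputable def counit : A →ₗ[K] K := Classical.choose H.exists_counit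

theorem sliceL_counit_T₁ (t : A ⊗[K] A) : sliceL H.counit (H.T₁ t) = LinearMap.mul' K A t :=
  (Classical.choose_spec H.exists_counit).1 t

theorem sliceR_counit_T₂ (t : A ⊗[K] A) : sliceR H.counit (H.T₂ t) = LinearMap.mul' K A t :=
  (Classical.choose_spec H.exists_counit).2 t

theorem sliceL_counit_left_Δ (a : A) (y : A ⊗[K] A) :
    sliceL H.counit (left (H.Δ a) y) = a * sliceL H.counit y := by
  obtain ⟨t, rfl⟩ := H.bijective_T₁.2 y
  rw [sliceL_counit_T₁]
  induction t using TensorProduct.induction_on with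
  | zero => simp
  | add x y hx hy => simp only [map_add, mul_add, hx, hy]
  | tmul b c => rw [← T₁_mul_tmul, sliceL_counit_T₁]; simp [mul_assoc]

theorem counit_mul (a b : A) : H.counit (a * b) = H.counit a * H.counit b := by
  have h : ∀ y : A ⊗[K] A, sliceL H.counit ((LinearMap.mulRight K b).rTensor A y) =
      H.counit b • sliceL H.counit y := by
    intro y
    obtain ⟨t, rfl⟩ := H.bijective_T₁.2 y
    rw [sliceL_counit_T₁]
    induction t using TensorProduct.induction_on with
    | zero => simp
    | add x y hx hy => simp only [map_add, smul_add, hx, hy]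
    | tmul a c => rw [← left_Δ_tmul, sliceL_counit_left_Δ]; simp [mul_smul_comm]
  by_cases hA : ∀ x : A, x = 0
  · rw [hA (a * b), hA a, map_zero, zero_mul]
  push Not at hA
  obtain ⟨p, hp⟩ := hA
  have := h (a ⊗ₜ p)
  simp only [LinearMap.rTensor_tmul, sliceL_tmul, LinearMap.mulRight_apply, smul_smul] at this
  rw [smul_left_injective K hp this, mul_comm]

theorem exists_counit_eq_one [Nontrivial A] : ∃ q : A, H.counit q = 1 := by
  by_contra! h
  have h0 : H.counit = 0 := by
    ext q
    by_contra hq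
    exact h ((H.counit q)⁻¹ • q) (by simpa using inv_mul_cancel₀ hq)
  obtain ⟨x, hx⟩ := exists_ne (0 : A)
  refine hx (H.nondeg.1 x fun y => ?_)
  have := H.sliceL_counit_T₁ (x ⊗ₜ y)
  rw [h0] at this
  simpa [sliceL] using this.symm

theorem surjective_mul' (H : MultiplierHopfAlgebra K A) : Function.Surjective (LinearMap.mul' K A) := by
  rcases subsingleton_or_nontrivial A with hA | hA
  · exact fun x => ⟨0, Subsingleton.elim _ _⟩
  intro x
  obtain ⟨q, hq⟩ := H.exists_counit_eq_one
  obtain ⟨t, ht⟩ := H.bijective_T₁.2 (q ⊗ₜ x)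
  refine ⟨t, ?_⟩
  rw [← sliceL_counit_T₁, ht]
  simp [hq]

/-- `a ⊗ b ↦ S(a) b`, where `S` is the antipode with values in the left multipliers. -/
noncomputable def antipodeL : A ⊗[K] A →ₗ[K] A := sliceL H.counit ∘ₗ H.equiv₁.symm.toLinearMap

/-- `a ⊗ b ↦ a S(b)`, where `S` is the antipode with values in the right multipliers. -/
noncomputable def antipodeR : A ⊗[K] A →ₗ[K] A := sliceR H.counit ∘ₗ H.equiv₂.symm.toLinearMap

theorem antipodeL_T₁ (t : A ⊗[K] A) : H.antipodeL (H.T₁ t) = sliceL H.counit t := by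
  simp [antipodeL]

theorem antipodeR_T₂ (t : A ⊗[K] A) : H.antipodeR (H.T₂ t) = sliceR H.counit t := by
  simp [antipodeR]

theorem surjective_antipodeR : Function.Surjective H.antipodeR := by
  rcases subsingleton_or_nontrivial A with hA | hA
  · exact fun x => ⟨0, Subsingleton.elim _ _⟩
  intro x
  obtain ⟨q, hq⟩ := H.exists_counit_eq_one
  exact ⟨H.T₂ (x ⊗ₜ q), by rw [antipodeR_T₂]; simp [hq]⟩

theorem mul_antipodeL (a b c : A) :
    a * H.antipodeL (b ⊗ₜ c) = H.antipodeR (a ⊗ₜ b) * c := by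
  have hc : H.antipodeL ∘ₗ H.T₁ = sliceL H.counit := LinearMap.ext H.antipodeL_T₁
  have h₁ : ∀ (x : A) (s : A ⊗[K] A), LinearMap.mul' K A (H.antipodeL.lTensor A
      (TensorProduct.assoc K A A A
      (H.T₂.rTensor A ((TensorProduct.assoc K A A A).symm (x ⊗ₜ H.T₁ s))))) =
      x * sliceL H.counit (H.T₁ s) := by
    intro x s
    rw [coassoc_apply, ← LinearMap.comp_apply (H.antipodeL.lTensor A), ← LinearMap.lTensor_comp, hc,
      sliceL_counit_T₁]
    induction s using TensorProduct.induction_on with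
    | zero => simp
    | add x y hx hy => simp only [map_add, TensorProduct.tmul_add, mul_add, hx, hy]
    | tmul p q =>
      have h := H.sliceR_counit_T₂ (x ⊗ₜ p)
      rw [LinearMap.mul'_apply] at h
      rw [LinearMap.mul'_apply, ← mul_assoc, ← h]
      simp only [TensorProduct.assoc_symm_tmul, LinearMap.rTensor_tmul]
      generalize H.T₂ (x ⊗ₜ p) = u
      induction u using TensorProduct.induction_on with
      | zero => simp
      | add x y hx hy => simp only [map_add, TensorProduct.add_tmul, add_mul, hx, hy]
      | tmul p q => simp [smul_mul_assoc]
  have h₂ : ∀ (y : A ⊗[K] A) (b : A), LinearMap.mul' K A (H.antipodeL.lTensor A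
      (TensorProduct.assoc K A A A (y ⊗ₜ b))) = H.antipodeR y * b := by
    intro y b
    obtain ⟨t, rfl⟩ := H.bijective_T₂.2 y
    rw [antipodeR_T₂]
    induction t using TensorProduct.induction_on with
    | zero => simp
    | add x y hx hy => simp only [map_add, TensorProduct.add_tmul, add_mul, hx, hy]
    | tmul x a =>
      obtain ⟨s, hs⟩ := H.bijective_T₁.2 (a ⊗ₜ b)
      have := h₁ x s
      rw [hs] at this
      simpa [smul_mul_assoc, mul_smul_comm] using this
  simpa using h₂ (a ⊗ₜ b) c

theorem antipodeL_tmul_mul (a b c : A) :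
    H.antipodeL (a ⊗ₜ (b * c)) = H.antipodeL (a ⊗ₜ b) * c := by
  rw [← sub_eq_zero]
  refine H.nondeg.2 _ fun x => ?_
  rw [LinearMap.mul_apply', mul_sub, mul_antipodeL, ← mul_assoc x, mul_antipodeL, mul_assoc,
    sub_self]

/-- `S(a b) c = S(b)(S(a) c)`: both sides, with `Δ(a)(1 ⊗ c)` for `a ⊗ c`, give `ε(a) S(b) c`. -/
theorem antipodeL_mul_tmul (a b c : A) :
    H.antipodeL ((a * b) ⊗ₜ c) = H.antipodeL (b ⊗ₜ H.antipodeL (a ⊗ₜ c)) := by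
  have h₁ : ∀ a (y : A ⊗[K] A), H.antipodeL (left (H.Δ a) y) = H.counit a • H.antipodeL y := by
    intro a y
    obtain ⟨t, rfl⟩ := H.bijective_T₁.2 y
    rw [antipodeL_T₁]
    induction t using TensorProduct.induction_on with
    | zero => simp
    | add x y hx hy => simp only [map_add, smul_add, hx, hy]
    | tmul b c => rw [← T₁_mul_tmul, antipodeL_T₁]; simp [counit_mul, mul_smul]
  have h₂ : ∀ y : A ⊗[K] A, H.antipodeL ((LinearMap.mulRight K b).rTensor A y) =
      H.antipodeL (b ⊗ₜ H.antipodeL y) := by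
    intro y
    obtain ⟨t, rfl⟩ := H.bijective_T₁.2 y
    rw [antipodeL_T₁]
    induction t using TensorProduct.induction_on with
    | zero => simp
    | add x y hx hy => simp only [map_add, TensorProduct.tmul_add, hx, hy]
    | tmul a c => rw [← left_Δ_tmul, h₁]; simp
  simpa using h₂ (a ⊗ₜ c)

/-- The condition that `H'` has the opposite comultiplication of `H`, in a form symmetric in the
two: `(Δ(a)(b ⊗ 1))(1 ⊗ c) = (Δ(a)(1 ⊗ c))(b ⊗ 1)`. -/
def IsOpposite (H H' : MultiplierHopfAlgebra K A) : Prop :=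
  ∀ a b c, (LinearMap.mulRight K c).lTensor A (TensorProduct.comm K A A (H'.T₁ (a ⊗ₜ b))) =
    (LinearMap.mulRight K b).rTensor A (H.T₁ (a ⊗ₜ c))

variable {H} {H' : MultiplierHopfAlgebra K A}

theorem IsOpposite.symm (h : IsOpposite H H') : IsOpposite H' H := by
  intro a b c
  have := congrArg (TensorProduct.comm K A A) (h a c b)
  rw [comm_lTensor, comm_rTensor, comm_comm_apply] at this
  exact this.symm

theorem IsOpposite.T₂_mul (h : IsOpposite H H') (x a b : A) :
    (LinearMap.mulRight K b).rTensor A (H.T₂ (x ⊗ₜ a)) =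
      (LinearMap.mulLeft K x).rTensor A (TensorProduct.comm K A A (H'.T₁ (a ⊗ₜ b))) := by
  refine eq_of_lTensor (fun y => LinearMap.mulRight K y) (fun m hm => H.nondeg.1 m hm) fun y => ?_
  rw [lTensor_rTensor_apply, lTensor_rTensor_apply, h, lTensor_mulRight_T₂,
    ← LinearMap.rTensor_comp_apply, ← LinearMap.rTensor_comp_apply]
  congr 2
  ext; simp [mul_assoc]

theorem IsOpposite.counit_eq (h : IsOpposite H H') : H'.counit = H.counit := by
  have h₁ : ∀ t, sliceL H.counit (H'.T₁ t) = LinearMap.mul' K A t := by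
    intro t
    induction t using TensorProduct.induction_on with
    | zero => simp
    | add x y hx hy => simp only [map_add, hx, hy]
    | tmul a b =>
      rw [← sub_eq_zero]
      refine H.nondeg.2 _ fun x => ?_
      have := congrArg (sliceR H.counit) (h.T₂_mul x a b)
      rw [sliceR_rTensor, sliceR_rTensor, sliceR_comm, sliceR_counit_T₂] at this
      simp only [LinearMap.mul_apply', mul_sub, LinearMap.mul'_apply, sub_eq_zero] at *
      rw [← mul_assoc]
      exact this.symm
  have h₂ : ∀ y : A ⊗[K] A, sliceL H.counit y = sliceL H'.counit y := by
    intro y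
    obtain ⟨t, rfl⟩ := H'.bijective_T₁.2 y
    rw [h₁, sliceL_counit_T₁]
  rcases subsingleton_or_nontrivial A with hA | hA
  · ext x; rw [Subsingleton.elim x 0, map_zero, map_zero]
  obtain ⟨p, hp⟩ := exists_ne (0 : A)
  ext x
  have := h₂ (x ⊗ₜ p)
  simp only [sliceL_tmul] at this
  exact (smul_left_injective K hp this).symm

/-- If the opposite comultiplication makes sense, then the antipode has values in `A`: for
`ε(q) = 1` one has `S(p) = S(q₍₁₎ p) q₍₂₎`. -/
theorem IsOpposite.exists_antipode (h : IsOpposite H H') :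
    ∃ S : A →ₗ[K] A, (∀ a b, S a * b = H.antipodeL (a ⊗ₜ b)) ∧
      (∀ a b, a * S b = H.antipodeR (a ⊗ₜ b)) ∧ ∀ a b, S (a * b) = S b * S a := by
  rcases subsingleton_or_nontrivial A with hA | hA
  · exact ⟨0, fun _ _ => Subsingleton.elim _ _, fun _ _ => Subsingleton.elim _ _,
      fun _ _ => Subsingleton.elim _ _⟩
  obtain ⟨q, hq⟩ := H.exists_counit_eq_one
  let S : A →ₗ[K] A := H.antipodeL ∘ₗ (TensorProduct.comm K A A).toLinearMap ∘ₗ H'.T₁ ∘ₗ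
    TensorProduct.mk K A A q
  have hL : ∀ t c, H.antipodeL t * c = H.antipodeL ((LinearMap.mulRight K c).lTensor A t) := by
    intro t c
    induction t using TensorProduct.induction_on with
    | zero => simp
    | add x y hx hy => simp only [map_add, add_mul, hx, hy]
    | tmul x y => simp [antipodeL_tmul_mul]
  have hS : ∀ a b, S a * b = H.antipodeL (a ⊗ₜ b) := by
    intro p c
    have h₁ : ∀ t, H.antipodeL ((LinearMap.mulRight K p).rTensor A t) =
        H.antipodeL (p ⊗ₜ H.antipodeL t) := by
      intro t
      induction t using TensorProduct.induction_on with
      | zero => simp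
      | add x y hx hy => simp only [map_add, TensorProduct.tmul_add, hx, hy]
      | tmul x y => simp [antipodeL_mul_tmul]
    change H.antipodeL (TensorProduct.comm K A A (H'.T₁ (q ⊗ₜ p))) * c = _
    rw [hL, h, h₁, antipodeL_T₁]
    simp [hq]
  refine ⟨S, hS, fun a b => ?_, fun a b => ?_⟩
  · rw [← sub_eq_zero]
    refine H.nondeg.1 _ fun c => ?_
    rw [LinearMap.mul_apply', sub_mul, mul_assoc, hS, mul_antipodeL, sub_self]
  · rw [← sub_eq_zero]
    refine H.nondeg.1 _ fun c => ?_
    rw [LinearMap.mul_apply', sub_mul, mul_assoc, hS, hS, hS, antipodeL_mul_tmul, sub_self]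

theorem IsOpposite.antipode_comp (h : IsOpposite H H') {S S' : A →ₗ[K] A}
    (hS : ∀ a b, S a * b = H.antipodeL (a ⊗ₜ b)) (hS' : ∀ a b, S' a * b = H'.antipodeL (a ⊗ₜ b))
    (hSR' : ∀ a b, a * S' b = H'.antipodeR (a ⊗ₜ b))
    (hm' : ∀ a b, S' (a * b) = S' b * S' a) (a : A) : S' (S a) = a := by
  have hLL : ∀ t, H.antipodeL t = LinearMap.mul' K A (S.rTensor A t) := by
    intro t
    induction t using TensorProduct.induction_on with
    | zero => simp
    | add x y hx hy => simp only [map_add, hx, hy]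
    | tmul x y => simp [hS]
  have hLL' : ∀ t, H'.antipodeL t = LinearMap.mul' K A (S'.rTensor A t) := by
    intro t
    induction t using TensorProduct.induction_on with
    | zero => simp
    | add x y hx hy => simp only [map_add, hx, hy]
    | tmul x y => simp [hS']
  -- `S'(a₍₂₎ b) S'(S(a₍₁₎)) = ε(a) S'(b) = S'(a₍₂₎ b) a₍₁₎`
  have h₁ : ∀ a b, LinearMap.mul' K A (TensorProduct.map S' (S' ∘ₗ S)
      (TensorProduct.comm K A A (H.T₁ (a ⊗ₜ b)))) = H.counit a • S' b := by
    intro a b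
    have : H.counit a • S' b = S' (H.antipodeL (H.T₁ (a ⊗ₜ b))) := by
      rw [antipodeL_T₁]; simp
    rw [this, hLL]
    generalize H.T₁ (a ⊗ₜ b) = t
    induction t using TensorProduct.induction_on with
    | zero => simp
    | add x y hx hy => simp only [map_add, hx, hy]
    | tmul x y => simp [hm']
  have h₂ : ∀ a b, LinearMap.mul' K A (TensorProduct.map S' LinearMap.id
      (TensorProduct.comm K A A (H.T₁ (a ⊗ₜ b)))) = H.counit a • S' b := by
    intro a b
    rw [← sub_eq_zero]
    refine H.nondeg.1 _ fun c => ?_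
    rw [LinearMap.mul_apply', sub_mul, sub_eq_zero]
    have e₁ : ∀ t : A ⊗[K] A, LinearMap.mul' K A (TensorProduct.map S' LinearMap.id
        (TensorProduct.comm K A A t)) * c = LinearMap.mul' K A (TensorProduct.map S' LinearMap.id
        (TensorProduct.comm K A A ((LinearMap.mulRight K c).rTensor A t))) := by
      intro t
      induction t using TensorProduct.induction_on with
      | zero => simp
      | add x y hx hy => simp only [map_add, add_mul, hx, hy]
      | tmul x y => simp [mul_assoc]
    have e₂ : S' b * H'.antipodeL (H'.T₁ (a ⊗ₜ c)) = LinearMap.mul' K A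
        (TensorProduct.map S' LinearMap.id (TensorProduct.comm K A A
        ((LinearMap.mulRight K b).lTensor A
          (TensorProduct.comm K A A (H'.T₁ (a ⊗ₜ c)))))) := by
      rw [hLL']
      generalize H'.T₁ (a ⊗ₜ c) = t
      induction t using TensorProduct.induction_on with
      | zero => simp
      | add x y hx hy => simp only [map_add, mul_add, hx, hy]
      | tmul x y => simp [hm', mul_assoc]
    rw [e₁, ← h, ← e₂, antipodeL_T₁, h.counit_eq]
    simp [mul_smul_comm, smul_mul_assoc]
  have h₃ : ∀ t, LinearMap.mul' K A (TensorProduct.map S' (S' ∘ₗ S) t) =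
      LinearMap.mul' K A (TensorProduct.map S' LinearMap.id t) := by
    intro t
    obtain ⟨u, hu⟩ := H.bijective_T₁.2 (TensorProduct.comm K A A t)
    have hu' : t = TensorProduct.comm K A A (H.T₁ u) := by rw [hu, comm_comm_apply]
    rw [hu']
    induction u using TensorProduct.induction_on generalizing t with
    | zero => simp
    | add x y hx hy =>
      simp only [map_add]
      rw [hx _ (comm_comm_apply _).symm rfl, hy _ (comm_comm_apply _).symm rfl]
    | tmul x y => rw [h₁, h₂]
  rw [← sub_eq_zero]
  refine H.nondeg.2 _ fun x => ?_
  obtain ⟨u, hu⟩ := H'.surjective_antipodeR x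
  rw [LinearMap.mul_apply', ← hu]
  clear hu
  induction u using TensorProduct.induction_on with
  | zero => simp
  | add x y hx hy => simp only [map_add, add_mul, hx, hy, add_zero]
  | tmul y z =>
    have := h₃ (z ⊗ₜ a)
    simp only [TensorProduct.map_tmul, LinearMap.mul'_apply, LinearMap.comp_apply,
      LinearMap.id_apply] at this
    rw [← hSR', mul_sub, mul_assoc, mul_assoc, this, sub_self]

end MultiplierHopfAlgebra

namespace RegularMultiplierHopfAlgebra

open MultiplierAlgebra

variable {K A : Type*} [Field K] [NonUnitalRing A] [Module K A] [IsScalarTower K A A]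
  [SMulCommClass K A A] (H : RegularMultiplierHopfAlgebra K A)

theorem isOpposite : MultiplierHopfAlgebra.IsOpposite H.toMultiplierHopfAlgebra H.cop := by
  intro a b c
  refine H.nondeg.tensor_ext fun z => ?_
  rw [lTensor_mulRight_mul, rTensor_mulRight_mul, H.T₁_mul]
  refine (TensorProduct.comm K A A).injective ?_
  rw [comm_mul, comm_comm_apply, H.cop.T₁_mul, H.cop_Δ]
  change TensorProduct.comm K A A (left (H.Δ a) (TensorProduct.comm K A A _)) = _
  simp only [comm_lTensor, comm_rTensor, comm_comm_apply, lTensor_rTensor_apply]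

theorem exists_isAntipode : ∃ S : A ≃ₗ[K] A, H.IsAntipode S := by
  have h := H.isOpposite
  obtain ⟨S, hS, hSR, hSm⟩ := h.exists_antipode
  obtain ⟨S', hS', hSR', hSm'⟩ := h.symm.exists_antipode
  refine ⟨LinearEquiv.ofLinearMap S S'
    (LinearMap.ext (h.symm.antipode_comp hS' hS hSR hSm))
    (LinearMap.ext (h.antipode_comp hS hS' hSR' hSm')), hSm,
    { H.counit with
      map_zero' := map_zero H.counit
      map_mul' := H.counit_mul }, ⟨fun a b => ?_, fun a b => ?_⟩, fun a b => ?_, fun a b => ?_⟩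
  · exact H.sliceL_counit_T₁ _
  · exact H.sliceR_counit_T₂ _
  · have e : ∀ t, LinearMap.mul' K A (S.rTensor A t) = H.antipodeL t := by
      intro t
      induction t using TensorProduct.induction_on with
      | zero => simp
      | add x y hx hy => simp only [map_add, hx, hy]
      | tmul x y => simp [hS]
    refine (e _).trans ?_
    rw [H.antipodeL_T₁]
    exact sliceL_tmul _ _ _
  · have e : ∀ t, LinearMap.mul' K A (S.lTensor A t) = H.antipodeR t := by
      intro t
      induction t using TensorProduct.induction_on with
      | zero => simp
      | add x y hx hy => simp only [map_add, hx, hy]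
      | tmul x y => simp [hSR]
    refine (e _).trans ?_
    rw [H.antipodeR_T₂]
    exact sliceR_tmul _ _ _

theorem isAntipode_antipode : H.IsAntipode H.antipode :=
  Classical.epsilon_spec H.exists_isAntipode

end RegularMultiplierHopfAlgebra

/-! ### Slices of the coproducts by the pairing -/

namespace MultiplierHopfPairing

variable {K A B : Type*} [Field K]
  [NonUnitalRing A] [Module K A] [IsScalarTower K A A] [SMulCommClass K A A]
  [NonUnitalRing B] [Module K B] [IsScalarTower K B B] [SMulCommClass K B B]
  {HA : RegularMultiplierHopfAlgebra K A} {HB : RegularMultiplierHopfAlgebra K B}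
  (P : MultiplierHopfPairing HA HB)

/-- The pairing with the roles of the two algebras exchanged. -/
def flip : MultiplierHopfPairing HB HA where
  form := P.form.flip
  nondegenerate := ⟨fun b h => P.nondegenerate.2 b h, fun a h => P.nondegenerate.1 a h⟩
  lactA := P.lactB
  ractA := P.ractB
  lactB := P.lactA
  ractB := P.ractA
  lactA_mul := P.lactB_mul
  ractA_mul b a b' := P.ractB_mul b a b'
  lactB_mul b a a' := P.lactA_mul b a a'
  ractB_mul a b a' := P.ractA_mul a b a'
  form_mul_right b a a' := P.form_mul_left a a' b
  form_mul_right' b a a' := P.form_mul_left' a a' b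
  form_mul_left b b' a := P.form_mul_right a b b'
  form_mul_left' b b' a := P.form_mul_right' a b b'
  unital_lactA := P.unital_lactB
  unital_ractA := P.unital_ractB
  unital_lactB := P.unital_lactA
  unital_ractB := P.unital_ractA

theorem separating_form (b : B) (h : ∀ a, P.form a b = 0) : b = 0 :=
  P.nondegenerate.2 b h

theorem separating_form_flip (a : A) (h : ∀ b, P.form.flip b a = 0) : a = 0 :=
  P.nondegenerate.1 a h

theorem ext_left {a a' : A} (h : ∀ b, P.form a b = P.form a' b) : a = a' := by
  rw [← sub_eq_zero]
  exact P.nondegenerate.1 _ fun b => by simp [h b]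

theorem ext_right {b b' : B} (h : ∀ a, P.form a b = P.form a b') : b = b' :=
  P.flip.ext_left h

theorem lactA_lactA (b b' : B) (a : A) : P.lactA b (P.lactA b' a) = P.lactA (b * b') a :=
  P.ext_left fun c => by simp only [← P.form_mul_right, mul_assoc]

theorem ractA_ractA (a : A) (b b' : B) : P.ractA (P.ractA a b) b' = P.ractA a (b * b') :=
  P.ext_left fun c => by simp only [← P.form_mul_right', mul_assoc]

theorem lactA_ractA (b b' : B) (a : A) :
    P.lactA b (P.ractA a b') = P.ractA (P.lactA b a) b' :=
  P.ext_left fun c => by simp only [← P.form_mul_right', ← P.form_mul_right, mul_assoc]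

theorem lactB_lactB (a a' : A) (b : B) : P.lactB a (P.lactB a' b) = P.lactB (a * a') b :=
  P.flip.lactA_lactA a a' b

theorem ractB_ractB (b : B) (a a' : A) : P.ractB (P.ractB b a) a' = P.ractB b (a * a') :=
  P.flip.ractA_ractA b a a'

theorem form_comp_mulRight (a : A) (b : B) :
    P.form a ∘ₗ LinearMap.mulRight K b = P.form (P.lactA b a) :=
  LinearMap.ext fun c => P.form_mul_right a c b

theorem form_comp_mulLeft (a : A) (b : B) :
    P.form a ∘ₗ LinearMap.mulLeft K b = P.form (P.ractA a b) :=
  LinearMap.ext fun c => P.form_mul_right' a b c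

theorem form_comp_lactB (a a' : A) : P.form a ∘ₗ P.lactB a' = P.form (a * a') :=
  LinearMap.ext fun c => (P.form_mul_left a a' c).symm

theorem form_comp_ractB (a a' : A) : P.form a ∘ₗ P.ractB.flip a' = P.form (a' * a) :=
  LinearMap.ext fun c => (P.form_mul_left' a' a c).symm

/-- Linear maps that agree on `B ▶ A = A` are equal. -/
theorem ext_lactA {X : Type*} [AddCommGroup X] [Module K X] {f g : A →ₗ[K] X}
    (h : ∀ b a, f (P.lactA b a) = g (P.lactA b a)) : f = g := by
  ext a
  obtain ⟨t, rfl⟩ := P.unital_lactA a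
  induction t using TensorProduct.induction_on with
  | zero => simp
  | add x y hx hy => simp only [map_add, hx, hy]
  | tmul b a => exact h b a

/-- Linear maps that agree on `A ◀ B = A` are equal. -/
theorem ext_ractA {X : Type*} [AddCommGroup X] [Module K X] {f g : A →ₗ[K] X}
    (h : ∀ a b, f (P.ractA a b) = g (P.ractA a b)) : f = g := by
  ext a
  obtain ⟨t, rfl⟩ := P.unital_ractA a
  induction t using TensorProduct.induction_on with
  | zero => simp
  | add x y hx hy => simp only [map_add, hx, hy]
  | tmul b a => exact h b a

theorem ext_sliceB {M : Type*} [AddCommGroup M] [Module K M] {z z' : M ⊗[K] B}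
    (h : ∀ a, sliceR (P.form a) z = sliceR (P.form a) z') : z = z' :=
  eq_of_sliceR (fun a => P.form a) P.separating_form h

theorem ext_sliceA {M : Type*} [AddCommGroup M] [Module K M] {z z' : M ⊗[K] A}
    (h : ∀ b, sliceR (P.form.flip b) z = sliceR (P.form.flip b) z') : z = z' :=
  eq_of_sliceR (fun b => P.form.flip b) P.separating_form_flip h

theorem sliceL_T₁B (d : A) (b b' : B) :
    sliceL (P.form d) (HB.T₁ (b ⊗ₜ b')) = P.ractB b d * b' :=
  (P.ractB_mul b d b').symm

theorem sliceR_coverFstB (d : A) (b b' : B) :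
    sliceR (P.form d) (HB.coverFst b b') = P.lactB d b * b' :=
  (P.lactB_mul d b b').symm

theorem sliceL_copT₁B (d : A) (b b' : B) :
    sliceL (P.form d) (HB.cop.T₁ (b ⊗ₜ b')) = P.lactB d b * b' := by
  rw [← sliceR_coverFstB, RegularMultiplierHopfAlgebra.coverFst, sliceR_comm]

theorem sliceR_T₁B (d : A) (b b' : B) :
    sliceR (P.form d) (HB.T₁ (b ⊗ₜ b')) = P.lactB (P.lactA b' d) b := by
  rw [← sub_eq_zero]
  refine HB.nondeg.1 _ fun x => ?_
  have h := congrArg (sliceR (P.form d)) (HB.isOpposite b x b')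
  rw [sliceR_rTensor, sliceR_lTensor, form_comp_mulRight] at h
  rw [LinearMap.mul_apply', sub_mul, sub_eq_zero, ← sliceR_coverFstB]
  exact h.symm

theorem sliceL_coverFstB (d : A) (b b' : B) :
    sliceL (P.form d) (HB.coverFst b b') = P.ractB b (P.lactA b' d) := by
  rw [← sub_eq_zero]
  refine HB.nondeg.1 _ fun x => ?_
  have h := congrArg (sliceL (P.form d)) (HB.isOpposite b b' x)
  rw [sliceL_rTensor, sliceL_lTensor, form_comp_mulRight, sliceL_T₁B] at h
  rw [LinearMap.mul_apply', sub_mul, sub_eq_zero]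
  exact h

theorem sliceR_T₂B (d : A) (b b' : B) :
    sliceR (P.form d) (HB.T₂ (b ⊗ₜ b')) = b * P.lactB d b' := by
  rw [← sub_eq_zero]
  refine HB.nondeg.1 _ fun x => ?_
  have h := congrArg (sliceR (P.form d)) (HB.isOpposite.T₂_mul b b' x)
  rw [sliceR_rTensor, sliceR_rTensor] at h
  rw [LinearMap.mul_apply', sub_mul, sub_eq_zero, mul_assoc, ← sliceR_coverFstB]
  exact h

theorem sliceL_T₂B (d : A) (b b' : B) :
    sliceL (P.form d) (HB.T₂ (b ⊗ₜ b')) = P.ractB b' (P.ractA d b) := by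
  rw [← sub_eq_zero]
  refine HB.nondeg.1 _ fun x => ?_
  have h := congrArg (sliceL (P.form d)) (HB.lTensor_mulRight_T₂ b b' x)
  rw [sliceL_rTensor, sliceL_lTensor, form_comp_mulLeft, sliceL_T₁B] at h
  rw [LinearMap.mul_apply', sub_mul, sub_eq_zero]
  exact h

theorem sliceR_copT₂B (d : A) (b b' : B) :
    sliceR (P.form d) (HB.cop.T₂ (b ⊗ₜ b')) = b * P.ractB b' d := by
  rw [← sub_eq_zero]
  refine HB.nondeg.1 _ fun x => ?_
  have h := congrArg (sliceR (P.form d)) (HB.isOpposite.symm.T₂_mul b b' x)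
  rw [sliceR_rTensor, sliceR_rTensor, sliceR_comm, sliceL_T₁B] at h
  rw [LinearMap.mul_apply', sub_mul, sub_eq_zero, mul_assoc]
  exact h

theorem sliceL_copT₂B (d : A) (b b' : B) :
    sliceL (P.form d) (HB.cop.T₂ (b ⊗ₜ b')) = P.lactB (P.ractA d b) b' := by
  rw [← sub_eq_zero]
  refine HB.nondeg.1 _ fun x => ?_
  have h := congrArg (sliceL (P.form d)) (HB.cop.lTensor_mulRight_T₂ b b' x)
  rw [sliceL_rTensor, sliceL_lTensor, form_comp_mulLeft, sliceL_copT₁B] at h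
  rw [LinearMap.mul_apply', sub_mul, sub_eq_zero]
  exact h

theorem sliceL_T₁A (c : B) (a a' : A) :
    sliceL (P.form.flip c) (HA.T₁ (a ⊗ₜ a')) = P.ractA a c * a' :=
  P.flip.sliceL_T₁B c a a'

theorem sliceL_coverFstA (c : B) (a a' : A) :
    sliceL (P.form.flip c) (HA.coverFst a a') = P.ractA a (P.lactB a' c) :=
  P.flip.sliceL_coverFstB c a a'

theorem sliceR_copT₂A (c : B) (a a' : A) :
    sliceR (P.form.flip c) (HA.cop.T₂ (a ⊗ₜ a')) = a * P.ractA a' c :=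
  P.flip.sliceR_copT₂B c a a'

end MultiplierHopfPairing

/-! ### Coverings of the actions -/

section Covering

variable {K X V : Type*} [Field K] [AddCommGroup X] [Module K X] [AddCommGroup V] [Module K V]

/-- A unital action of `X` on `V` has a covering `x ⊗ v ↦ x₍₂₎ v ⊗ x₍₁₎` with values in `V ⊗ X`. On
`v = x' v'` it is formed from `T(x ⊗ x') = x₍₁₎ ⊗ x₍₂₎ x'`; it is characterized by its slices. -/
theorem exists_covering {ι : Sort*} (φ : ι → X →ₗ[K] K) (hφ : ∀ x, (∀ i, φ i x = 0) → x = 0)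
    (act : X →ₗ[K] V →ₗ[K] V) (hact : Function.Surjective (TensorProduct.lift act))
    (T : X ⊗[K] X →ₗ[K] X ⊗[K] X) (h : ι → X →ₗ[K] V →ₗ[K] V)
    (hT : ∀ i x x' v, act (sliceL (φ i) (T (x ⊗ₜ x'))) v = h i x (act x' v)) :
    ∃ G : X →ₗ[K] V →ₗ[K] V ⊗[K] X, (∀ i x v, sliceR (φ i) (G x v) = h i x v) ∧
      (Function.Surjective T → Function.Surjective (TensorProduct.lift G)) := by
  let f : X ⊗[K] (X ⊗[K] V) →ₗ[K] X ⊗[K] V := (TensorProduct.lift act).lTensor X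
  have hf : Function.Surjective f := LinearMap.lTensor_surjective X hact
  let g : X ⊗[K] (X ⊗[K] V) →ₗ[K] V ⊗[K] X := (TensorProduct.comm K X V).toLinearMap ∘ₗ
    (TensorProduct.lift act).lTensor X ∘ₗ (TensorProduct.assoc K X X V).toLinearMap ∘ₗ
    T.rTensor V ∘ₗ (TensorProduct.assoc K X X V).symm.toLinearMap
  have hg : ∀ i w, sliceR (φ i) (g w) = TensorProduct.lift (h i) (f w) := by
    intro i w
    induction w using TensorProduct.induction_on with
    | zero => simp
    | add x y hx hy => simp only [map_add, hx, hy]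
    | tmul x t =>
      induction t using TensorProduct.induction_on with
      | zero => simp
      | add x y hx hy => simp only [map_add, TensorProduct.tmul_add, hx, hy]
      | tmul x' v =>
        simp only [f, g, LinearMap.comp_apply, LinearEquiv.coe_coe, LinearMap.lTensor_tmul,
          TensorProduct.lift.tmul, TensorProduct.assoc_symm_tmul, LinearMap.rTensor_tmul,
          sliceR_comm, sliceL_lTensor, ← hT]
        generalize T (x ⊗ₜ x') = u
        induction u using TensorProduct.induction_on with
        | zero => simp
        | add x y hx hy =>
          simp only [map_add, TensorProduct.add_tmul, LinearMap.add_apply, hx, hy]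
        | tmul y y' => simp
  obtain ⟨G, hG⟩ := exists_of_slices φ hf g _ hg
  refine ⟨TensorProduct.curry G, fun i x v => by simp [hG], fun hT z => ?_⟩
  have hgs : Function.Surjective g := (TensorProduct.comm K X V).surjective.comp <|
    (LinearMap.lTensor_surjective X hact).comp <| (TensorProduct.assoc K X X V).surjective.comp <|
    (LinearMap.rTensor_surjective V hT).comp (TensorProduct.assoc K X X V).symm.surjective
  obtain ⟨w, rfl⟩ := hgs z
  refine ⟨f w, eq_of_sliceR φ hφ fun i => ?_⟩
  rw [hg, ← hG]
  congr 1
  generalize f w = u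
  induction u using TensorProduct.induction_on with
  | zero => simp
  | add x y hx hy => simp only [map_add, hx, hy]
  | tmul y y' => simp

end Covering

/-! ### The twist maps -/

namespace MultiplierHopfPairing

variable {K A B : Type*} [Field K]
  [NonUnitalRing A] [Module K A] [IsScalarTower K A A] [SMulCommClass K A A]
  [NonUnitalRing B] [Module K B] [IsScalarTower K B B] [SMulCommClass K B B]
  {HA : RegularMultiplierHopfAlgebra K A} {HB : RegularMultiplierHopfAlgebra K B}
  (P : MultiplierHopfPairing HA HB)

theorem isLeftTwist_of_sliceR {R : B ⊗[K] A →ₗ[K] A ⊗[K] B}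
    (h : ∀ b a d, sliceR (P.form d) (R (b ⊗ₜ a)) = P.lactA (P.lactB d b) a) : P.IsLeftTwist R := by
  intro b a b'
  refine P.ext_sliceB fun d => ?_
  rw [sliceR_lTensor, form_comp_mulRight, h, sliceR_rTensor, RegularMultiplierHopfAlgebra.coverSnd,
    sliceR_T₁B]
  rfl

variable {P} in
theorem IsLeftTwist.sliceR {R : B ⊗[K] A →ₗ[K] A ⊗[K] B} (hR : P.IsLeftTwist R) (b : B) (a d : A) :
    sliceR (P.form d) (R (b ⊗ₜ a)) = P.lactA (P.lactB d b) a := by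
  let f' : A →ₗ[K] A →ₗ[K] A := LinearMap.mk₂ K
    (fun d a => _root_.sliceR (M := A) (P.form d) (R (b ⊗ₜ a)))
    (fun d d' a => by rw [map_add, sliceR_add_left])
    (fun c d a => by rw [map_smul, sliceR_smul_left])
    (fun d a a' => by simp [TensorProduct.tmul_add]) (fun c d a => by simp)
  have h : f' = P.lactA ∘ₗ P.lactB.flip b := by
    refine P.ext_lactA fun b' d => LinearMap.ext fun a => ?_
    have := congrArg (_root_.sliceR (M := A) (P.form d)) (hR b a b')
    rw [sliceR_lTensor, form_comp_mulRight, sliceR_rTensor, RegularMultiplierHopfAlgebra.coverSnd,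
      sliceR_T₁B] at this
    exact this
  exact LinearMap.congr_fun (LinearMap.congr_fun h d) a

theorem exists_isLeftTwist : ∃ R, P.IsLeftTwist R ∧ Function.Surjective R := by
  obtain ⟨G, hG, hs⟩ := exists_covering (fun d => P.form d) P.separating_form P.lactA P.unital_lactA
    HB.cop.T₁ (fun d => P.lactA ∘ₗ P.lactB d) (fun d b b' a => by
      simp [sliceL_copT₁B, lactA_lactA])
  exact ⟨TensorProduct.lift G, P.isLeftTwist_of_sliceR fun b a d => hG d b a,
    hs HB.cop.bijective_T₁.2⟩

theorem isLeftTwist_leftTwist : P.IsLeftTwist P.leftTwist :=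
  Classical.epsilon_spec (P.exists_isLeftTwist.imp fun _ h => h.1)

theorem sliceR_leftTwist (b : B) (a d : A) :
    sliceR (P.form d) (P.leftTwist (b ⊗ₜ a)) = P.lactA (P.lactB d b) a :=
  P.isLeftTwist_leftTwist.sliceR b a d

theorem sliceL_leftTwist (b e : B) (a : A) :
    sliceL (P.form.flip e) (P.leftTwist (b ⊗ₜ a)) = P.ractB b (P.ractA a e) := by
  refine P.ext_right fun d => ?_
  rw [← apply_sliceR, sliceR_leftTwist, ← P.form_mul_left', LinearMap.flip_apply,
    ← P.form_mul_right, P.form_mul_right', ← P.form_mul_left]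

theorem surjective_leftTwist : Function.Surjective P.leftTwist := by
  obtain ⟨R, hR, hs⟩ := P.exists_isLeftTwist
  convert hs
  refine TensorProduct.ext' fun b a => P.ext_sliceB fun d => ?_
  rw [sliceR_leftTwist, hR.sliceR]

theorem exists_twistRInv : ∃ Q : A ⊗[K] B →ₗ[K] A ⊗[K] B,
    (∀ a b d, sliceR (P.form d) (Q (a ⊗ₜ b)) = P.ractA a (P.ractB b d)) ∧
      Function.Surjective Q := by
  let c := (TensorProduct.comm K B B)
  obtain ⟨G, hG, hs⟩ := exists_covering (fun d => P.form d) P.separating_form P.ractA.flip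
    (by
      intro a
      obtain ⟨t, rfl⟩ := P.unital_ractA a
      refine ⟨TensorProduct.comm K A B t, ?_⟩
      induction t using TensorProduct.induction_on with
      | zero => simp
      | add x y hx hy => simp only [map_add, hx, hy]
      | tmul x y => simp)
    (c.toLinearMap ∘ₗ HB.cop.T₂ ∘ₗ c.toLinearMap) (fun d => P.ractA.flip ∘ₗ P.ractB.flip d)
    (fun d b b' a => by simp [c, sliceL_comm, sliceR_copT₂B, ractA_ractA])
  refine ⟨TensorProduct.lift G ∘ₗ (TensorProduct.comm K A B).toLinearMap,
    fun a b d => by simpa using hG d b a, ?_⟩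
  exact (hs (c.surjective.comp (HB.cop.bijective_T₂.2.comp c.surjective))).comp
    (TensorProduct.comm K A B).surjective

/-- The map `a ⊗ b ↦ a ◀ b₍₂₎ ⊗ b₍₁₎`, the inverse of the right twist. -/
noncomputable def twistRInv : A ⊗[K] B →ₗ[K] A ⊗[K] B := Classical.choose P.exists_twistRInv

theorem sliceR_twistRInv (a d : A) (b : B) :
    sliceR (P.form d) (P.twistRInv (a ⊗ₜ b)) = P.ractA a (P.ractB b d) :=
  (Classical.choose_spec P.exists_twistRInv).1 a b d

theorem surjective_twistRInv : Function.Surjective P.twistRInv :=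
  (Classical.choose_spec P.exists_twistRInv).2

theorem sliceL_twistRInv (a : A) (b e : B) :
    sliceL (P.form.flip e) (P.twistRInv (a ⊗ₜ b)) = P.lactB (P.lactA e a) b := by
  refine P.ext_right fun d => ?_
  rw [← apply_sliceR, sliceR_twistRInv, ← P.form_mul_left, LinearMap.flip_apply,
    ← P.form_mul_right', P.form_mul_right, ← P.form_mul_left']

theorem exists_coverB : ∃ G : A →ₗ[K] B →ₗ[K] B ⊗[K] A,
    ∀ a b c, sliceR (P.form.flip c) (G a b) = P.lactB (P.ractA a c) b := by
  obtain ⟨G, hG, -⟩ := exists_covering (fun c => P.form.flip c) P.separating_form_flip P.lactB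
    P.unital_lactB HA.T₁ (fun c => P.lactB ∘ₗ P.ractA.flip c) (fun c a a' b => by
      simp [sliceL_T₁A, lactB_lactB])
  exact ⟨G, fun a b c => hG c a b⟩

/-- The map `a ⊗ b ↦ a₍₂₎ ▶ b ⊗ a₍₁₎`. -/
noncomputable def coverB : A →ₗ[K] B →ₗ[K] B ⊗[K] A := Classical.choose P.exists_coverB

theorem sliceR_coverB (a : A) (b c : B) :
    sliceR (P.form.flip c) (P.coverB a b) = P.lactB (P.ractA a c) b :=
  Classical.choose_spec P.exists_coverB a b c

/-! ### The actions on products -/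

/-- `(c b) ◀ a = (c ◀ a₍₁₎)(b ◀ a₍₂₎)`. -/
theorem mul_ractB (c b : B) (a : A) :
    P.ractB (c * b) a = LinearMap.mul' K B ((P.ractB c).rTensor B (P.leftTwist (b ⊗ₜ a))) := by
  rw [← sub_eq_zero]
  refine HB.nondeg.1 _ fun x => ?_
  rw [LinearMap.mul_apply', sub_mul, sub_eq_zero, ← sliceL_T₁B, HB.T₁_mul_tmul]
  have e₁ : ∀ t : B ⊗[K] B, sliceL (P.form a) (MultiplierAlgebra.left (HB.Δ c) t) =
      LinearMap.mul' K B ((P.ractB c).rTensor B ((P.lactA.flip a).rTensor B t)) := by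
    intro t
    induction t using TensorProduct.induction_on with
    | zero => simp
    | add x y hx hy => simp only [map_add, hx, hy]
    | tmul x y =>
      rw [HB.left_Δ_tmul, sliceL_rTensor, form_comp_mulRight, sliceL_T₁B]
      simp
  have e₂ := P.isLeftTwist_leftTwist b a x
  rw [RegularMultiplierHopfAlgebra.coverSnd] at e₂
  rw [e₁, ← e₂]
  generalize P.leftTwist (b ⊗ₜ a) = t
  induction t using TensorProduct.induction_on with
  | zero => simp
  | add x y hx hy => simp only [map_add, hx, hy, add_mul]
  | tmul x y => simp [mul_assoc]

/-- `b ▶ (a a') = (b₍₁₎ ▶ a)(b₍₂₎ ▶ a')`. -/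
theorem lactA_mul_eq (b : B) (a a' : A) :
    P.lactA b (a * a') =
      LinearMap.mul' K A ((P.lactA.flip a').lTensor A (P.leftTwist (b ⊗ₜ a))) := by
  refine P.ext_left fun c => ?_
  rw [← P.form_mul_right, P.form_mul_left', mul_ractB]
  generalize P.leftTwist (b ⊗ₜ a) = t
  induction t using TensorProduct.induction_on with
  | zero => simp
  | add x y hx hy => simp only [map_add, hx, hy, LinearMap.add_apply]
  | tmul x y => simp [P.form_mul_right, P.form_mul_left']

/-- `(a a') ◀ c = (a ◀ c₍₁₎)(a' ◀ c₍₂₎)`. -/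
theorem mul_ractA (a a' : A) (c : B) :
    P.ractA (a * a') c = LinearMap.mul' K A (TensorProduct.comm K A A
      ((P.ractA a).lTensor A (P.twistRInv (a' ⊗ₜ c)))) := by
  rw [← sub_eq_zero]
  refine HA.nondeg.1 _ fun x => ?_
  rw [LinearMap.mul_apply', sub_mul, sub_eq_zero, ← sliceL_T₁A, HA.T₁_mul_tmul]
  have e₁ : ∀ t : A ⊗[K] A, sliceL (P.form.flip c) (MultiplierAlgebra.left (HA.Δ a) t) =
      LinearMap.mul' K A (TensorProduct.comm K A A ((P.ractA a).lTensor A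
        (TensorProduct.comm K B A ((P.lactB.flip c).rTensor A t)))) := by
    intro t
    induction t using TensorProduct.induction_on with
    | zero => simp
    | add x y hx hy => simp only [map_add, hx, hy]
    | tmul x y =>
      rw [HA.left_Δ_tmul, sliceL_rTensor]
      have := P.flip.form_comp_mulRight c x
      rw [show P.form.flip c ∘ₗ LinearMap.mulRight K x = P.form.flip (P.lactB x c) from this,
        sliceL_T₁A]
      simp
  have e₂ : TensorProduct.comm K B A ((P.lactB.flip c).rTensor A (HA.T₁ (a' ⊗ₜ x))) =
      (LinearMap.mulRight K x).rTensor B (P.twistRInv (a' ⊗ₜ c)) := by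
    refine P.ext_sliceB fun d => ?_
    rw [sliceR_rTensor, sliceR_twistRInv, sliceR_comm, sliceL_rTensor]
    have : P.form d ∘ₗ P.lactB.flip c = P.form.flip (P.ractB c d) :=
      LinearMap.ext fun a => by
        simp [← P.form_mul_left, ← P.form_mul_left']
    rw [this, sliceL_T₁A]
    rfl
  rw [e₁, e₂]
  generalize P.twistRInv (a' ⊗ₜ c) = t
  induction t using TensorProduct.induction_on with
  | zero => simp
  | add x y hx hy => simp only [map_add, hx, hy, add_mul]
  | tmul x y => simp [mul_assoc]

/-- `a ▶ (b b') = b₍₁₎ (a ◀ b₍₂₎ ▶ b')`. -/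
theorem lactB_mul_eq (a : A) (b b' : B) :
    P.lactB a (b * b') = LinearMap.mul' K B ((P.lactB.flip b').lTensor B
      (TensorProduct.comm K A B (P.twistRInv (a ⊗ₜ b)))) := by
  refine P.ext_right fun d => ?_
  rw [← P.form_mul_left, P.form_mul_right', mul_ractA]
  generalize P.twistRInv (a ⊗ₜ b) = t
  induction t using TensorProduct.induction_on with
  | zero => simp
  | add x y hx hy => simp only [map_add, hx, hy, LinearMap.add_apply]
  | tmul x y => simp [P.form_mul_right', P.form_mul_left]

/-- `d ▶ (b b') = (d₍₁₎ ▶ b)(d₍₂₎ ▶ b')`. -/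
theorem lactB_mul_eq' (d : A) (b b' : B) :
    P.lactB d (b * b') = LinearMap.mul' K B ((P.lactB.flip b).rTensor B
      (TensorProduct.comm K B A (P.coverB d b'))) := by
  rw [← sub_eq_zero]
  refine HB.nondeg.1 _ fun x => ?_
  rw [LinearMap.mul_apply', sub_mul, sub_eq_zero, ← sliceL_copT₁B, HB.cop.T₁_mul_tmul]
  have e₁ : ∀ t : B ⊗[K] B, sliceL (P.form d) (MultiplierAlgebra.left (HB.cop.Δ b) t) =
      LinearMap.mul' K B ((P.lactB.flip b).rTensor B ((P.lactA.flip d).rTensor B t)) := by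
    intro t
    induction t using TensorProduct.induction_on with
    | zero => simp
    | add x y hx hy => simp only [map_add, hx, hy]
    | tmul x y =>
      rw [HB.cop.left_Δ_tmul, sliceL_rTensor, form_comp_mulRight, sliceL_copT₁B]
      simp
  have e₂ : TensorProduct.comm K A B ((P.lactA.flip d).rTensor B (HB.cop.T₁ (b' ⊗ₜ x))) =
      (LinearMap.mulRight K x).rTensor A (P.coverB d b') := by
    refine P.ext_sliceA fun c => ?_
    rw [sliceR_rTensor, sliceR_coverB, sliceR_comm, sliceL_rTensor]
    have : P.form.flip c ∘ₗ P.lactA.flip d = P.form (P.ractA d c) :=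
      LinearMap.ext fun a => by
        simp [← P.form_mul_right, ← P.form_mul_right']
    rw [this, sliceL_copT₁B]
    rfl
  have e₃ := congrArg (TensorProduct.comm K B A) e₂
  rw [comm_comm_apply] at e₃
  rw [e₁, e₃]
  generalize P.coverB d b' = t
  induction t using TensorProduct.induction_on with
  | zero => simp
  | add x y hx hy => simp only [map_add, hx, hy, add_mul]
  | tmul x y => simp [mul_assoc]

/-! ### The right twist -/

theorem counit_ractB {ε : B →ₙₐ[K] K} (hε : HB.IsCounit ε) (b : B) (f : A) :
    ε (P.ractB b f) = P.form f b := by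
  rcases subsingleton_or_nontrivial B with hB | hB
  · rw [Subsingleton.elim (P.ractB b f) 0, Subsingleton.elim b 0, map_zero, map_zero]
  have h₁ : ∀ b', sliceR (ε : B →ₗ[K] K) (HB.T₁ (b ⊗ₜ b')) = ε b' • b := by
    intro b'
    rw [← sub_eq_zero]
    refine HB.nondeg.2 _ fun x => ?_
    rw [LinearMap.mul_apply', mul_sub, sub_eq_zero]
    have h := congrArg (sliceR (ε : B →ₗ[K] K)) (HB.lTensor_mulRight_T₂ x b b')
    have h' : (ε : B →ₗ[K] K) ∘ₗ LinearMap.mulRight K b' = ε b' • (ε : B →ₗ[K] K) :=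
      LinearMap.ext fun y => by simp [mul_comm]
    rw [sliceR_rTensor, sliceR_lTensor, h', sliceR_smul_left] at h
    have h3 : sliceR (ε : B →ₗ[K] K) (HB.T₂ (x ⊗ₜ b)) = x * b := hε.2 x b
    rw [h3] at h
    rw [mul_smul_comm]
    exact h.symm
  obtain ⟨q, hq⟩ : ∃ q, ε q ≠ 0 := by
    by_contra! h
    obtain ⟨x, hx⟩ := exists_ne (0 : B)
    refine hx (HB.nondeg.1 x fun y => ?_)
    have : sliceL (ε : B →ₗ[K] K) (HB.T₁ (x ⊗ₜ y)) = x * y := hε.1 x y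
    have h0 : (ε : B →ₗ[K] K) = 0 := LinearMap.ext h
    rw [h0] at this
    simpa [sliceL] using this.symm
  have h₂ := congrArg ε (P.sliceL_T₁B f b q)
  have h₃ := apply_sliceR (ε : B →ₗ[K] K) (P.form f) (HB.T₁ (b ⊗ₜ q))
  rw [h₁, map_smul, smul_eq_mul] at h₃
  rw [map_mul, mul_comm] at h₂
  refine mul_left_cancel₀ hq (h₂.symm.trans h₃.symm)

/-- `c b₍₃₎ S⁻¹(b₍₂₎) ⟨f, b₍₁₎⟩ = ⟨f, b⟩ c`. -/
theorem mul_antipode_symm (c b : B) (f : A) :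
    LinearMap.mul' K B ((HB.antipode.symm.toLinearMap ∘ₗ P.ractB.flip f).lTensor B
      (HB.cop.T₂ (c ⊗ₜ b))) = P.form f b • c := by
  obtain ⟨hS, ε, hε, -, hSR⟩ := HB.isAntipode_antipode
  have h₁ : ∀ b, LinearMap.mul' K B (TensorProduct.comm K B B
      (HB.antipode.toLinearMap.rTensor B (HB.cop.T₂ (c ⊗ₜ b)))) = ε b • HB.antipode c := by
    intro b
    rw [← sub_eq_zero]
    refine HB.nondeg.2 _ fun x => ?_
    rw [LinearMap.mul_apply', mul_sub, sub_eq_zero]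
    have e₁ : (LinearMap.mulLeft K x).lTensor B (HB.cop.T₂ (c ⊗ₜ b)) =
        TensorProduct.comm K B B ((LinearMap.mulLeft K c).lTensor B (HB.T₂ (x ⊗ₜ b))) := by
      refine P.ext_sliceB fun d => ?_
      rw [sliceR_lTensor, form_comp_mulLeft, sliceR_copT₂B, sliceR_comm, sliceL_lTensor,
        sliceL_T₂B]
      rfl
    have e₂ : ∀ t : B ⊗[K] B, x * LinearMap.mul' K B (TensorProduct.comm K B B
        (HB.antipode.toLinearMap.rTensor B t)) = LinearMap.mul' K B (TensorProduct.comm K B B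
        (HB.antipode.toLinearMap.rTensor B ((LinearMap.mulLeft K x).lTensor B t))) := by
      intro t
      induction t using TensorProduct.induction_on with
      | zero => simp
      | add x y hx hy => simp only [map_add, hx, hy, mul_add]
      | tmul x y => simp [mul_assoc]
    have e₃ : ∀ t : B ⊗[K] B, LinearMap.mul' K B (TensorProduct.comm K B B
        (HB.antipode.toLinearMap.rTensor B (TensorProduct.comm K B B
          ((LinearMap.mulLeft K c).lTensor B t)))) =
        LinearMap.mul' K B (HB.antipode.toLinearMap.lTensor B t) * HB.antipode c := by
      intro t
      induction t using TensorProduct.induction_on with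
      | zero => simp
      | add x y hx hy => simp only [map_add, hx, hy, add_mul]
      | tmul x y => simp [mul_assoc, hS]
    rw [e₂, e₁, e₃, hSR, smul_mul_assoc, mul_smul_comm]
  have h₂ : (P.ractB.flip f).lTensor B (HB.cop.T₂ (c ⊗ₜ b)) = HB.cop.T₂ (c ⊗ₜ P.ractB b f) := by
    refine P.ext_sliceB fun d => ?_
    rw [sliceR_lTensor, form_comp_ractB, sliceR_copT₂B, sliceR_copT₂B, ractB_ractB]
  rw [LinearMap.lTensor_comp_apply, h₂]
  refine HB.antipode.injective ?_
  rw [map_smul, ← P.counit_ractB hε, ← h₁]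
  generalize HB.cop.T₂ (c ⊗ₜ P.ractB b f) = t
  induction t using TensorProduct.induction_on with
  | zero => simp
  | add x y hx hy => simp only [map_add, hx, hy]
  | tmul x y => simp [hS]

theorem twistRInv_ractA (a : A) (c b : B) :
    P.twistRInv (P.ractA a c ⊗ₜ b) = (P.ractA a).rTensor B (HB.cop.T₂ (c ⊗ₜ b)) := by
  refine P.ext_sliceB fun d => ?_
  rw [sliceR_twistRInv, sliceR_rTensor, sliceR_copT₂B, ractA_ractA]

/-- `a ⊗ b ↦ a ◀ S⁻¹(b₍₂₎) ⊗ b₍₁₎ b'`. -/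
noncomputable def coveredRightTwist (b' : B) : A ⊗[K] B →ₗ[K] A ⊗[K] B :=
  (TensorProduct.lift P.ractA ∘ₗ HB.antipode.symm.toLinearMap.lTensor A).rTensor B ∘ₗ
    (TensorProduct.assoc K A B B).symm.toLinearMap ∘ₗ
    (HB.cop.T₁ ∘ₗ (TensorProduct.mk K B B).flip b').lTensor A

theorem coveredRightTwist_tmul (a : A) (b b' : B) :
    P.coveredRightTwist b' (a ⊗ₜ b) =
      (P.ractA a ∘ₗ HB.antipode.symm.toLinearMap).rTensor B
        (TensorProduct.comm K B B (HB.coverFst b b')) := by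
  rw [RegularMultiplierHopfAlgebra.coverFst, comm_comm_apply]
  simp only [coveredRightTwist, LinearMap.comp_apply, LinearMap.lTensor_tmul,
    LinearMap.flip_apply, TensorProduct.mk_apply, LinearEquiv.coe_coe]
  generalize HB.cop.T₁ (b ⊗ₜ b') = t
  induction t using TensorProduct.induction_on with
  | zero => simp
  | add x y hx hy => simp only [map_add, TensorProduct.tmul_add, hx, hy]
  | tmul x y => simp

theorem coveredRightTwist_twistRInv (b' : B) (z : A ⊗[K] B) :
    P.coveredRightTwist b' (P.twistRInv z) = (LinearMap.mulRight K b').lTensor A z := by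
  have h : P.coveredRightTwist b' ∘ₗ P.twistRInv = (LinearMap.mulRight K b').lTensor A := by
    refine TensorProduct.ext (P.ext_ractA fun a c => LinearMap.ext fun b => ?_)
    change P.coveredRightTwist b' (P.twistRInv (P.ractA a c ⊗ₜ b)) =
      P.ractA a c ⊗ₜ (b * b')
    rw [twistRInv_ractA]
    refine P.ext_sliceB fun d => ?_
    have e : ∀ t : B ⊗[K] B, sliceR (P.form d)
        (P.coveredRightTwist b' ((P.ractA a).rTensor B t)) =
        P.ractA a (LinearMap.mul' K B ((HB.antipode.symm.toLinearMap ∘ₗ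
          P.ractB.flip (P.lactA b' d)).lTensor B t)) := by
      intro t
      induction t using TensorProduct.induction_on with
      | zero => simp
      | add x y hx hy => simp only [map_add, hx, hy]
      | tmul x y =>
        rw [LinearMap.rTensor_tmul, coveredRightTwist_tmul, sliceR_rTensor, sliceR_comm,
          sliceL_coverFstB]
        simp [ractA_ractA]
    rw [e, mul_antipode_symm, sliceR_tmul, P.form_mul_right, map_smul]
  exact LinearMap.congr_fun h z

theorem injective_twistRInv : Function.Injective P.twistRInv := by
  intro z z' h
  refine eq_of_lTensor (fun b' => LinearMap.mulRight K b') (fun b hb => HB.nondeg.1 b hb)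
    fun b' => ?_
  rw [← coveredRightTwist_twistRInv, h, coveredRightTwist_twistRInv]

theorem isRightTwist_rightTwist : P.IsRightTwist P.rightTwist := by
  let e := LinearEquiv.ofBijective P.twistRInv ⟨P.injective_twistRInv, P.surjective_twistRInv⟩
  refine Classical.epsilon_spec (p := P.IsRightTwist) ⟨e.symm.toLinearMap, fun a b b' => ?_⟩
  rw [← coveredRightTwist_tmul, ← P.coveredRightTwist_twistRInv]
  exact congrArg _ (e.apply_symm_apply _)

theorem rightTwist_twistRInv (z : A ⊗[K] B) : P.rightTwist (P.twistRInv z) = z := by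
  have h : ∀ b' w, (LinearMap.mulRight K b').lTensor A (P.rightTwist w) =
      P.coveredRightTwist b' w := by
    intro b' w
    induction w using TensorProduct.induction_on with
    | zero => simp
    | add x y hx hy => simp only [map_add, hx, hy]
    | tmul a b => rw [coveredRightTwist_tmul, P.isRightTwist_rightTwist]
  refine eq_of_lTensor (fun b' => LinearMap.mulRight K b') (fun b hb => HB.nondeg.1 b hb)
    fun b' => ?_
  rw [h, coveredRightTwist_twistRInv]

theorem twistRInv_rightTwist (z : A ⊗[K] B) : P.twistRInv (P.rightTwist z) = z := by
  obtain ⟨w, rfl⟩ := P.surjective_twistRInv z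
  rw [rightTwist_twistRInv]

theorem surjective_twist : Function.Surjective P.twist := by
  intro z
  obtain ⟨w, hw⟩ := P.surjective_leftTwist (P.twistRInv z)
  exact ⟨w, by rw [twist, LinearMap.comp_apply, hw, rightTwist_twistRInv]⟩

/-- The left twist as an endomorphism `a ⊗ b ↦ b₍₁₎ ▶ a ⊗ b₍₂₎` of `A ⊗ B`. -/
noncomputable def twistL : A ⊗[K] B →ₗ[K] A ⊗[K] B :=
  P.leftTwist ∘ₗ (TensorProduct.comm K A B).toLinearMap

@[simp] theorem twistL_tmul (a : A) (b : B) : P.twistL (a ⊗ₜ b) = P.leftTwist (b ⊗ₜ a) := by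
  simp [twistL]

theorem leftTwist_lactA (b c : B) (a : A) :
    P.leftTwist (b ⊗ₜ P.lactA c a) = (P.lactA.flip a).rTensor B (HB.coverFst b c) := by
  refine P.ext_sliceB fun d => ?_
  rw [sliceR_leftTwist, sliceR_rTensor, sliceR_coverFstB, lactA_lactA]
  rfl

/-- Both composites are `a ⊗ b ↦ b₍₁₎ ▶ a ◀ b₍₃₎ ⊗ b₍₂₎`. -/
theorem twistRInv_twistL (z : A ⊗[K] B) :
    P.twistRInv (P.twistL z) = P.twistL (P.twistRInv z) := by
  have h : P.twistRInv ∘ₗ P.twistL = P.twistL ∘ₗ P.twistRInv := by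
    refine TensorProduct.ext (P.ext_ractA fun a c' => ?_)
    revert a
    suffices h : ((TensorProduct.mk K A B).compr₂ (P.twistRInv ∘ₗ P.twistL)) ∘ₗ P.ractA.flip c' =
        ((TensorProduct.mk K A B).compr₂ (P.twistL ∘ₗ P.twistRInv)) ∘ₗ P.ractA.flip c' from
      fun a => LinearMap.congr_fun h a
    refine P.ext_lactA fun c a => LinearMap.ext fun b => ?_
    change P.twistRInv (P.twistL (P.ractA (P.lactA c a) c' ⊗ₜ b)) =
      P.twistL (P.twistRInv (P.ractA (P.lactA c a) c' ⊗ₜ b))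
    rw [twistRInv_ractA, twistL_tmul, ← lactA_ractA, leftTwist_lactA]
    refine P.ext_sliceB fun d => ?_
    let Φ : B ⊗[K] B →ₗ[K] A := TensorProduct.lift (P.ractA ∘ₗ P.lactA.flip a)
    have e₁ : ∀ t : B ⊗[K] B, sliceR (P.form d) (P.twistRInv
        ((P.lactA.flip (P.ractA a c')).rTensor B t)) =
        Φ ((LinearMap.mulLeft K c' ∘ₗ P.ractB.flip d).lTensor B t) := by
      intro t
      induction t using TensorProduct.induction_on with
      | zero => simp
      | add x y hx hy => simp only [map_add, hx, hy]
      | tmul x y => simp [Φ, sliceR_twistRInv, lactA_ractA, ractA_ractA]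
    have e₂ : ∀ t : B ⊗[K] B, sliceR (P.form d) (P.twistL
        ((P.ractA (P.lactA c a)).rTensor B t)) =
        Φ (TensorProduct.comm K B B ((LinearMap.mulRight K c ∘ₗ P.lactB d).lTensor B t)) := by
      intro t
      induction t using TensorProduct.induction_on with
      | zero => simp
      | add x y hx hy => simp only [map_add, hx, hy]
      | tmul x y => simp [Φ, sliceR_leftTwist, lactA_ractA, lactA_lactA]
    rw [e₁, e₂]
    congr 1
    refine P.ext_sliceB fun g => ?_
    rw [sliceR_lTensor, sliceR_comm, sliceL_lTensor, sliceL_copT₂B, ← LinearMap.comp_assoc,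
      form_comp_mulLeft, form_comp_ractB, sliceR_coverFstB]
    simp [lactB_lactB]
  exact LinearMap.congr_fun h z

end MultiplierHopfPairing

/-! ### Compatible actions of the two algebras -/

section Through

variable {K X Y V W Z : Type*} [Field K] [AddCommGroup X] [Module K X] [AddCommGroup Y]
  [Module K Y] [AddCommGroup V] [Module K V] [AddCommGroup W] [Module K W] [AddCommGroup Z]
  [Module K Z]

/-- For a covering `k : x ⊗ v ↦ x₍₂₎ v ⊗ x₍₁₎` and a map `g : y ⊗ w ↦ y w`, the map
`x ⊗ (v ⊗ w) ↦ x₍₂₎ v ⊗ x₍₁₎ w`. -/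
noncomputable def throughCover (k : X →ₗ[K] V →ₗ[K] V ⊗[K] Y) (g : Y →ₗ[K] W →ₗ[K] Z) :
    X →ₗ[K] V ⊗[K] W →ₗ[K] V ⊗[K] Z :=
  TensorProduct.curry ((TensorProduct.lift g).lTensor V ∘ₗ
    (TensorProduct.assoc K V Y W).toLinearMap ∘ₗ (TensorProduct.lift k).rTensor W ∘ₗ
    (TensorProduct.assoc K X V W).symm.toLinearMap)

@[simp] theorem throughCover_tmul (k : X →ₗ[K] V →ₗ[K] V ⊗[K] Y) (g : Y →ₗ[K] W →ₗ[K] Z) (x : X)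
    (v : V) (w : W) : throughCover k g x (v ⊗ₜ w) = (g.flip w).lTensor V (k x v) := by
  simp only [throughCover, TensorProduct.curry_apply, LinearMap.comp_apply, LinearEquiv.coe_coe,
    TensorProduct.assoc_symm_tmul, LinearMap.rTensor_tmul, TensorProduct.lift.tmul]
  generalize k x v = t
  induction t using TensorProduct.induction_on with
  | zero => simp
  | add x y hx hy => simp only [map_add, TensorProduct.add_tmul, hx, hy]
  | tmul x y => simp

theorem sliceR_assoc_symm (φ : Z →ₗ[K] K) (t : V ⊗[K] (W ⊗[K] Z)) :
    sliceR φ ((TensorProduct.assoc K V W Z).symm t) = (sliceR φ).lTensor V t := by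
  induction t using TensorProduct.induction_on with
  | zero => simp
  | add x y hx hy => simp only [map_add, hx, hy]
  | tmul v s =>
    induction s using TensorProduct.induction_on with
    | zero => simp
    | add x y hx hy => simp only [map_add, TensorProduct.tmul_add, hx, hy]
    | tmul x y => simp

theorem sliceR_throughCover (k : X →ₗ[K] V →ₗ[K] V ⊗[K] X) (k' : X →ₗ[K] W →ₗ[K] W ⊗[K] X)
    (g : X →ₗ[K] W →ₗ[K] W) (φ : X →ₗ[K] K) (f : X →ₗ[K] X)
    (hk : ∀ x v, f.lTensor V (k x v) = k (f x) v) (hk' : ∀ x w, sliceR φ (k' x w) = g (f x) w)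
    (x : X) (z : V ⊗[K] W) :
    sliceR φ ((TensorProduct.assoc K V W X).symm (throughCover k k' x z)) =
      throughCover k g (f x) z := by
  induction z using TensorProduct.induction_on with
  | zero => simp
  | add x y hx hy => simp only [map_add, hx, hy]
  | tmul v w =>
    rw [throughCover_tmul, throughCover_tmul, sliceR_assoc_symm, ← hk,
      ← LinearMap.lTensor_comp_apply, ← LinearMap.lTensor_comp_apply]
    congr 2
    ext y
    exact hk' y w

end Through

theorem throughCover_mul {K X V W : Type*} [Field K] [NonUnitalRing X] [Module K X]
    [IsScalarTower K X X] [SMulCommClass K X X] [AddCommGroup V] [Module K V] [AddCommGroup W]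
    [Module K W] (k : X →ₗ[K] V →ₗ[K] V ⊗[K] X)
    (hk : ∀ x x' v, k (x * x') v = (LinearMap.mul' K X).lTensor V
      (TensorProduct.assoc K V X X ((k x).rTensor X (k x' v))))
    (g : X →ₗ[K] W →ₗ[K] W) (hg : ∀ x x' w, g (x * x') w = g x (g x' w)) (x x' : X)
    (z : V ⊗[K] W) :
    throughCover k g (x * x') z = throughCover k g x (throughCover k g x' z) := by
  induction z using TensorProduct.induction_on with
  | zero => simp
  | add x y hx hy => simp only [map_add, hx, hy]
  | tmul v w =>
    rw [throughCover_tmul, throughCover_tmul, hk]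
    generalize k x' v = t
    induction t using TensorProduct.induction_on with
    | zero => simp
    | add x y hx hy => simp only [map_add, hx, hy]
    | tmul v y =>
      simp only [LinearMap.rTensor_tmul, LinearMap.lTensor_tmul, throughCover_tmul,
        LinearMap.flip_apply]
      generalize k x v = t
      induction t using TensorProduct.induction_on with
      | zero => simp
      | add x y hx hy => simp only [map_add, TensorProduct.add_tmul, hx, hy]
      | tmul v y' => simp [hg]

namespace MultiplierHopfPairing

variable {K A B : Type*} [Field K]
  [NonUnitalRing A] [Module K A] [IsScalarTower K A A] [SMulCommClass K A A]
  [NonUnitalRing B] [Module K B] [IsScalarTower K B B] [SMulCommClass K B B]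
  {HA : RegularMultiplierHopfAlgebra K A} {HB : RegularMultiplierHopfAlgebra K B}
  {P : MultiplierHopfPairing HA HB}

/-- A vector space with an action of `A` and an action of `B` for which `a₍₂₎ v ⊗ a₍₁₎` and
`b₍₁₎ v ⊗ b₍₂₎` make sense as elements of `V ⊗ A` and `V ⊗ B`. No relation between the two actions
is imposed; `IsHeisenberg` and `IsDouble` are the relations of interest. -/
structure DoubleAction (P : MultiplierHopfPairing HA HB) (V : Type*) [AddCommGroup V]
    [Module K V] where
  /-- The action of `A`. -/
  actA : A →ₗ[K] V →ₗ[K] V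
  /-- The action of `B`. -/
  actB : B →ₗ[K] V →ₗ[K] V
  actA_mul : ∀ a a' v, actA (a * a') v = actA a (actA a' v)
  actB_mul : ∀ b b' v, actB (b * b') v = actB b (actB b' v)
  /-- The covering `a₍₂₎ v ⊗ a₍₁₎`. -/
  coverA : A →ₗ[K] V →ₗ[K] V ⊗[K] A
  /-- The covering `b₍₁₎ v ⊗ b₍₂₎`. -/
  coverB : B →ₗ[K] V →ₗ[K] V ⊗[K] B
  sliceR_coverA : ∀ a v c, sliceR (P.form.flip c) (coverA a v) = actA (P.ractA a c) v
  sliceR_coverB : ∀ b v d, sliceR (P.form d) (coverB b v) = actB (P.lactB d b) v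

/-- The functional `⟨·, c⟩ ⊗ ⟨d, ·⟩` on `A ⊗ B`. -/
noncomputable def formAB (P : MultiplierHopfPairing HA HB) (c : B) (d : A) : A ⊗[K] B →ₗ[K] K :=
  P.form d ∘ₗ sliceL (P.form.flip c)

@[simp] theorem formAB_tmul (c : B) (d : A) (a : A) (b : B) :
    P.formAB c d (a ⊗ₜ b) = P.form a c * P.form d b := by
  simp [formAB]

/-- The map `(· ◀ c) ⊗ (d ▶ ·)` on `A ⊗ B`. -/
noncomputable def translate (P : MultiplierHopfPairing HA HB) (c : B) (d : A) :
    A ⊗[K] B →ₗ[K] A ⊗[K] B :=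
  TensorProduct.map (P.ractA.flip c) (P.lactB d)

@[simp] theorem translate_tmul (c : B) (d : A) (a : A) (b : B) :
    P.translate c d (a ⊗ₜ b) = P.ractA a c ⊗ₜ P.lactB d b := by
  simp [translate]

theorem separating_formAB (z : A ⊗[K] B) (h : ∀ i : B × A, P.formAB i.1 i.2 z = 0) : z = 0 :=
  eq_of_sliceL (fun c => P.form.flip c) P.separating_form_flip fun c =>
    P.ext_right fun d => by simpa [formAB] using h (c, d)

theorem ext_formAB {V : Type*} [AddCommGroup V] [Module K V] {t t' : V ⊗[K] (A ⊗[K] B)}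
    (h : ∀ c d, sliceR (P.formAB c d) t = sliceR (P.formAB c d) t') : t = t' :=
  eq_of_sliceR (fun i : B × A => P.formAB i.1 i.2) P.separating_formAB fun i => h i.1 i.2

theorem eq_zero_of_ractA (a : A) (h : ∀ c, P.ractA a c = 0) : a = 0 := by
  refine P.ext_left fun b => ?_
  obtain ⟨t, rfl⟩ := HB.surjective_mul' b
  induction t using TensorProduct.induction_on with
  | zero => simp
  | add x y hx hy => simp only [map_add, hx, hy]
  | tmul x y => simp [P.form_mul_right', h]

theorem eq_zero_of_lactA (a : A) (h : ∀ c, P.lactA c a = 0) : a = 0 := by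
  refine P.ext_left fun b => ?_
  obtain ⟨t, rfl⟩ := HB.surjective_mul' b
  induction t using TensorProduct.induction_on with
  | zero => simp
  | add x y hx hy => simp only [map_add, hx, hy]
  | tmul x y => simp [P.form_mul_right, h]

theorem eq_zero_of_translate (z : A ⊗[K] B) (h : ∀ c d, P.translate c d z = 0) : z = 0 := by
  refine eq_of_lTensor (fun d => P.lactB d) P.flip.eq_zero_of_lactA fun d => ?_
  refine eq_of_rTensor (fun c => P.ractA.flip c) P.eq_zero_of_ractA fun c => ?_
  have : ∀ z : A ⊗[K] B, (P.ractA.flip c).rTensor B ((P.lactB d).lTensor A z) =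
      P.translate c d z := by
    intro z
    induction z using TensorProduct.induction_on with
    | zero => simp
    | add x y hx hy => simp only [map_add, hx, hy]
    | tmul x y => simp
  rw [this, this, h, map_zero]

theorem twistL_translate (c : B) (d : A) (z : A ⊗[K] B) :
    P.twistL (P.translate c d z) = P.translate c d (P.twistL z) := by
  induction z using TensorProduct.induction_on with
  | zero => simp
  | add x y hx hy => simp only [map_add, hx, hy]
  | tmul a b =>
    refine P.ext_sliceB fun f => ?_
    have : ∀ z : A ⊗[K] B, sliceR (P.form f) (P.translate c d z) =
        P.ractA (sliceR (P.form (f * d)) z) c := by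
      intro z
      induction z using TensorProduct.induction_on with
      | zero => simp
      | add x y hx hy => simp only [map_add, hx, hy, LinearMap.add_apply]
      | tmul x y => simp [← P.form_mul_left]
    rw [this, translate_tmul, twistL_tmul, twistL_tmul, sliceR_leftTwist, sliceR_leftTwist,
      lactA_ractA, lactB_lactB]

namespace DoubleAction

variable {V W : Type*} [AddCommGroup V] [Module K V] [AddCommGroup W] [Module K W]
  (ρ : DoubleAction P V) (σ : DoubleAction P W)

theorem lTensor_lactB_coverA (a : A) (c : B) (v : V) :
    (P.lactB.flip c).lTensor V (ρ.coverA a v) =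
      (ρ.actA.flip v).rTensor B (P.twistRInv (a ⊗ₜ c)) := by
  refine P.ext_sliceB fun d => ?_
  have : P.form d ∘ₗ P.lactB.flip c = P.form.flip (P.ractB c d) :=
    LinearMap.ext fun a => by simp [← P.form_mul_left, ← P.form_mul_left']
  rw [sliceR_lTensor, this, ρ.sliceR_coverA, sliceR_rTensor, sliceR_twistRInv]
  rfl

theorem lTensor_lactA_coverB (d : A) (b : B) (v : V) :
    (P.lactA.flip d).lTensor V (ρ.coverB b v) =
      (ρ.actB.flip v).rTensor A (P.coverB d b) := by
  refine P.ext_sliceA fun c => ?_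
  have : P.form.flip c ∘ₗ P.lactA.flip d = P.form (P.ractA d c) :=
    LinearMap.ext fun a => by simp [← P.form_mul_right, ← P.form_mul_right']
  rw [sliceR_lTensor, this, ρ.sliceR_coverB, sliceR_rTensor, P.sliceR_coverB]
  rfl

theorem lTensor_ractA_coverA (a : A) (c : B) (v : V) :
    (P.ractA.flip c).lTensor V (ρ.coverA a v) = ρ.coverA (P.ractA a c) v := by
  refine P.ext_sliceA fun e => ?_
  have : P.form.flip e ∘ₗ P.ractA.flip c = P.form.flip (c * e) :=
    LinearMap.ext fun a => by simp [← P.form_mul_right']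
  rw [sliceR_lTensor, this, ρ.sliceR_coverA, ρ.sliceR_coverA, ractA_ractA]

theorem lTensor_lactB_coverB (b : B) (d : A) (v : V) :
    (P.lactB d).lTensor V (ρ.coverB b v) = ρ.coverB (P.lactB d b) v := by
  refine P.ext_sliceB fun e => ?_
  rw [sliceR_lTensor, form_comp_lactB, ρ.sliceR_coverB, ρ.sliceR_coverB, lactB_lactB]

theorem coverA_mul (a a' : A) (v : V) : ρ.coverA (a * a') v = (LinearMap.mul' K A).lTensor V
    (TensorProduct.assoc K V A A ((ρ.coverA a).rTensor A (ρ.coverA a' v))) := by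
  refine P.ext_sliceA fun c => ?_
  have e : ∀ t : V ⊗[K] A, sliceR (P.form.flip c) ((LinearMap.mul' K A).lTensor V
      (TensorProduct.assoc K V A A ((ρ.coverA a).rTensor A t))) =
      TensorProduct.lift (ρ.actA ∘ₗ P.ractA a).flip ((P.lactB.flip c).lTensor V t) := by
    intro t
    induction t using TensorProduct.induction_on with
    | zero => simp
    | add x y hx hy => simp only [map_add, hx, hy]
    | tmul v x =>
      simp only [LinearMap.rTensor_tmul, LinearMap.lTensor_tmul, TensorProduct.lift.tmul,
        LinearMap.flip_apply, LinearMap.comp_apply, ← ρ.sliceR_coverA]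
      generalize ρ.coverA a v = u
      induction u using TensorProduct.induction_on with
      | zero => simp
      | add x y hx hy => simp only [map_add, TensorProduct.add_tmul, hx, hy]
      | tmul w y => simp [P.form_mul_left]
  rw [e, ρ.sliceR_coverA, mul_ractA, lTensor_lactB_coverA]
  generalize P.twistRInv (a' ⊗ₜ c) = t
  induction t using TensorProduct.induction_on with
  | zero => simp
  | add x y hx hy => simp only [map_add, hx, hy, LinearMap.add_apply]
  | tmul x y => simp [ρ.actA_mul]

theorem coverB_mul (b b' : B) (v : V) : ρ.coverB (b * b') v = (LinearMap.mul' K B).lTensor V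
    (TensorProduct.assoc K V B B ((ρ.coverB b).rTensor B (ρ.coverB b' v))) := by
  refine P.ext_sliceB fun d => ?_
  have e : ∀ t : V ⊗[K] B, sliceR (P.form d) ((LinearMap.mul' K B).lTensor V
      (TensorProduct.assoc K V B B ((ρ.coverB b).rTensor B t))) =
      TensorProduct.lift (ρ.actB ∘ₗ P.lactB.flip b).flip ((P.lactA.flip d).lTensor V t) := by
    intro t
    induction t using TensorProduct.induction_on with
    | zero => simp
    | add x y hx hy => simp only [map_add, hx, hy]
    | tmul v x =>
      simp only [LinearMap.rTensor_tmul, LinearMap.lTensor_tmul, TensorProduct.lift.tmul,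
        LinearMap.flip_apply, LinearMap.comp_apply, ← ρ.sliceR_coverB]
      generalize ρ.coverB b v = u
      induction u using TensorProduct.induction_on with
      | zero => simp
      | add x y hx hy => simp only [map_add, TensorProduct.add_tmul, hx, hy]
      | tmul w y => simp [P.form_mul_right]
  rw [e, ρ.sliceR_coverB, lactB_mul_eq', lTensor_lactA_coverB]
  generalize P.coverB d b' = t
  induction t using TensorProduct.induction_on with
  | zero => simp
  | add x y hx hy => simp only [map_add, hx, hy, LinearMap.add_apply]
  | tmul x y => simp [ρ.actB_mul]

/-- The tensor product, on which `a` acts by `a₍₂₎ ⊗ a₍₁₎` and `b` by `b₍₁₎ ⊗ b₍₂₎`. -/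
noncomputable def tensor : DoubleAction P (V ⊗[K] W) where
  actA := throughCover ρ.coverA σ.actA
  actB := throughCover ρ.coverB σ.actB
  actA_mul := throughCover_mul _ ρ.coverA_mul _ σ.actA_mul
  actB_mul := throughCover_mul _ ρ.coverB_mul _ σ.actB_mul
  coverA := (throughCover ρ.coverA σ.coverA).compr₂
    (TensorProduct.assoc K V W A).symm.toLinearMap
  coverB := (throughCover ρ.coverB σ.coverB).compr₂
    (TensorProduct.assoc K V W B).symm.toLinearMap
  sliceR_coverA a z c := sliceR_throughCover _ _ _ _ (P.ractA.flip c)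
    (fun a v => ρ.lTensor_ractA_coverA a c v) (fun a w => σ.sliceR_coverA a w c) a z
  sliceR_coverB b z d := sliceR_throughCover _ _ _ _ (P.lactB d)
    (fun b v => ρ.lTensor_lactB_coverB b d v) (fun b w => σ.sliceR_coverB b w d) b z

/-- The map `a ⊗ b ↦ (v ↦ a b v)`. -/
noncomputable def ab : A ⊗[K] B →ₗ[K] V →ₗ[K] V :=
  TensorProduct.lift (LinearMap.mk₂ K (fun a b => ρ.actA a ∘ₗ ρ.actB b)
    (fun a a' b => by ext; simp) (fun c a b => by ext; simp) (fun a b b' => by ext; simp)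
    (fun c a b => by ext; simp))

@[simp] theorem ab_tmul (a : A) (b : B) (v : V) : ρ.ab (a ⊗ₜ b) v = ρ.actA a (ρ.actB b v) := by
  simp [ab]

/-- The map `a ⊗ b ↦ (v ↦ b a v)`. -/
noncomputable def ba : A ⊗[K] B →ₗ[K] V →ₗ[K] V :=
  TensorProduct.lift (LinearMap.mk₂ K (fun a b => ρ.actB b ∘ₗ ρ.actA a)
    (fun a a' b => by ext; simp) (fun c a b => by ext; simp) (fun a b b' => by ext; simp)
    (fun c a b => by ext; simp))

@[simp] theorem ba_tmul (a : A) (b : B) (v : V) : ρ.ba (a ⊗ₜ b) v = ρ.actB b (ρ.actA a v) := by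
  simp [ba]

/-- The map `(a ⊗ b) ⊗ v ↦ a₍₂₎ b₍₁₎ v ⊗ (a₍₁₎ ⊗ b₍₂₎)`. -/
noncomputable def coverAB : A ⊗[K] B →ₗ[K] V →ₗ[K] V ⊗[K] (A ⊗[K] B) :=
  TensorProduct.lift (LinearMap.mk₂ K (fun a b => (TensorProduct.assoc K V A B).toLinearMap ∘ₗ
      (ρ.coverA a).rTensor B ∘ₗ ρ.coverB b)
    (fun a a' b => by ext; simp [LinearMap.rTensor_add])
    (fun c a b => by ext; simp [LinearMap.rTensor_smul])
    (fun a b b' => by ext; simp) (fun c a b => by ext; simp))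

theorem coverAB_tmul (a : A) (b : B) (v : V) : ρ.coverAB (a ⊗ₜ b) v =
    TensorProduct.assoc K V A B ((ρ.coverA a).rTensor B (ρ.coverB b v)) := by
  simp [coverAB]

/-- The map `(a ⊗ b) ⊗ v ↦ b₍₁₎ a₍₂₎ v ⊗ (a₍₁₎ ⊗ b₍₂₎)`. -/
noncomputable def coverBA : A ⊗[K] B →ₗ[K] V →ₗ[K] V ⊗[K] (A ⊗[K] B) :=
  TensorProduct.lift (LinearMap.mk₂ K (fun a b =>
      (TensorProduct.comm K B A).toLinearMap.lTensor V ∘ₗ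
      (TensorProduct.assoc K V B A).toLinearMap ∘ₗ (ρ.coverB b).rTensor A ∘ₗ ρ.coverA a)
    (fun a a' b => by ext; simp)
    (fun c a b => by ext; simp)
    (fun a b b' => by ext; simp [LinearMap.rTensor_add])
    (fun c a b => by ext; simp [LinearMap.rTensor_smul]))

theorem coverBA_tmul (a : A) (b : B) (v : V) : ρ.coverBA (a ⊗ₜ b) v =
    (TensorProduct.comm K B A).toLinearMap.lTensor V
      (TensorProduct.assoc K V B A ((ρ.coverB b).rTensor A (ρ.coverA a v))) := by
  simp [coverBA]

theorem sliceR_coverAB (c : B) (d : A) (z : A ⊗[K] B) (v : V) :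
    sliceR (P.formAB c d) (ρ.coverAB z v) = ρ.ab (P.translate c d z) v := by
  induction z using TensorProduct.induction_on with
  | zero => simp
  | add x y hx hy => simp only [map_add, hx, hy, LinearMap.add_apply]
  | tmul a b =>
    rw [coverAB_tmul, translate_tmul, ab_tmul, ← ρ.sliceR_coverB]
    generalize ρ.coverB b v = t
    induction t using TensorProduct.induction_on with
    | zero => simp
    | add x y hx hy => simp only [map_add, hx, hy]
    | tmul v y =>
      simp only [LinearMap.rTensor_tmul, sliceR_tmul, map_smul, ← ρ.sliceR_coverA]
      generalize ρ.coverA a v = t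
      induction t using TensorProduct.induction_on with
      | zero => simp
      | add x y hx hy => simp only [map_add, hx, hy, TensorProduct.add_tmul, smul_add]
      | tmul v y => simp [smul_smul, mul_comm]

/-- A functional on `A ⊗ B` applied to the last two legs of `b₍₁₎ a₍₂₎ v ⊗ (a₍₁₎ ⊗ b₍₂₎)`, where the
functional is `x ⊗ y ↦ ⟨g(x), y⟩`. -/
theorem sliceR_coverBA_of_form (φ : A ⊗[K] B →ₗ[K] K) (g : A →ₗ[K] A)
    (hφ : ∀ x y, φ (x ⊗ₜ y) = P.form (g x) y) (a : A) (b : B) (v : V) :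
    sliceR φ (ρ.coverBA (a ⊗ₜ b) v) =
      TensorProduct.lift ρ.actB.flip ((P.lactB.flip b ∘ₗ g).lTensor V (ρ.coverA a v)) := by
  rw [coverBA_tmul]
  generalize ρ.coverA a v = t
  induction t using TensorProduct.induction_on with
  | zero => simp
  | add x y hx hy => simp only [map_add, hx, hy]
  | tmul v x =>
    simp only [LinearMap.rTensor_tmul, LinearMap.lTensor_tmul, TensorProduct.lift.tmul,
      LinearMap.flip_apply, LinearMap.comp_apply, ← ρ.sliceR_coverB]
    generalize ρ.coverB b v = t
    induction t using TensorProduct.induction_on with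
    | zero => simp
    | add x y hx hy => simp only [map_add, hx, hy, TensorProduct.add_tmul]
    | tmul v y => simp [hφ]

theorem sliceR_coverBA (c : B) (d : A) (z : A ⊗[K] B) (v : V) :
    sliceR (P.formAB c d) (ρ.coverBA z v) = ρ.ba (P.translate c d z) v := by
  induction z using TensorProduct.induction_on with
  | zero => simp
  | add x y hx hy => simp only [map_add, hx, hy, LinearMap.add_apply]
  | tmul a b =>
    rw [coverBA_tmul, translate_tmul, ba_tmul, ← ρ.sliceR_coverA]
    generalize ρ.coverA a v = t
    induction t using TensorProduct.induction_on with
    | zero => simp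
    | add x y hx hy => simp only [map_add, hx, hy]
    | tmul v y =>
      simp only [LinearMap.rTensor_tmul, sliceR_tmul, map_smul, ← ρ.sliceR_coverB]
      generalize ρ.coverB b v = t
      induction t using TensorProduct.induction_on with
      | zero => simp
      | add x y hx hy => simp only [map_add, hx, hy, TensorProduct.add_tmul, smul_add]
      | tmul v y => simp [mul_smul]

theorem lTensor_translate_coverAB (c : B) (d : A) (z : A ⊗[K] B) (v : V) :
    (P.translate c d).lTensor V (ρ.coverAB z v) = ρ.coverAB (P.translate c d z) v := by
  refine ext_formAB (P := P) fun c' d' => ?_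
  have h : P.formAB c' d' ∘ₗ P.translate c d = P.formAB (c * c') (d' * d) :=
    TensorProduct.ext' fun a b => by simp [P.form_mul_left, P.form_mul_right']
  rw [sliceR_lTensor, h, sliceR_coverAB, sliceR_coverAB]
  congr 1
  induction z using TensorProduct.induction_on with
  | zero => simp
  | add x y hx hy => simp only [map_add, hx, hy]
  | tmul a b => simp [ractA_ractA, lactB_lactB]

/-- Both sides are `⟨a₍₁₎, b₍₃₎⟩ b₍₁₎ a₍₃₎ v ⊗ (a₍₂₎ ⊗ b₍₂₎)`. -/
theorem coverBA_twistRInv (z : A ⊗[K] B) (v : V) :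
    ρ.coverBA (P.twistRInv z) v = P.twistRInv.lTensor V (ρ.coverBA z v) := by
  induction z using TensorProduct.induction_on with
  | zero => simp
  | add x y hx hy => simp only [map_add, hx, hy, LinearMap.add_apply]
  | tmul a b =>
    refine ext_formAB (P := P) fun c d => ?_
    rw [sliceR_lTensor, sliceR_coverBA, ρ.sliceR_coverBA_of_form _ (LinearMap.mulLeft K d ∘ₗ P.lactA c)]
    · have h : (P.lactB.flip b ∘ₗ P.lactA c).lTensor V (ρ.coverA a v) =
          (ρ.actA.flip v ∘ₗ P.ractA.flip c).rTensor B (P.twistRInv (a ⊗ₜ b)) := by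
        refine P.ext_sliceB fun f => ?_
        have : P.form f ∘ₗ P.lactB.flip b ∘ₗ P.lactA c = P.form.flip (P.ractB b f * c) :=
          LinearMap.ext fun a => by
            simp [← P.form_mul_left, P.form_mul_right, P.form_mul_left']
        rw [sliceR_lTensor, this, ρ.sliceR_coverA, sliceR_rTensor, sliceR_twistRInv]
        simp [ractA_ractA]
      have h' : P.lactB.flip b ∘ₗ LinearMap.mulLeft K d ∘ₗ P.lactA c =
          P.lactB d ∘ₗ P.lactB.flip b ∘ₗ P.lactA c := by
        ext; simp [lactB_lactB]
      rw [h', LinearMap.lTensor_comp_apply, h]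
      generalize P.twistRInv (a ⊗ₜ b) = t
      induction t using TensorProduct.induction_on with
      | zero => simp
      | add x y hx hy => simp only [map_add, hx, hy, LinearMap.add_apply]
      | tmul x y => simp
    · intro x y
      have := congrArg (P.form d) (P.sliceL_twistRInv x y c)
      rw [← P.form_mul_left] at this
      exact this

/-- The relation `b a = (b₍₁₎ ▶ a) b₍₂₎` of the Heisenberg double. -/
def IsHeisenberg : Prop := ∀ z v, ρ.ba z v = ρ.ab (P.twistL z) v

/-- The relation `⟨a₍₁₎, b₍₂₎⟩ b₍₁₎ a₍₂₎ = ⟨a₍₂₎, b₍₁₎⟩ a₍₁₎ b₍₂₎` of the Drinfel'd double. -/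
def IsDouble : Prop := ∀ z v, ρ.ba (P.twistRInv z) v = ρ.ab (P.twistL z) v

variable {ρ σ}

theorem IsHeisenberg.coverBA (h : ρ.IsHeisenberg) (z : A ⊗[K] B) (v : V) :
    ρ.coverBA z v = ρ.coverAB (P.twistL z) v :=
  ext_formAB (P := P) fun c d => by
    rw [sliceR_coverBA, sliceR_coverAB, h, twistL_translate]

/-- The relation of `𝒟`, applied to the last legs of `a` and the first legs of `b`: the two sides are
`⟨a₍₂₎, b₍₂₎⟩ b₍₁₎ a₍₃₎ v ⊗ (a₍₁₎ ⊗ b₍₃₎)` and `⟨a₍₃₎, b₍₁₎⟩ a₍₂₎ b₍₂₎ v ⊗ (a₍₁₎ ⊗ b₍₃₎)`. -/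
theorem IsDouble.lTensor_coverBA (h : ρ.IsDouble) (z : A ⊗[K] B) (v : V) :
    P.twistL.lTensor V (ρ.coverBA z v) = ρ.coverAB (P.twistL z) v := by
  refine ext_formAB (P := P) fun c d => ?_
  rw [sliceR_lTensor, sliceR_coverAB, ← twistL_translate, ← h]
  induction z using TensorProduct.induction_on with
  | zero => simp
  | add x y hx hy => simp only [map_add, hx, hy, LinearMap.add_apply]
  | tmul a b =>
    rw [ρ.sliceR_coverBA_of_form _ (LinearMap.mulRight K d ∘ₗ P.ractA.flip c)]
    · have h' : P.lactB.flip b ∘ₗ LinearMap.mulRight K d ∘ₗ P.ractA.flip c =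
          P.lactB.flip (P.lactB d b) ∘ₗ P.ractA.flip c := by
        ext; simp [lactB_lactB]
      rw [h', LinearMap.lTensor_comp_apply, lTensor_ractA_coverA, lTensor_lactB_coverA,
        translate_tmul]
      generalize P.twistRInv (P.ractA a c ⊗ₜ P.lactB d b) = t
      induction t using TensorProduct.induction_on with
      | zero => simp
      | add x y hx hy => simp only [map_add, hx, hy, LinearMap.add_apply]
      | tmul x y => simp
    · intro x y
      have := congrArg (P.form d) (P.sliceL_leftTwist y c x)
      rw [← P.form_mul_left'] at this
      simpa [formAB] using this

variable (ρ σ)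

theorem tensor_ab_tmul (z : A ⊗[K] B) (v : V) (w : W) :
    (ρ.tensor σ).ab z (v ⊗ₜ w) = (σ.ab.flip w).lTensor V (ρ.coverAB z v) := by
  induction z using TensorProduct.induction_on with
  | zero => simp
  | add x y hx hy => simp only [map_add, hx, hy, LinearMap.add_apply]
  | tmul a b =>
    rw [ab_tmul, coverAB_tmul]
    change throughCover ρ.coverA σ.actA a (throughCover ρ.coverB σ.actB b (v ⊗ₜ w)) = _
    rw [throughCover_tmul]
    generalize ρ.coverB b v = t
    induction t using TensorProduct.induction_on with
    | zero => simp
    | add x y hx hy => simp only [map_add, hx, hy]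
    | tmul v y =>
      simp only [LinearMap.rTensor_tmul, LinearMap.lTensor_tmul, throughCover_tmul]
      generalize ρ.coverA a v = t
      induction t using TensorProduct.induction_on with
      | zero => simp
      | add x y hx hy => simp only [map_add, hx, hy, TensorProduct.add_tmul]
      | tmul v y => simp

theorem tensor_ba_tmul (z : A ⊗[K] B) (v : V) (w : W) :
    (ρ.tensor σ).ba z (v ⊗ₜ w) = (σ.ba.flip w).lTensor V (ρ.coverBA z v) := by
  induction z using TensorProduct.induction_on with
  | zero => simp
  | add x y hx hy => simp only [map_add, hx, hy, LinearMap.add_apply]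
  | tmul a b =>
    rw [ba_tmul, coverBA_tmul]
    change throughCover ρ.coverB σ.actB b (throughCover ρ.coverA σ.actA a (v ⊗ₜ w)) = _
    rw [throughCover_tmul]
    generalize ρ.coverA a v = t
    induction t using TensorProduct.induction_on with
    | zero => simp
    | add x y hx hy => simp only [map_add, hx, hy]
    | tmul v y =>
      simp only [LinearMap.rTensor_tmul, LinearMap.lTensor_tmul, throughCover_tmul]
      generalize ρ.coverB b v = t
      induction t using TensorProduct.induction_on with
      | zero => simp
      | add x y hx hy => simp only [map_add, hx, hy, TensorProduct.add_tmul]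
      | tmul v y => simp

theorem tensor_coverAB_tmul (z : A ⊗[K] B) (v : V) (w : W) :
    (ρ.tensor σ).coverAB z (v ⊗ₜ w) = (TensorProduct.assoc K V W (A ⊗[K] B)).symm
      ((σ.coverAB.flip w).lTensor V (ρ.coverAB z v)) := by
  refine ext_formAB (P := P) fun c d => ?_
  rw [sliceR_coverAB, tensor_ab_tmul, sliceR_assoc_symm, ← lTensor_translate_coverAB,
    ← LinearMap.lTensor_comp_apply, ← LinearMap.lTensor_comp_apply]
  congr 2
  exact LinearMap.ext fun z => (σ.sliceR_coverAB c d z w).symm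

/-- The common pattern of the tensor product rules below: a relation `ba ∘ q = ab ∘ k` on `W` becomes
the relation `ba ∘ q = ab ∘ twistL` on `V ⊗ W`, if `q` can be pulled out of `b₍₁₎ a₍₂₎ v ⊗ (a₍₁₎ ⊗ b₍₂₎)`
and `k`, applied to the last two legs, turns this into `coverAB` of the left twist. -/
theorem tensor_relation {q k : A ⊗[K] B →ₗ[K] A ⊗[K] B}
    (hW : ∀ z w, σ.ba (q z) w = σ.ab (k z) w)
    (hq : ∀ z v, ρ.coverBA (q z) v = q.lTensor V (ρ.coverBA z v))
    (hk : ∀ z v, k.lTensor V (ρ.coverBA z v) = ρ.coverAB (P.twistL z) v) (z : A ⊗[K] B)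
    (u : V ⊗[K] W) : (ρ.tensor σ).ba (q z) u = (ρ.tensor σ).ab (P.twistL z) u := by
  induction u using TensorProduct.induction_on with
  | zero => simp
  | add x y hx hy => simp only [map_add, hx, hy]
  | tmul v w =>
    rw [tensor_ba_tmul, tensor_ab_tmul, hq, ← hk, ← LinearMap.lTensor_comp_apply,
      ← LinearMap.lTensor_comp_apply]
    congr 2
    exact LinearMap.ext fun z => hW z w

variable {ρ σ}

theorem IsDouble.tensor (hρ : ρ.IsDouble) (hσ : σ.IsDouble) : (ρ.tensor σ).IsDouble :=
  tensor_relation ρ σ hσ ρ.coverBA_twistRInv hρ.lTensor_coverBA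

theorem IsDouble.tensor_isHeisenberg (hρ : ρ.IsDouble) (hσ : σ.IsHeisenberg) :
    (ρ.tensor σ).IsHeisenberg :=
  tensor_relation ρ σ (q := LinearMap.id) hσ (fun z v => by simp) hρ.lTensor_coverBA

theorem IsHeisenberg.tensor_isDouble (hρ : ρ.IsHeisenberg)
    (hσ : ∀ z w, σ.ba (P.twistRInv z) w = σ.ab z w) : (ρ.tensor σ).IsDouble :=
  tensor_relation ρ σ (k := LinearMap.id) hσ ρ.coverBA_twistRInv
    (fun z v => by simpa using hρ.coverBA z v)

/-- The products `a b` act faithfully. -/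
def IsFaithful (ρ : DoubleAction P V) : Prop := ∀ z, (∀ v, ρ.ab z v = 0) → z = 0

theorem IsFaithful.tensor (hρ : ρ.IsFaithful) (hσ : σ.IsFaithful) : (ρ.tensor σ).IsFaithful := by
  intro z hz
  refine P.eq_zero_of_translate z fun c d => hρ _ fun v => ?_
  have : ρ.coverAB z v = 0 := eq_of_lTensor (fun w => σ.ab.flip w) hσ fun w => by
    rw [← tensor_ab_tmul, hz, map_zero]
  rw [← sliceR_coverAB, this, map_zero]

end DoubleAction

end MultiplierHopfPairing

/-! ### The basic modules -/

namespace MultiplierHopfPairing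

variable {K A B : Type*} [Field K]
  [NonUnitalRing A] [Module K A] [IsScalarTower K A A] [SMulCommClass K A A]
  [NonUnitalRing B] [Module K B] [IsScalarTower K B B] [SMulCommClass K B B]
  {HA : RegularMultiplierHopfAlgebra K A} {HB : RegularMultiplierHopfAlgebra K B}
  (P : MultiplierHopfPairing HA HB)

/-- The Heisenberg module `A`: `A` acts by left multiplication, `B` by `b ▶ a`. -/
noncomputable def actionOnA : DoubleAction P A where
  actA := LinearMap.mul K A
  actB := P.lactA
  actA_mul a a' v := by simp [mul_assoc]
  actB_mul b b' v := (P.lactA_lactA b b' v).symm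
  coverA := (TensorProduct.curry HA.T₁).compr₂ (TensorProduct.comm K A A).toLinearMap
  coverB := TensorProduct.curry P.leftTwist
  sliceR_coverA a v c := by simp [sliceR_comm, sliceL_T₁A]
  sliceR_coverB b v d := by simp [sliceR_leftTwist]

/-- The module `B`, on which `A` acts by `a ▶ b` and `B` by left multiplication. -/
noncomputable def actionOnB : DoubleAction P B where
  actA := P.lactB
  actB := LinearMap.mul K B
  actA_mul a a' v := (P.lactB_lactB a a' v).symm
  actB_mul b b' v := by simp [mul_assoc]
  coverA := P.coverB
  coverB := (TensorProduct.curry HB.cop.T₁).compr₂ (TensorProduct.comm K B B).toLinearMap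
  sliceR_coverA a v c := P.sliceR_coverB a v c
  sliceR_coverB b v d := by simp [sliceR_comm, sliceL_copT₁B]

/-- The module `A ⊗ B` of the Drinfel'd double. -/
noncomputable def actionOnAB : DoubleAction P (A ⊗[K] B) := P.actionOnA.tensor P.actionOnB

theorem isHeisenberg_actionOnA : P.actionOnA.IsHeisenberg := by
  intro z v
  induction z using TensorProduct.induction_on with
  | zero => simp
  | add x y hx hy => simp only [map_add, hx, hy, LinearMap.add_apply]
  | tmul a b =>
    rw [DoubleAction.ba_tmul, twistL_tmul]
    refine (P.lactA_mul_eq b a v).trans ?_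
    generalize P.leftTwist (b ⊗ₜ a) = t
    induction t using TensorProduct.induction_on with
    | zero => simp
    | add x y hx hy => simp only [map_add, hx, hy, LinearMap.add_apply]
    | tmul x y => simp [actionOnA]

theorem actionOnB_ba_twistRInv (z : A ⊗[K] B) (w : B) :
    P.actionOnB.ba (P.twistRInv z) w = P.actionOnB.ab z w := by
  induction z using TensorProduct.induction_on with
  | zero => simp
  | add x y hx hy => simp only [map_add, hx, hy, LinearMap.add_apply]
  | tmul a b =>
    rw [DoubleAction.ab_tmul]
    refine Eq.trans ?_ (P.lactB_mul_eq a b w).symm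
    generalize P.twistRInv (a ⊗ₜ b) = t
    induction t using TensorProduct.induction_on with
    | zero => simp
    | add x y hx hy => simp only [map_add, hx, hy, LinearMap.add_apply]
    | tmul x y => simp [actionOnB]

theorem isDouble_actionOnAB : P.actionOnAB.IsDouble :=
  P.isHeisenberg_actionOnA.tensor_isDouble P.actionOnB_ba_twistRInv

/-- If `a (b ▶ u) = 0` for all `u`, then `a y ⟨z, b⟩ = 0` for all `y`, `z`, because the elements
`Δ(u)(u' ⊗ 1)` span `A ⊗ A`. -/
theorem isFaithful_actionOnA : P.actionOnA.IsFaithful := by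
  intro z hz
  let G : A ⊗[K] A →ₗ[K] A ⊗[K] B →ₗ[K] A := TensorProduct.lift (LinearMap.mk₂ K
    (fun p q => LinearMap.mulRight K p ∘ₗ sliceR (P.form q))
    (fun p p' q => by ext; simp [mul_add]) (fun c p q => by ext; simp [mul_smul_comm, smul_comm c])
    (fun p q q' => by ext; simp [add_smul, add_mul, smul_mul_assoc])
    (fun c p q => by ext; simp [mul_smul]))
  have hG : ∀ u u' z, G (HA.coverFst u u') z = P.actionOnA.ab z u * u' := by
    intro u u' z
    induction z using TensorProduct.induction_on with
    | zero => simp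
    | add x y hx hy => simp only [map_add, hx, hy, LinearMap.add_apply, add_mul]
    | tmul a b =>
      have h : P.actionOnA.ab (a ⊗ₜ b) u * u' = a * (P.lactA b u * u') := by
        rw [← mul_assoc, DoubleAction.ab_tmul]; rfl
      rw [h, P.lactA_mul]
      generalize HA.coverFst u u' = t
      induction t using TensorProduct.induction_on with
      | zero => simp
      | add x y hx hy => simp only [map_add, hx, hy, LinearMap.add_apply, mul_add]
      | tmul p q => simp [G, mul_smul_comm]
  have hG₀ : ∀ t, G (TensorProduct.comm K A A (HA.cop.T₁ t)) z = 0 := by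
    intro t
    induction t using TensorProduct.induction_on with
    | zero => simp
    | add x y hx hy => simp only [map_add, hx, hy, LinearMap.add_apply, add_zero]
    | tmul u u' => exact (hG u u' z).trans (by rw [hz, zero_mul])
  refine P.ext_sliceB fun q => ?_
  rw [map_zero]
  refine HA.nondeg.1 _ fun p => ?_
  obtain ⟨t, ht⟩ := HA.cop.bijective_T₁.2 (TensorProduct.comm K A A (p ⊗ₜ q))
  have := hG₀ t
  rw [ht, comm_comm_apply] at this
  simpa [G] using this

theorem actionOnB_ab (z : A ⊗[K] B) (w : B) : P.actionOnB.ab z w =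
    P.flip.actionOnA.ab (TensorProduct.comm K A B (P.twistRInv z)) w := by
  rw [← actionOnB_ba_twistRInv]
  generalize P.twistRInv z = t
  induction t using TensorProduct.induction_on with
  | zero => simp
  | add x y hx hy => simp only [map_add, hx, hy, LinearMap.add_apply]
  | tmul a b => simp [actionOnA, actionOnB, flip]

theorem isFaithful_actionOnB : P.actionOnB.IsFaithful := by
  intro z hz
  refine P.injective_twistRInv ((TensorProduct.comm K A B).injective ?_)
  rw [map_zero, map_zero]
  exact P.flip.isFaithful_actionOnA _ fun w => by rw [← actionOnB_ab, hz]

theorem isFaithful_actionOnAB : P.actionOnAB.IsFaithful :=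
  P.isFaithful_actionOnA.tensor P.isFaithful_actionOnB

/-- Linear maps on `A` that agree on the elements `a (b ▶ u)` are equal. -/
theorem ext_actionOnA {X : Type*} [AddCommGroup X] [Module K X] {f g : A →ₗ[K] X}
    (h : ∀ z u, f (P.actionOnA.ab z u) = g (P.actionOnA.ab z u)) : f = g := by
  ext x
  obtain ⟨t, rfl⟩ := HA.surjective_mul' x
  induction t using TensorProduct.induction_on with
  | zero => simp
  | add x y hx hy => simp only [map_add, hx, hy]
  | tmul a a' =>
    refine LinearMap.congr_fun (P.ext_lactA (f := f ∘ₗ LinearMap.mulLeft K a)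
      (g := g ∘ₗ LinearMap.mulLeft K a) fun b u => ?_) a'
    simpa [actionOnA] using h (a ⊗ₜ b) u

theorem separating_actionOnA (w : A) (h : ∀ z, P.actionOnA.ab z w = 0) : w = 0 := by
  refine P.eq_zero_of_lactA w fun b => HA.nondeg.2 _ fun a => ?_
  simpa [actionOnA] using h (a ⊗ₜ b)

/-- The slices of `b w` pair with functionals as the operators of `w` on the Heisenberg module `A`
pair with `b`, so the faithfulness of that module applies. -/
theorem separating_actB (w : A ⊗[K] B) (h : ∀ b, P.actionOnAB.actB b w = 0) : w = 0 := by
  refine eq_of_rTensor (fun e => P.ractA.flip e) P.eq_zero_of_ractA fun e => ?_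
  rw [map_zero]
  refine P.isFaithful_actionOnA _ fun f => P.ext_left fun b => ?_
  have key : ∀ w : A ⊗[K] B,
      P.form (P.actionOnA.ab ((P.ractA.flip e).rTensor B w) f) b =
        P.form f (sliceL (P.form.flip e) (P.actionOnAB.actB b w)) := by
    intro w
    induction w using TensorProduct.induction_on with
    | zero => simp
    | add x y hx hy => simp only [map_add, hx, hy, LinearMap.add_apply]
    | tmul p q =>
      have e₁ : P.actionOnAB.actB b (p ⊗ₜ q) =
          (LinearMap.mulRight K q).lTensor A (P.leftTwist (b ⊗ₜ p)) :=
        throughCover_tmul _ _ _ _ _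
      rw [e₁, sliceL_lTensor, sliceL_leftTwist, LinearMap.mulRight_apply, P.form_mul_right,
        ← P.form_mul_left', LinearMap.rTensor_tmul, DoubleAction.ab_tmul]
      rfl
  rw [key, h]
  simp

/-- As for `separating_actB`, with the Heisenberg module `B` of the flipped pairing. -/
theorem separating_actA (w : A ⊗[K] B) (h : ∀ a, P.actionOnAB.actA a w = 0) : w = 0 := by
  refine eq_of_lTensor (fun f => P.ractB.flip f) P.flip.eq_zero_of_ractA fun f => ?_
  refine (TensorProduct.comm K A B).injective ?_
  rw [map_zero, map_zero]
  refine P.flip.isFaithful_actionOnA _ fun e => P.ext_right fun a => ?_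
  have key : ∀ w : A ⊗[K] B,
      P.form a (P.flip.actionOnA.ab (TensorProduct.comm K A B ((P.ractB.flip f).lTensor A w)) e) =
        P.form (sliceR (P.form f) (P.actionOnAB.actA a w)) e := by
    intro w
    induction w using TensorProduct.induction_on with
    | zero => simp
    | add x y hx hy => simp only [map_add, hx, hy, LinearMap.add_apply]
    | tmul p q =>
      have e₁ : P.actionOnAB.actA a (p ⊗ₜ q) =
          (P.lactB.flip q).lTensor A (TensorProduct.comm K A A (HA.T₁ (a ⊗ₜ p))) :=
        throughCover_tmul _ _ _ _ _
      have e₂ : P.form f ∘ₗ P.lactB.flip q = P.form.flip (P.ractB q f) :=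
        LinearMap.ext fun a => by simp [← P.form_mul_left, ← P.form_mul_left']
      rw [e₁, sliceR_lTensor, e₂, sliceR_comm, sliceL_T₁A, P.form_mul_left, ← P.form_mul_right',
        LinearMap.lTensor_tmul, TensorProduct.comm_tmul, DoubleAction.ab_tmul]
      rfl
  rw [key, h]
  simp

theorem separating_actionOnAB (w : A ⊗[K] B) (h : ∀ z, P.actionOnAB.ab z w = 0) : w = 0 :=
  P.separating_actB w fun b => P.separating_actA _ fun a => by simpa using h (a ⊗ₜ b)

/-! ### The products of the two doubles -/

section Products

variable {P} {V : Type*} [AddCommGroup V] [Module K V] {ρ : DoubleAction P V}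

theorem DoubleAction.ab_map (ρ : DoubleAction P V) (a : A) (b : B) (t : A ⊗[K] B) (v : V) :
    ρ.ab (TensorProduct.map (LinearMap.mulLeft K a) (LinearMap.mulRight K b) t) v =
      ρ.actA a (ρ.ab t (ρ.actB b v)) := by
  induction t using TensorProduct.induction_on with
  | zero => simp
  | add x y hx hy => simp only [map_add, hx, hy, LinearMap.add_apply]
  | tmul x y => simp [ρ.actA_mul, ρ.actB_mul]

theorem DoubleAction.IsHeisenberg.ab_mul (h : ρ.IsHeisenberg) (x y : A ⊗[K] B) (v : V) :
    ρ.ab (P.heisenbergMul x y) v = ρ.ab x (ρ.ab y v) := by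
  induction x using TensorProduct.induction_on with
  | zero => simp
  | add x y hx hy => simp only [map_add, hx, hy, LinearMap.add_apply]
  | tmul a b =>
    induction y using TensorProduct.induction_on with
    | zero => simp
    | add x y hx hy => simp only [map_add, hx, hy, LinearMap.add_apply]
    | tmul a' b' =>
      rw [heisenbergMul_tmul, LinearMap.rTensor_comp_apply, ← P.isLeftTwist_leftTwist,
        ← LinearMap.comp_apply (LinearMap.rTensor B _), LinearMap.rTensor_comp_lTensor,
        DoubleAction.ab_map, ← twistL_tmul, ← h]
      simp

theorem DoubleAction.IsDouble.ab_twist (h : ρ.IsDouble) (b : B) (a : A) (v : V) :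
    ρ.ab (P.twist (b ⊗ₜ a)) v = ρ.actB b (ρ.actA a v) := by
  rw [twist, LinearMap.comp_apply, ← twistL_tmul, ← ρ.ba_tmul,
    ← P.twistRInv_rightTwist (a ⊗ₜ b), ← twistRInv_twistL, rightTwist_twistRInv, h]

theorem DoubleAction.IsDouble.ab_mul (h : ρ.IsDouble) (x y : A ⊗[K] B) (v : V) :
    ρ.ab (P.doubleMul x y) v = ρ.ab x (ρ.ab y v) := by
  induction x using TensorProduct.induction_on with
  | zero => simp
  | add x y hx hy => simp only [map_add, hx, hy, LinearMap.add_apply]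
  | tmul a b =>
    induction y using TensorProduct.induction_on with
    | zero => simp
    | add x y hx hy => simp only [map_add, hx, hy, LinearMap.add_apply]
    | tmul a' b' =>
      rw [doubleMul_tmul, DoubleAction.ab_map, h.ab_twist]
      simp

end Products

theorem heisenberg_ext {x y : A ⊗[K] B} (h : ∀ u, P.actionOnA.ab x u = P.actionOnA.ab y u) :
    x = y := by
  rw [← sub_eq_zero]
  exact P.isFaithful_actionOnA _ fun u => by simp [h]

theorem associative_heisenbergMul : AssociativeMul P.heisenbergMul := fun x y z =>
  P.heisenberg_ext fun u => by simp only [P.isHeisenberg_actionOnA.ab_mul]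

theorem nondegenerate_heisenbergMul : NondegenerateMul P.heisenbergMul := by
  refine ⟨fun x h => P.isFaithful_actionOnA x fun u => ?_, fun y h =>
    P.isFaithful_actionOnA y fun u => P.separating_actionOnA _ fun z => ?_⟩
  · refine LinearMap.congr_fun (P.ext_actionOnA (g := 0) fun z u => ?_) u
    rw [← P.isHeisenberg_actionOnA.ab_mul, h]
    simp
  · rw [← P.isHeisenberg_actionOnA.ab_mul, h]
    simp

theorem eq_zero_of_doubleMul (y : A ⊗[K] B) (h : ∀ x, P.doubleMul x y = 0) : y = 0 :=
  P.isFaithful_actionOnAB y fun u => P.separating_actionOnAB _ fun z => by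
    rw [← P.isDouble_actionOnAB.ab_mul, h]
    simp

end MultiplierHopfPairing

/-! ### The coaction -/

namespace MultiplierHopfPairing

universe u v w

variable {K : Type w} {A : Type u} {B : Type v} [Field K]
  [NonUnitalRing A] [Module K A] [IsScalarTower K A A] [SMulCommClass K A A]
  [NonUnitalRing B] [Module K B] [IsScalarTower K B B] [SMulCommClass K B B]
  {HA : RegularMultiplierHopfAlgebra K A} {HB : RegularMultiplierHopfAlgebra K B}
  (P : MultiplierHopfPairing HA HB)

namespace DoubleAction

variable {P} {V W : Type*} [AddCommGroup V] [Module K V] [AddCommGroup W] [Module K W]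
  (ρ : DoubleAction P V) (σ : DoubleAction P W)

theorem rTensor_actA_copT₂ (a a' : A) (x : V) :
    (ρ.actA.flip x).rTensor A (HA.cop.T₂ (a' ⊗ₜ a)) = (ρ.actA a').rTensor A (ρ.coverA a x) := by
  refine P.ext_sliceA fun c => ?_
  rw [sliceR_rTensor, sliceR_rTensor, ρ.sliceR_coverA, sliceR_copT₂A, ← ρ.actA_mul]
  rfl

theorem rTensor_actB_T₂ (b b' : B) (x : V) :
    (ρ.actB.flip x).rTensor B (HB.T₂ (b' ⊗ₜ b)) = (ρ.actB b').rTensor B (ρ.coverB b x) := by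
  refine P.ext_sliceB fun c => ?_
  rw [sliceR_rTensor, sliceR_rTensor, ρ.sliceR_coverB, sliceR_T₂B, ← ρ.actB_mul]
  rfl

theorem rTensor_actB_coverFst (b b' : B) (x : V) :
    (ρ.actB.flip x).rTensor B (HB.coverFst b b') = ρ.coverB b (ρ.actB b' x) := by
  refine P.ext_sliceB fun c => ?_
  rw [sliceR_rTensor, ρ.sliceR_coverB, sliceR_coverFstB, ← ρ.actB_mul]
  rfl

theorem rTensor_actA_T₁ (a a' : A) (x : V) :
    (ρ.actA.flip x).rTensor A (TensorProduct.comm K A A (HA.T₁ (a ⊗ₜ a'))) =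
      ρ.coverA a (ρ.actA a' x) := by
  refine P.ext_sliceA fun c => ?_
  rw [sliceR_rTensor, ρ.sliceR_coverA, sliceR_comm, sliceL_T₁A, ← ρ.actA_mul]
  rfl

theorem rTensor_actA_coverFst (a a' : A) (x : V) :
    (ρ.actA.flip x).rTensor A (TensorProduct.comm K A A (HA.coverFst a a')) =
      (LinearMap.mulRight K a').lTensor V (ρ.coverA a x) := by
  refine P.ext_sliceA fun c => ?_
  rw [sliceR_rTensor, sliceR_lTensor, sliceR_comm, sliceL_coverFstA,
    show P.form.flip c ∘ₗ LinearMap.mulRight K a' = P.form.flip (P.lactB a' c) from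
      P.flip.form_comp_mulRight c a', ρ.sliceR_coverA]
  rfl

/-- The joint action of `(A ⊗ B) ⊗ (A ⊗ B)` on `V ⊗ W`. -/
noncomputable def joint : (A ⊗[K] B) ⊗[K] (A ⊗[K] B) →ₗ[K] V ⊗[K] W →ₗ[K] V ⊗[K] W :=
  TensorProduct.lift (LinearMap.mk₂ K (fun d y => TensorProduct.map (ρ.ab d) (σ.ab y))
    (fun d d' y => by rw [map_add, TensorProduct.map_add_left])
    (fun c d y => by rw [map_smul, TensorProduct.map_smul_left])
    (fun d y y' => by rw [map_add, TensorProduct.map_add_right])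
    (fun c d y => by rw [map_smul, TensorProduct.map_smul_right]))

@[simp] theorem joint_tmul (d y : A ⊗[K] B) :
    joint ρ σ (d ⊗ₜ y) = TensorProduct.map (ρ.ab d) (σ.ab y) := by
  simp [joint]

theorem joint_apply_tmul (t : (A ⊗[K] B) ⊗[K] (A ⊗[K] B)) (x : V) (y : W) :
    joint ρ σ t (x ⊗ₜ y) =
      (σ.ab.flip y).lTensor V ((ρ.ab.flip x).rTensor (A ⊗[K] B) t) := by
  induction t using TensorProduct.induction_on with
  | zero => simp
  | add x y hx hy => simp only [map_add, hx, hy, LinearMap.add_apply]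
  | tmul d y => simp

/-- The map `(d ⊗ x) ⊗ v ↦ d v ⊗ x`, for `d` in `A ⊗ B`. -/
noncomputable def leg (X : Type*) [AddCommGroup X] [Module K X] :
    (A ⊗[K] B) ⊗[K] X →ₗ[K] V →ₗ[K] V ⊗[K] X :=
  (LinearMap.rTensorHom X ∘ₗ ρ.ab.flip).flip

theorem leg_apply {X : Type*} [AddCommGroup X] [Module K X] (s : (A ⊗[K] B) ⊗[K] X) (y : V) :
    ρ.leg X s y = (ρ.ab.flip y).rTensor X s := rfl

end DoubleAction

/-- Tensors over the double are determined by their first legs acting on `A ⊗ B`. -/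
theorem ext_actionOnAB {X : Type*} [AddCommGroup X] [Module K X] {t t' : (A ⊗[K] B) ⊗[K] X}
    (h : ∀ x, (P.actionOnAB.ab.flip x).rTensor X t = (P.actionOnAB.ab.flip x).rTensor X t') :
    t = t' :=
  eq_of_rTensor (fun x => P.actionOnAB.ab.flip x) P.isFaithful_actionOnAB h

/-- The element `t` is `(x ⊗ 1) Γ(z)`: on modules over the double, its first leg acts as that of
`x a₍₂₎ b₍₁₎ ⊗ (a₍₁₎ ⊗ b₍₂₎)` for `z = a ⊗ b`. The universe contains `A ⊗ B` and its tensor powers. -/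
def IsLeftCoaction (x z : A ⊗[K] B) (t : (A ⊗[K] B) ⊗[K] (A ⊗[K] B)) : Prop :=
  ∀ (V : Type (max u v)) [AddCommGroup V] [Module K V] (ρ : DoubleAction P V), ρ.IsDouble →
    ∀ y, (ρ.ab.flip y).rTensor (A ⊗[K] B) t = (ρ.ab x).rTensor (A ⊗[K] B) (ρ.coverAB z y)

/-- The element `t` is `Γ(z) (x ⊗ 1)`: on modules over the double, its first leg acts as that of
`a₍₂₎ b₍₁₎ x ⊗ (a₍₁₎ ⊗ b₍₂₎)` for `z = a ⊗ b`. -/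
def IsRightCoaction (x z : A ⊗[K] B) (t : (A ⊗[K] B) ⊗[K] (A ⊗[K] B)) : Prop :=
  ∀ (V : Type (max u v)) [AddCommGroup V] [Module K V] (ρ : DoubleAction P V), ρ.IsDouble →
    ∀ y, (ρ.ab.flip y).rTensor (A ⊗[K] B) t = ρ.coverAB z (ρ.ab x y)

/-- `x a₍₂₎ ⊗ a₍₁₎` is an element of `𝒟 ⊗ A`: for `x = b' a'` it is formed from `a' a₍₂₎ ⊗ a₍₁₎`. -/
theorem exists_left_coverA (x : A ⊗[K] B) (a : A) : ∃ t : (A ⊗[K] B) ⊗[K] A,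
    ∀ (V : Type (max u v)) [AddCommGroup V] [Module K V] (ρ : DoubleAction P V), ρ.IsDouble →
      ∀ y, (ρ.ab.flip y).rTensor A t = (ρ.ab x).rTensor A (ρ.coverA a y) := by
  obtain ⟨s, rfl⟩ := P.surjective_twist x
  induction s using TensorProduct.induction_on with
  | zero => exact ⟨0, fun V _ _ ρ _ y => by simp⟩
  | add s s' hs hs' =>
    obtain ⟨t, ht⟩ := hs
    obtain ⟨t', ht'⟩ := hs'
    exact ⟨t + t', fun V _ _ ρ hρ y => by
      simp only [map_add, ht V ρ hρ, ht' V ρ hρ, LinearMap.rTensor_add, LinearMap.add_apply]⟩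
  | tmul b' a' =>
    refine ⟨(P.twist ∘ₗ TensorProduct.mk K B A b').rTensor A (HA.cop.T₂ (a' ⊗ₜ a)),
      fun V _ _ ρ hρ y => ?_⟩
    have h₁ : ρ.ab.flip y ∘ₗ P.twist ∘ₗ TensorProduct.mk K B A b' =
        ρ.actB b' ∘ₗ ρ.actA.flip y := LinearMap.ext fun g => by simp [hρ.ab_twist]
    have h₂ : ρ.ab (P.twist (b' ⊗ₜ a')) = ρ.actB b' ∘ₗ ρ.actA a' :=
      LinearMap.ext fun y => by simp [hρ.ab_twist]
    rw [← LinearMap.rTensor_comp_apply, h₁, h₂, LinearMap.rTensor_comp_apply,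
      LinearMap.rTensor_comp_apply, ρ.rTensor_actA_copT₂]

/-- `x b₍₁₎ ⊗ b₍₂₎` is an element of `𝒟 ⊗ B`: for `x = a' b'` it is formed from `b' b₍₁₎ ⊗ b₍₂₎`. -/
theorem exists_left_coverB (x : A ⊗[K] B) (b : B) : ∃ t : (A ⊗[K] B) ⊗[K] B,
    ∀ (V : Type (max u v)) [AddCommGroup V] [Module K V] (ρ : DoubleAction P V), ρ.IsDouble →
      ∀ y, (ρ.ab.flip y).rTensor B t = (ρ.ab x).rTensor B (ρ.coverB b y) := by
  induction x using TensorProduct.induction_on with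
  | zero => exact ⟨0, fun V _ _ ρ _ y => by simp⟩
  | add s s' hs hs' =>
    obtain ⟨t, ht⟩ := hs
    obtain ⟨t', ht'⟩ := hs'
    exact ⟨t + t', fun V _ _ ρ hρ y => by
      simp only [map_add, ht V ρ hρ, ht' V ρ hρ, LinearMap.rTensor_add, LinearMap.add_apply]⟩
  | tmul a' b' =>
    refine ⟨(TensorProduct.mk K A B a').rTensor B (HB.T₂ (b' ⊗ₜ b)), fun V _ _ ρ hρ y => ?_⟩
    have h₁ : ρ.ab.flip y ∘ₗ TensorProduct.mk K A B a' = ρ.actA a' ∘ₗ ρ.actB.flip y :=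
      LinearMap.ext fun g => by simp
    have h₂ : ρ.ab (a' ⊗ₜ b') = ρ.actA a' ∘ₗ ρ.actB b' := LinearMap.ext fun y => by simp
    rw [← LinearMap.rTensor_comp_apply, h₁, h₂, LinearMap.rTensor_comp_apply,
      LinearMap.rTensor_comp_apply, ρ.rTensor_actB_T₂]

/-- `b₍₁₎ x ⊗ b₍₂₎` is an element of `𝒟 ⊗ B`: for `x = b' a'` it is formed from `b₍₁₎ b' ⊗ b₍₂₎`. -/
theorem exists_right_coverB (x : A ⊗[K] B) (b : B) : ∃ t : (A ⊗[K] B) ⊗[K] B,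
    ∀ (V : Type (max u v)) [AddCommGroup V] [Module K V] (ρ : DoubleAction P V), ρ.IsDouble →
      ∀ y, (ρ.ab.flip y).rTensor B t = ρ.coverB b (ρ.ab x y) := by
  obtain ⟨s, rfl⟩ := P.surjective_twist x
  induction s using TensorProduct.induction_on with
  | zero => exact ⟨0, fun V _ _ ρ _ y => by simp⟩
  | add s s' hs hs' =>
    obtain ⟨t, ht⟩ := hs
    obtain ⟨t', ht'⟩ := hs'
    exact ⟨t + t', fun V _ _ ρ hρ y => by
      simp only [map_add, ht V ρ hρ, ht' V ρ hρ, LinearMap.add_apply]⟩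
  | tmul b' a' =>
    refine ⟨(P.twist ∘ₗ (TensorProduct.mk K B A).flip a').rTensor B (HB.coverFst b b'),
      fun V _ _ ρ hρ y => ?_⟩
    have h₁ : ρ.ab.flip y ∘ₗ P.twist ∘ₗ (TensorProduct.mk K B A).flip a' =
        ρ.actB.flip (ρ.actA a' y) := LinearMap.ext fun g => by simp [hρ.ab_twist]
    rw [← LinearMap.rTensor_comp_apply, h₁, hρ.ab_twist, ρ.rTensor_actB_coverFst]

/-- `a₍₂₎ x ⊗ a₍₁₎` is an element of `𝒟 ⊗ A`: for `x = a' b'` it is formed from `a₍₂₎ a' ⊗ a₍₁₎`. -/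
theorem exists_right_coverA (x : A ⊗[K] B) (a : A) : ∃ t : (A ⊗[K] B) ⊗[K] A,
    ∀ (V : Type (max u v)) [AddCommGroup V] [Module K V] (ρ : DoubleAction P V), ρ.IsDouble →
      ∀ y, (ρ.ab.flip y).rTensor A t = ρ.coverA a (ρ.ab x y) := by
  induction x using TensorProduct.induction_on with
  | zero => exact ⟨0, fun V _ _ ρ _ y => by simp⟩
  | add s s' hs hs' =>
    obtain ⟨t, ht⟩ := hs
    obtain ⟨t', ht'⟩ := hs'
    exact ⟨t + t', fun V _ _ ρ hρ y => by
      simp only [map_add, ht V ρ hρ, ht' V ρ hρ, LinearMap.add_apply]⟩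
  | tmul a' b' =>
    refine ⟨((TensorProduct.mk K A B).flip b').rTensor A
      (TensorProduct.comm K A A (HA.T₁ (a ⊗ₜ a'))), fun V _ _ ρ hρ y => ?_⟩
    have h₁ : ρ.ab.flip y ∘ₗ (TensorProduct.mk K A B).flip b' = ρ.actA.flip (ρ.actB b' y) :=
      LinearMap.ext fun g => by simp
    rw [← LinearMap.rTensor_comp_apply, h₁, ρ.ab_tmul, ρ.rTensor_actA_T₁]

theorem assoc_tmul_right {V X Y : Type*} [AddCommGroup V] [Module K V] [AddCommGroup X]
    [Module K X] [AddCommGroup Y] [Module K Y] (u : V ⊗[K] X) (y : Y) :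
    TensorProduct.assoc K V X Y (u ⊗ₜ y) = ((TensorProduct.mk K X Y).flip y).lTensor V u := by
  induction u using TensorProduct.induction_on with
  | zero => simp
  | add x y hx hy => simp only [map_add, TensorProduct.add_tmul, hx, hy]
  | tmul x y => simp

theorem assoc_rTensor_mk_flip {V X Y : Type*} [AddCommGroup V] [Module K V] [AddCommGroup X]
    [Module K X] [AddCommGroup Y] [Module K Y] (u : V ⊗[K] Y) (x : X) :
    TensorProduct.assoc K V X Y (((TensorProduct.mk K V X).flip x).rTensor Y u) =
      (TensorProduct.mk K X Y x).lTensor V u := by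
  induction u using TensorProduct.induction_on with
  | zero => simp
  | add x y hx hy => simp only [map_add, hx, hy]
  | tmul x y => simp

theorem exists_isLeftCoaction (x z : A ⊗[K] B) : ∃ t, P.IsLeftCoaction x z t := by
  induction z using TensorProduct.induction_on with
  | zero => exact ⟨0, fun V _ _ ρ _ y => by simp⟩
  | add s s' hs hs' =>
    obtain ⟨t, ht⟩ := hs
    obtain ⟨t', ht'⟩ := hs'
    exact ⟨t + t', fun V _ _ ρ hρ y => by
      simp only [map_add, ht V ρ hρ, ht' V ρ hρ, LinearMap.add_apply]⟩
  | tmul a b =>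
    -- `s = x a₍₂₎ ⊗ a₍₁₎` is multiplied by `b₍₁₎` in its first leg, and `b₍₂₎` is appended
    have key : ∀ s : (A ⊗[K] B) ⊗[K] A, ∃ t : (A ⊗[K] B) ⊗[K] (A ⊗[K] B),
        ∀ (V : Type (max u v)) [AddCommGroup V] [Module K V] (ρ : DoubleAction P V),
          ρ.IsDouble → ∀ y, (ρ.ab.flip y).rTensor (A ⊗[K] B) t =
            TensorProduct.assoc K V A B ((ρ.leg A s).rTensor B (ρ.coverB b y)) := by
      intro s
      induction s using TensorProduct.induction_on with
      | zero => exact ⟨0, fun V _ _ ρ _ y => by simp⟩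
      | add s s' hs hs' =>
        obtain ⟨t, ht⟩ := hs
        obtain ⟨t', ht'⟩ := hs'
        exact ⟨t + t', fun V _ _ ρ hρ y => by
          simp only [map_add, ht V ρ hρ, ht' V ρ hρ, LinearMap.rTensor_add, LinearMap.add_apply]⟩
      | tmul x' h =>
        obtain ⟨t, ht⟩ := P.exists_left_coverB x' b
        refine ⟨(TensorProduct.mk K A B h).lTensor _ t, fun V _ _ ρ hρ y => ?_⟩
        have e : ρ.leg A (x' ⊗ₜ h) = (TensorProduct.mk K V A).flip h ∘ₗ ρ.ab x' :=
          LinearMap.ext fun v => by simp [DoubleAction.leg_apply]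
        rw [e, LinearMap.rTensor_comp_apply, ← ht V ρ hρ, assoc_rTensor_mk_flip,
          ← LinearMap.comp_apply, LinearMap.rTensor_comp_lTensor,
          ← LinearMap.lTensor_comp_rTensor, LinearMap.comp_apply]
    obtain ⟨s, hs⟩ := P.exists_left_coverA x a
    obtain ⟨t, ht⟩ := key s
    refine ⟨t, fun V _ _ ρ hρ y => ?_⟩
    have e : ρ.leg A s = (ρ.ab x).rTensor A ∘ₗ ρ.coverA a := LinearMap.ext fun v => hs V ρ hρ v
    rw [ht V ρ hρ, e, ρ.coverAB_tmul, LinearMap.rTensor_comp_apply]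
    generalize (ρ.coverA a).rTensor B (ρ.coverB b y) = u
    induction u using TensorProduct.induction_on with
    | zero => simp
    | add x y hx hy => simp only [map_add, hx, hy]
    | tmul u c =>
      rw [LinearMap.rTensor_tmul, assoc_tmul_right, assoc_tmul_right, ← LinearMap.comp_apply,
        ← LinearMap.comp_apply, LinearMap.rTensor_comp_lTensor, LinearMap.lTensor_comp_rTensor]

theorem exists_isRightCoaction (x z : A ⊗[K] B) : ∃ t, P.IsRightCoaction x z t := by
  induction z using TensorProduct.induction_on with
  | zero => exact ⟨0, fun V _ _ ρ _ y => by simp⟩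
  | add s s' hs hs' =>
    obtain ⟨t, ht⟩ := hs
    obtain ⟨t', ht'⟩ := hs'
    exact ⟨t + t', fun V _ _ ρ hρ y => by
      simp only [map_add, ht V ρ hρ, ht' V ρ hρ, LinearMap.add_apply]⟩
  | tmul a b =>
    -- `s = b₍₁₎ x ⊗ b₍₂₎` is multiplied by `a₍₂₎` from the left in its first leg, and `a₍₁₎` is inserted
    have key : ∀ s : (A ⊗[K] B) ⊗[K] B, ∃ t : (A ⊗[K] B) ⊗[K] (A ⊗[K] B),
        ∀ (V : Type (max u v)) [AddCommGroup V] [Module K V] (ρ : DoubleAction P V),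
          ρ.IsDouble → ∀ y, (ρ.ab.flip y).rTensor (A ⊗[K] B) t =
            TensorProduct.assoc K V A B
              ((ρ.coverA a).rTensor B ((ρ.ab.flip y).rTensor B s)) := by
      intro s
      induction s using TensorProduct.induction_on with
      | zero => exact ⟨0, fun V _ _ ρ _ y => by simp⟩
      | add s s' hs hs' =>
        obtain ⟨t, ht⟩ := hs
        obtain ⟨t', ht'⟩ := hs'
        exact ⟨t + t', fun V _ _ ρ hρ y => by simp only [map_add, ht V ρ hρ, ht' V ρ hρ]⟩
      | tmul x' h =>
        obtain ⟨t, ht⟩ := P.exists_right_coverA x' a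
        refine ⟨((TensorProduct.mk K A B).flip h).lTensor _ t, fun V _ _ ρ hρ y => ?_⟩
        rw [LinearMap.rTensor_tmul, LinearMap.rTensor_tmul, LinearMap.flip_apply, ← ht V ρ hρ,
          assoc_tmul_right, ← LinearMap.comp_apply, LinearMap.rTensor_comp_lTensor,
          ← LinearMap.lTensor_comp_rTensor, LinearMap.comp_apply]
    obtain ⟨s, hs⟩ := P.exists_right_coverB x b
    obtain ⟨t, ht⟩ := key s
    exact ⟨t, fun V _ _ ρ hρ y => by rw [ht V ρ hρ, hs V ρ hρ, ρ.coverAB_tmul]⟩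

variable {P} in
theorem IsLeftCoaction.unique {x z : A ⊗[K] B} {t t' : (A ⊗[K] B) ⊗[K] (A ⊗[K] B)}
    (h : P.IsLeftCoaction x z t) (h' : P.IsLeftCoaction x z t') : t = t' :=
  P.ext_actionOnAB fun y => (h _ _ P.isDouble_actionOnAB y).trans
    (h' _ _ P.isDouble_actionOnAB y).symm

variable {P} in
theorem IsRightCoaction.unique {x z : A ⊗[K] B} {t t' : (A ⊗[K] B) ⊗[K] (A ⊗[K] B)}
    (h : P.IsRightCoaction x z t) (h' : P.IsRightCoaction x z t') : t = t' :=
  P.ext_actionOnAB fun y => (h _ _ P.isDouble_actionOnAB y).trans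
    (h' _ _ P.isDouble_actionOnAB y).symm

/-- The bilinear map `(z, x) ↦ (x ⊗ 1) Γ(z)`. -/
noncomputable def coactionLeft :
    A ⊗[K] B →ₗ[K] A ⊗[K] B →ₗ[K] (A ⊗[K] B) ⊗[K] (A ⊗[K] B) :=
  have hs (x z) := (P.exists_isLeftCoaction x z).choose_spec
  LinearMap.mk₂ K (fun z x => (P.exists_isLeftCoaction x z).choose)
    (fun z z' x => (hs x (z + z')).unique fun V _ _ ρ hρ y => by
      simp only [map_add, hs x z V ρ hρ, hs x z' V ρ hρ, LinearMap.add_apply])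
    (fun c z x => (hs x (c • z)).unique fun V _ _ ρ hρ y => by
      simp only [map_smul, hs x z V ρ hρ, LinearMap.smul_apply])
    (fun z x x' => (hs (x + x') z).unique fun V _ _ ρ hρ y => by
      simp only [map_add, hs x z V ρ hρ, hs x' z V ρ hρ, LinearMap.rTensor_add,
        LinearMap.add_apply])
    (fun c z x => (hs (c • x) z).unique fun V _ _ ρ hρ y => by
      simp only [map_smul, hs x z V ρ hρ, LinearMap.rTensor_smul, LinearMap.smul_apply])

/-- The bilinear map `(z, x) ↦ Γ(z) (x ⊗ 1)`. -/
noncomputable def coactionRight :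
    A ⊗[K] B →ₗ[K] A ⊗[K] B →ₗ[K] (A ⊗[K] B) ⊗[K] (A ⊗[K] B) :=
  have hs (x z) := (P.exists_isRightCoaction x z).choose_spec
  LinearMap.mk₂ K (fun z x => (P.exists_isRightCoaction x z).choose)
    (fun z z' x => (hs x (z + z')).unique fun V _ _ ρ hρ y => by
      simp only [map_add, hs x z V ρ hρ, hs x z' V ρ hρ, LinearMap.add_apply])
    (fun c z x => (hs x (c • z)).unique fun V _ _ ρ hρ y => by
      simp only [map_smul, hs x z V ρ hρ, LinearMap.smul_apply])
    (fun z x x' => (hs (x + x') z).unique fun V _ _ ρ hρ y => by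
      simp only [map_add, hs x z V ρ hρ, hs x' z V ρ hρ, LinearMap.add_apply])
    (fun c z x => (hs (c • x) z).unique fun V _ _ ρ hρ y => by
      simp only [map_smul, hs x z V ρ hρ, LinearMap.smul_apply])

theorem isLeftCoaction_coactionLeft (x z : A ⊗[K] B) :
    P.IsLeftCoaction x z (P.coactionLeft z x) :=
  (P.exists_isLeftCoaction x z).choose_spec

theorem isRightCoaction_coactionRight (x z : A ⊗[K] B) :
    P.IsRightCoaction x z (P.coactionRight z x) :=
  (P.exists_isRightCoaction x z).choose_spec

variable {P} in
theorem DoubleAction.IsDouble.rTensor_doubleMul {V : Type*} [AddCommGroup V] [Module K V]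
    {ρ : DoubleAction P V} (h : ρ.IsDouble) {X : Type*} [AddCommGroup X] [Module K X]
    (x : A ⊗[K] B) (y : V) (t : (A ⊗[K] B) ⊗[K] X) :
    (ρ.ab.flip y).rTensor X ((P.doubleMul x).rTensor X t) =
      (ρ.ab x).rTensor X ((ρ.ab.flip y).rTensor X t) := by
  rw [← LinearMap.rTensor_comp_apply, ← LinearMap.rTensor_comp_apply]
  congr 2
  exact LinearMap.ext fun d => h.ab_mul x d y

variable {P} in
theorem DoubleAction.IsDouble.rTensor_doubleMul_flip {V : Type*} [AddCommGroup V] [Module K V]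
    {ρ : DoubleAction P V} (h : ρ.IsDouble) {X : Type*} [AddCommGroup X] [Module K X]
    (x : A ⊗[K] B) (y : V) (t : (A ⊗[K] B) ⊗[K] X) :
    (ρ.ab.flip y).rTensor X ((P.doubleMul.flip x).rTensor X t) =
      (ρ.ab.flip (ρ.ab x y)).rTensor X t := by
  rw [← LinearMap.rTensor_comp_apply]
  congr 2
  exact LinearMap.ext fun d => h.ab_mul d x y

/-- The coaction `Γ : ℋ → M₀(𝒟 ⊗ ℋ)`. On a module over the double, both sides of the compatibility
condition for `d'`, `d` act as `d' a₍₂₎ b₍₁₎ d ⊗ (a₍₁₎ ⊗ b₍₂₎)`. -/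
noncomputable def coaction : A ⊗[K] B →ₗ[K] CompletedModule P.doubleMul (A ⊗[K] B) :=
  (P.coactionLeft.prod P.coactionRight).codRestrict _ fun z d' d => P.ext_actionOnAB fun y => by
    have h := P.isDouble_actionOnAB
    change (P.actionOnAB.ab.flip y).rTensor _ ((P.doubleMul d').rTensor _ (P.coactionRight z d)) =
      (P.actionOnAB.ab.flip y).rTensor _ ((P.doubleMul.flip d).rTensor _ (P.coactionLeft z d'))
    rw [h.rTensor_doubleMul, h.rTensor_doubleMul_flip, P.isLeftCoaction_coactionLeft _ _ _ _ h,
      P.isRightCoaction_coactionRight _ _ _ _ h]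

theorem isLeftCoaction_coaction (x z : A ⊗[K] B) :
    P.IsLeftCoaction x z (coverMap P.coaction x z) :=
  P.isLeftCoaction_coactionLeft x z

end MultiplierHopfPairing

/-! ### The comodule algebra -/

section Map

variable {K V V' W W' : Type*} [Field K] [AddCommGroup V] [Module K V] [AddCommGroup V']
  [Module K V'] [AddCommGroup W] [Module K W] [AddCommGroup W'] [Module K W']

theorem rTensor_lTensor_eq_map (f : V →ₗ[K] V') (g : W →ₗ[K] W') (t : V ⊗[K] W) :
    f.rTensor W' (g.lTensor V t) = TensorProduct.map f g t :=
  LinearMap.congr_fun (LinearMap.rTensor_comp_lTensor ..) t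

theorem lTensor_rTensor_eq_map (f : V →ₗ[K] V') (g : W →ₗ[K] W') (t : V ⊗[K] W) :
    g.lTensor V' (f.rTensor W t) = TensorProduct.map f g t :=
  LinearMap.congr_fun (LinearMap.lTensor_comp_rTensor ..) t

end Map

/-- If only zero is annihilated by all left multiplications, the map `d ↦ (d ⊗ 1) y` determines `y`. -/
theorem CompletedModule.ext_fromLeft {K D X : Type*} [Field K] [AddCommGroup D] [Module K D]
    [AddCommGroup X] [Module K X] {μ : D →ₗ[K] D →ₗ[K] D}
    (hμ : ∀ d, (∀ d', μ d' d = 0) → d = 0) {y z : CompletedModule μ X}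
    (h : CompletedModule.fromLeft y = CompletedModule.fromLeft z) : y = z := by
  refine Subtype.ext (Prod.ext h (LinearMap.ext fun d => eq_of_rTensor μ hμ fun d' => ?_))
  exact (CompletedModule.compat y d' d).trans (h ▸ (CompletedModule.compat z d' d).symm)

namespace MultiplierHopfPairing

universe u v w

variable {K : Type w} {A : Type u} {B : Type v} [Field K]
  [NonUnitalRing A] [Module K A] [IsScalarTower K A A] [SMulCommClass K A A]
  [NonUnitalRing B] [Module K B] [IsScalarTower K B B] [SMulCommClass K B B]
  {HA : RegularMultiplierHopfAlgebra K A} {HB : RegularMultiplierHopfAlgebra K B}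
  (P : MultiplierHopfPairing HA HB)

theorem coaction_ext {Γ Γ' : A ⊗[K] B →ₗ[K] CompletedModule P.doubleMul (A ⊗[K] B)}
    (h : ∀ x z, coverMap Γ x z = coverMap Γ' x z) : Γ = Γ' :=
  LinearMap.ext fun z => CompletedModule.ext_fromLeft P.eq_zero_of_doubleMul
    (LinearMap.ext fun x => h x z)

variable {P} in
theorem DoubleAction.rTensor_coveredCoproduct {V : Type*} [AddCommGroup V] [Module K V]
    (ρ : DoubleAction P V) (a a' : A) (b b' : B) (y : V) :
    (ρ.ab.flip y).rTensor (A ⊗[K] B) (coveredCoproduct HA HB a b a' b') =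
      ((LinearMap.mulRight K a').rTensor B).lTensor V (ρ.coverAB (a ⊗ₜ b) (ρ.actB b' y)) := by
  rw [ρ.coverAB_tmul, ← ρ.rTensor_actB_coverFst, coveredCoproduct]
  generalize HB.coverFst b b' = t
  induction t using TensorProduct.induction_on with
  | zero => simp
  | add x y hx hy => simp only [map_add, TensorProduct.tmul_add, hx, hy]
  | tmul p q =>
    have e₁ : ∀ s : A ⊗[K] A, (ρ.ab.flip y).rTensor (A ⊗[K] B)
        (TensorProduct.tensorTensorTensorComm K A A B B (s ⊗ₜ (p ⊗ₜ q))) =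
        TensorProduct.assoc K V A B ((ρ.actA.flip (ρ.actB p y)).rTensor A s ⊗ₜ q) := by
      intro s
      induction s using TensorProduct.induction_on with
      | zero => simp
      | add x y hx hy => simp only [map_add, TensorProduct.add_tmul, hx, hy]
      | tmul c d => simp
    rw [e₁, ρ.rTensor_actA_coverFst, LinearMap.rTensor_tmul, LinearMap.rTensor_tmul,
      LinearMap.flip_apply]
    generalize ρ.coverA a (ρ.actB p y) = u
    induction u using TensorProduct.induction_on with
    | zero => simp
    | add x y hx hy => simp only [map_add, TensorProduct.add_tmul, hx, hy]
    | tmul c d => simp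

theorem hasCoproductFormula_coaction : P.HasCoproductFormula P.coaction := by
  intro x a a' b b'
  have h := P.isDouble_actionOnAB
  refine P.ext_actionOnAB fun y => ?_
  rw [h.rTensor_doubleMul, DoubleAction.rTensor_coveredCoproduct, ← LinearMap.comp_apply,
    LinearMap.rTensor_comp_map]
  have e : P.actionOnAB.ab.flip y ∘ₗ (LinearMap.mulRight K b').lTensor A =
      P.actionOnAB.ab.flip (P.actionOnAB.actB b' y) :=
    TensorProduct.ext' fun c d => by simp [DoubleAction.actB_mul]
  rw [e, ← lTensor_rTensor_eq_map, P.isLeftCoaction_coaction _ _ _ _ h, lTensor_rTensor_eq_map,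
    rTensor_lTensor_eq_map]

/-- Covering the first leg in `B` and the second leg in `A` from the right loses no information. -/
theorem eq_of_map_mulRight (HA : RegularMultiplierHopfAlgebra K A)
    (HB : RegularMultiplierHopfAlgebra K B) {t t' : (A ⊗[K] B) ⊗[K] (A ⊗[K] B)}
    (h : ∀ (a : A) (b : B), TensorProduct.map ((LinearMap.mulRight K b).lTensor A)
        ((LinearMap.mulRight K a).rTensor B) t =
      TensorProduct.map ((LinearMap.mulRight K b).lTensor A)
        ((LinearMap.mulRight K a).rTensor B) t') : t = t' := by
  have hA : ∀ z : A ⊗[K] B, (∀ a, (LinearMap.mulRight K a).rTensor B z = 0) → z = 0 :=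
    fun z hz => eq_of_rTensor (fun a : A => LinearMap.mulRight K a)
      (fun c hc => HA.nondeg.1 c fun d => hc d) fun a => by rw [hz a, map_zero]
  have hB : ∀ z : A ⊗[K] B, (∀ b, (LinearMap.mulRight K b).lTensor A z = 0) → z = 0 :=
    fun z hz => eq_of_lTensor (fun b : B => LinearMap.mulRight K b)
      (fun c hc => HB.nondeg.1 c fun d => hc d) fun b => by rw [hz b, map_zero]
  refine eq_of_lTensor (fun a => (LinearMap.mulRight K a).rTensor B) hA fun a =>
    eq_of_rTensor (fun b => (LinearMap.mulRight K b).lTensor A) hB fun b => ?_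
  rw [rTensor_lTensor_eq_map, rTensor_lTensor_eq_map]
  exact h a b

variable {P} in
theorem HasCoproductFormula.unique
    {Γ Γ' : A ⊗[K] B →ₗ[K] CompletedModule P.doubleMul (A ⊗[K] B)}
    (h : P.HasCoproductFormula Γ) (h' : P.HasCoproductFormula Γ') : Γ = Γ' :=
  P.coaction_ext fun x => LinearMap.congr_fun (TensorProduct.ext' fun a b =>
    eq_of_map_mulRight HA HB fun a' b' => (h x a a' b b').trans (h' x a a' b b').symm)

theorem doubleΔ_eq_coaction : P.doubleΔ = P.coaction :=
  HasCoproductFormula.unique (Classical.epsilon_spec ⟨_, P.hasCoproductFormula_coaction⟩)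
    P.hasCoproductFormula_coaction

/-- If `Γ(z) = 0`, then `a₍₂₎ b₍₁₎ v ⊗ (a₍₁₎ ⊗ b₍₂₎) = 0` for `z = a ⊗ b`, and its slices say that the
translates of `z` act by zero on a faithful module. -/
theorem injective_coaction : Function.Injective P.coaction := by
  refine (injective_iff_map_eq_zero _).2 fun z hz => P.eq_zero_of_translate z fun c d =>
    P.isFaithful_actionOnAB _ fun y => ?_
  have : P.actionOnAB.coverAB z y = 0 :=
    eq_of_rTensor (fun x => P.actionOnAB.ab x) P.separating_actionOnAB fun x => by
      rw [← P.isLeftCoaction_coaction x z _ _ P.isDouble_actionOnAB]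
      simp [coverMap, hz]
  rw [← DoubleAction.sliceR_coverAB, this, map_zero]

section Joint

variable {P} {V : Type (max u v)} [AddCommGroup V] [Module K V] {W : Type*} [AddCommGroup W]
  [Module K W] {ρ : DoubleAction P V} {σ : DoubleAction P W}

open DoubleAction

/-- `(x ⊗ 1) Γ(z)` acts on `V ⊗ W` as `z` on the tensor product of the modules, followed by `x ⊗ 1`. -/
theorem joint_coaction (hρ : ρ.IsDouble) (x z : A ⊗[K] B) :
    joint ρ σ (coverMap P.coaction x z) = (ρ.ab x).rTensor W ∘ₗ (ρ.tensor σ).ab z :=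
  TensorProduct.ext' fun y y' => by
    rw [joint_apply_tmul, P.isLeftCoaction_coaction x z V ρ hρ, LinearMap.comp_apply,
      tensor_ab_tmul, lTensor_rTensor_eq_map, rTensor_lTensor_eq_map]

theorem joint_lTensor_heisenbergMul (hσ : σ.IsHeisenberg) (y : A ⊗[K] B)
    (t : (A ⊗[K] B) ⊗[K] (A ⊗[K] B)) :
    joint ρ σ ((P.heisenbergMul y).lTensor _ t) = (σ.ab y).lTensor V ∘ₗ joint ρ σ t := by
  induction t using TensorProduct.induction_on with
  | zero => simp
  | add x y hx hy => simp only [map_add, hx, hy, LinearMap.comp_add]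
  | tmul d y' =>
    rw [LinearMap.lTensor_tmul, joint_tmul, joint_tmul, LinearMap.lTensor_comp_map]
    congr 1
    exact LinearMap.ext fun w => hσ.ab_mul y y' w

theorem joint_mulOnRight (hρ : ρ.IsDouble) (hσ : σ.IsHeisenberg) (z : A ⊗[K] B)
    (t : (A ⊗[K] B) ⊗[K] (A ⊗[K] B)) :
    joint ρ σ (CompletedModule.mulOnRight P.heisenbergMul (P.coaction z) t) =
      joint ρ σ t ∘ₗ (ρ.tensor σ).ab z := by
  induction t using TensorProduct.induction_on with
  | zero => simp
  | add x y hx hy => simp only [map_add, hx, hy, LinearMap.add_comp]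
  | tmul d y =>
    rw [CompletedModule.mulOnRight_tmul, joint_lTensor_heisenbergMul hσ]
    change _ ∘ₗ joint ρ σ (coverMap P.coaction d z) = _
    rw [joint_coaction hρ, joint_tmul, ← LinearMap.comp_assoc, LinearMap.lTensor_comp_rTensor]

end Joint

/-- Tested on `V ⊗ W` with `V = A ⊗ B` and `W = A`, where the Heisenberg double acts. -/
theorem coaction_heisenbergMul (h k : A ⊗[K] B) : P.coaction (P.heisenbergMul h k) =
    CompletedModule.mul P.heisenbergMul (P.coaction h) (P.coaction k) := by
  refine CompletedModule.ext_fromLeft P.eq_zero_of_doubleMul (LinearMap.ext fun x => ?_)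
  change coverMap P.coaction x _ =
    CompletedModule.mulOnRight P.heisenbergMul (P.coaction k) (coverMap P.coaction x h)
  have hD := P.isDouble_actionOnAB
  have hH := P.isHeisenberg_actionOnA
  refine eq_of_lTensor (fun w => P.actionOnA.ab.flip w) P.isFaithful_actionOnA fun w =>
    P.ext_actionOnAB fun y => ?_
  have := congrArg (fun f => f (y ⊗ₜ w))
    (show DoubleAction.joint P.actionOnAB P.actionOnA _ = DoubleAction.joint _ _ _ from
      ((joint_coaction hD x (P.heisenbergMul h k)).trans ?_).trans
        (joint_mulOnRight hD hH k (coverMap P.coaction x h)).symm)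
  · simp only [DoubleAction.joint_apply_tmul] at this
    rw [rTensor_lTensor_eq_map, rTensor_lTensor_eq_map, ← lTensor_rTensor_eq_map,
      ← lTensor_rTensor_eq_map]
    exact this
  · rw [joint_coaction hD, LinearMap.comp_assoc]
    congr 1
    exact LinearMap.ext fun t => (hD.tensor_isHeisenberg hH).ab_mul h k t

section Coassociativity

variable {P} {V : Type (max u v)} [AddCommGroup V] [Module K V] {ρ : DoubleAction P V}

open DoubleAction

theorem map_assoc_rTensor_coaction (hρ : ρ.IsDouble) (p : A ⊗[K] B) (y y' : V)
    (s : (A ⊗[K] B) ⊗[K] (A ⊗[K] B)) :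
    TensorProduct.map (ρ.ab.flip y) ((ρ.ab.flip y').rTensor (A ⊗[K] B))
        (TensorProduct.assoc K _ _ _ ((coverMap P.coaction p).rTensor _ s)) =
      TensorProduct.assoc K V V (A ⊗[K] B) (((ρ.ab p).rTensor V).rTensor (A ⊗[K] B)
        (((ρ.tensor ρ).ab.flip (y ⊗ₜ y')).rTensor (A ⊗[K] B) s)) := by
  induction s using TensorProduct.induction_on with
  | zero => simp
  | add x y hx hy => simp only [map_add, hx, hy]
  | tmul d h =>
    have e := LinearMap.congr_fun (joint_coaction (σ := ρ) hρ p d) (y ⊗ₜ y')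
    rw [LinearMap.comp_apply, joint_apply_tmul] at e
    rw [LinearMap.rTensor_tmul, LinearMap.rTensor_tmul, LinearMap.rTensor_tmul,
      LinearMap.flip_apply, ← e]
    generalize coverMap P.coaction p d = t
    induction t using TensorProduct.induction_on with
    | zero => simp
    | add x y hx hy => simp only [map_add, TensorProduct.add_tmul, hx, hy]
    | tmul d d' => simp

theorem map_coverTwice_coaction (hρ : ρ.IsDouble) (x : A ⊗[K] B) (y y' : V)
    (t : (A ⊗[K] B) ⊗[K] (A ⊗[K] B)) :
    TensorProduct.map (ρ.ab.flip y) ((ρ.ab.flip y').rTensor (A ⊗[K] B))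
        (coverTwice P.coaction x t) =
      TensorProduct.assoc K V V (A ⊗[K] B) ((joint ρ ρ t).rTensor (A ⊗[K] B)
        ((ρ.tensor ρ).coverAB x (y ⊗ₜ y'))) := by
  induction t using TensorProduct.induction_on with
  | zero => simp
  | add x y hx hy => simp only [map_add, hx, hy, LinearMap.rTensor_add, LinearMap.add_apply]
  | tmul d e =>
    have h₁ : (ρ.ab.flip y').rTensor (A ⊗[K] B) ∘ₗ coverMap P.coaction e =
        (ρ.ab e).rTensor (A ⊗[K] B) ∘ₗ ρ.coverAB.flip y' :=
      LinearMap.ext fun z => P.isLeftCoaction_coaction e z V ρ hρ y'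
    rw [coverTwice_tmul, ← LinearMap.comp_apply, LinearMap.map_comp_lTensor, h₁,
      ← LinearMap.lTensor_comp_rTensor, LinearMap.comp_apply,
      P.isLeftCoaction_coaction d x V ρ hρ y, joint_tmul, tensor_coverAB_tmul]
    generalize ρ.coverAB x y = u
    induction u using TensorProduct.induction_on with
    | zero => simp
    | add x y hx hy => simp only [map_add, hx, hy]
    | tmul v z =>
      simp only [LinearMap.rTensor_tmul, LinearMap.lTensor_tmul, LinearMap.comp_apply]
      generalize ρ.coverAB.flip y' z = u
      induction u using TensorProduct.induction_on with
      | zero => simp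
      | add x y hx hy => simp only [map_add, TensorProduct.tmul_add, hx, hy]
      | tmul v z => simp

end Coassociativity

/-- Tested on `V ⊗ V` with `V = A ⊗ B`. Both sides give `a₍₂₎ b₍₁₎ (v ⊗ v') ⊗ (a₍₁₎ ⊗ b₍₂₎)`, followed by
the operators of `q` on `V ⊗ V` and of `p` on the first factor. -/
theorem isCoassociative_coaction : IsCoassociative P.coaction P.coaction := by
  intro p q x
  have h := P.isDouble_actionOnAB
  refine eq_of_lTensor (fun y' => (P.actionOnAB.ab.flip y').rTensor (A ⊗[K] B))
    (fun t ht => P.ext_actionOnAB fun y => (ht y).trans (map_zero _).symm) fun y' =>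
      P.ext_actionOnAB fun y => ?_
  rw [rTensor_lTensor_eq_map, rTensor_lTensor_eq_map, map_assoc_rTensor_coaction h, map_coverTwice_coaction h, joint_coaction h,
    P.isLeftCoaction_coaction q x _ _ (h.tensor h), LinearMap.rTensor_comp_apply]

end MultiplierHopfPairing

theorem proposition3p5 {K A B : Type*} [Field K]
    [NonUnitalRing A] [Module K A] [IsScalarTower K A A] [SMulCommClass K A A]
    [NonUnitalRing B] [Module K B] [IsScalarTower K B B] [SMulCommClass K B B]
    (HA : RegularMultiplierHopfAlgebra K A) (HB : RegularMultiplierHopfAlgebra K B)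
    (P : MultiplierHopfPairing HA HB) :
    ∃ Γ : A ⊗[K] B →ₗ[K] CompletedModule P.doubleMul (A ⊗[K] B),
      P.HasCoproductFormula Γ ∧
      (∀ Γ' : A ⊗[K] B →ₗ[K] CompletedModule P.doubleMul (A ⊗[K] B),
        P.HasCoproductFormula Γ' → Γ' = Γ) ∧
      IsLeftComoduleAlgebra P.doubleΔ P.heisenbergMul Γ := by
  refine ⟨P.coaction, P.hasCoproductFormula_coaction, fun Γ' h =>
    h.unique P.hasCoproductFormula_coaction, ?_⟩
  exact
    { assoc := P.associative_heisenbergMul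
      nondeg := P.nondegenerate_heisenbergMul
      injective := P.injective_coaction
      coassoc := by rw [P.doubleΔ_eq_coaction]; exact P.isCoassociative_coaction
      map_mul := P.coaction_heisenbergMul }
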